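/- Let $\mathbb F=\mathbb R,\mathbb C$ or $\mathbb H$, $\beta=\dim_{\mathbb R}\mathbb F$, $r\ge 1$, and let $(B_x)_{x\ge0}$ be a standard self-adjoint $r\times r$ matrix Brownian motion over $\mathbb F$: it has continuous self-adjoint paths, $B_0=0$, and independent increments, with $B_t-B_s$ distributed as $\sqrt{t-s}\,(X+X^\dagger)/\sqrt2$, where the entries of $X$ are independent standard $\mathbb F$-Gaussians ($\mathbb E|X_{ij}|^2=1$). Consider the multivariate stochastic Airy operator $\mathcal H=-\frac{d^2}{dx^2}+\sqrt2\,B'_x+rx$ on $L^2(\mathbb R_+,\mathbb F^r)$. The boundary condition $f'(0)=Wf(0)$ is given by $W=\sum_{i=1}^r w_iu_iu_i^\dagger$ with $u_1,\dots,u_r$ an orthonormal basis of $\mathbb F^r$ and $w_i\in(-\infty,\infty]$, where $w_i=\infty$ means $u_i^\dagger f(0)=0$. Put $$\tilde I=\sum_{w_i<\infty}u_iu_i^\dagger,\qquad \tilde W=\sum_{w_i<\infty}w_iu_iu_i^\dagger+\sum_{w_i=\infty}u_iu_i^\dagger .$$ With $g=f'-\sqrt2Bf$, the equation $\mathcal Hf=\lambda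 f$ becomes the system $$f'=\sqrt2\,B_xf+g,\qquad g'=(rx-\lambda-2B_x^2)f-\sqrt2\,B_xg\qquad(x\ge0),$$ with boundary condition $-\tilde Wf(0)+\tilde Ig(0)=0$. An eigenvalue is a real $\mu$ for which the system with $\lambda$ replaced by $\mu$ and this boundary condition have a solution $(f,g)$ with $0\ne f\in L^2(\mathbb R_+,\mathbb F^r)$; its multiplicity is the dimension (as a right $\mathbb F$-space) of the space of such $f$ together with $0$. Almost surely, for all such $W$ and all $\lambda\in\mathbb R$ simultaneously, the following holds. Let $F,G:\mathbb R_+\to\mathbb F^{r\times r}$ be the matrix solution of the system (each column of $\begin{bmatrix}F\\G\end{bmatrix}$ is a solution) with $F(0)=\tilde I$, $G(0)=\tilde W$. Then $(F,G)$ is a conjoined basis: $F^\dagger G=G^\dagger F$ and $\begin{bmatrix}F\\G\end{bmatrix}$ has rank $r$ at every $x\ge0$. The number of focal points of $F$ in $(0,\infty)$ (points $x$ at which $F(x)$ is singular, counted with multiplicity equal to the nullity of $F(x)$) is finite and equals the number of eigenvalues strictly below $\lambda$, counted with multiplicity. The same holds if the eigenvalues are understood in the weak sense, that is, as the real $\mu$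 for which there is an $f\neq0$ in $L^*$ with $$\langle\varphi',f'\rangle-\langle\varphi',Yf\rangle-\langle\varphi,Yf'\rangle+\varphi(0)^\dagger Wf(0)=\mu\langle\varphi,f\rangle$$ for all smooth compactly supported $\varphi:\mathbb R_+\to\mathbb F^r$ whose Dirichlet components $u_i^\dagger\varphi$ ($w_i=\infty$) are supported away from $0$, with multiplicities equal to the dimensions of the spaces of such $f$ together with $0$. Here $\langle\varphi,\psi\rangle=\int_0^\infty\varphi^\dagger\psi$, $Y(x)=\sqrt2B_x+\frac12rx^2$, the Dirichlet part of the boundary term is zero, and $L^*$ is the space of functions $f$ with a weak derivative $f'$, $\int_0^\infty(|f'|^2+(1+rx)|f|^2)\,dx<\infty$, and $u_i^\dagger f(0)=0$ whenever $w_i=\infty$. -/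

import Mathlib

open MeasureTheory ProbabilityTheory Set Matrix
open scoped NNReal ENNReal

noncomputable section

namespace StochasticAiry

/-! ### The scalars: real numbers, complex numbers, quaternions -/

/-- The classical scalar fields. A finite-dimensional real normed division algebra with an
involution such that `star x * x = ‖x‖ ^ 2` is, by the theorem of Frobenius, one of `ℝ`, `ℂ`, `ℍ`
with its usual absolute value and conjugation; these three are shown to be instances below. -/
class IsClassicalField (𝔽 : Type*) [NormedDivisionRing 𝔽] [StarRing 𝔽]
    [InnerProductSpace ℝ 𝔽] : Prop extends
    IsScalarTower ℝ 𝔽 𝔽, SMulCommClass ℝ 𝔽 𝔽, Module.Finite ℝ 𝔽 where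
  star_mul_self : ∀ x : 𝔽, star x * x = (‖x‖ ^ 2 : ℝ) • (1 : 𝔽)

instance isClassicalField_real : IsClassicalField ℝ where
  star_mul_self x := by simp [sq]

instance isClassicalField_complex : IsClassicalField ℂ where
  star_mul_self x := by
    simpa using Complex.conj_mul' x

instance isClassicalField_quaternion : IsClassicalField (Quaternion ℝ) where
  star_mul_self x := by
    rw [Quaternion.star_mul_self, Quaternion.normSq_eq_norm_mul_self, ← sq, Algebra.smul_def,
      mul_one]
    rfl

/-! ### Gaussian matrices and matrix Brownian motion -/

instance instMeasurableSpaceMatrix (m n α : Type*) [MeasurableSpace α] :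
    MeasurableSpace (Matrix m n α) :=
  inferInstanceAs (MeasurableSpace (m → n → α))

/-- The law `𝔽N(0,1)`: with `β = dim_ℝ 𝔽`, the law of `β ^ (-1/2) (g₁ e₁ + ⋯ + g_β e_β)`, where
the `gᵢ` are independent standard real Gaussians and `eᵢ` is an orthonormal real basis of `𝔽`
(such as `1`, or `1, i`, or `1, i, j, k`). -/
def gaussianScalar (𝔽 : Type*) [NormedDivisionRing 𝔽] [StarRing 𝔽] [InnerProductSpace ℝ 𝔽]
    [IsClassicalField 𝔽] [MeasurableSpace 𝔽] : Measure 𝔽 :=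
  (stdGaussian 𝔽).map (fun z => (√(Module.finrank ℝ 𝔽 : ℝ))⁻¹ • z)

/-- The Gaussian orthogonal / unitary / symplectic ensemble: the law of `(X + X†) / √2`, where `X`
is an `r × r` matrix of independent `𝔽N(0,1)` entries. -/
def gaussianEnsemble (r : ℕ) (𝔽 : Type*) [NormedDivisionRing 𝔽] [StarRing 𝔽]
    [InnerProductSpace ℝ 𝔽] [IsClassicalField 𝔽] [MeasurableSpace 𝔽] :
    Measure (Matrix (Fin r) (Fin r) 𝔽) :=
  (Measure.pi fun _ : Fin r => Measure.pi fun _ : Fin r => gaussianScalar 𝔽).map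
    (fun X => (√2 : ℝ)⁻¹ • (Matrix.of X + (Matrix.of X)ᴴ))

/-- Standard matrix Brownian motion: continuous self-adjoint paths, `B_0 = 0`, and independent
increments with `B_t - B_s` distributed as `√(t - s)` times a GO/U/SE matrix. -/
structure IsStandardMatrixBM {r : ℕ} {𝔽 Ω : Type*} [NormedDivisionRing 𝔽] [StarRing 𝔽]
    [InnerProductSpace ℝ 𝔽] [IsClassicalField 𝔽] [MeasurableSpace 𝔽] [MeasurableSpace Ω]
    (B : ℝ≥0 → Ω → Matrix (Fin r) (Fin r) 𝔽) (P : Measure Ω) : Prop where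
  zero : ∀ᵐ ω ∂P, B 0 ω = 0
  continuous_paths : ∀ᵐ ω ∂P, Continuous fun t => B t ω
  selfAdjoint : ∀ᵐ ω ∂P, ∀ t, (B t ω).IsHermitian
  indep_increments : HasIndepIncrements B P
  law_increments : ∀ s t : ℝ≥0, s ≤ t →
    HasLaw (fun ω => B t ω - B s ω)
      ((gaussianEnsemble r 𝔽).map fun A => √((t : ℝ) - s) • A) P

/-! ### The boundary parameter -/

/-- An element `W = ∑ wᵢ uᵢ uᵢ†` of the extended set of self-adjoint matrices: an orthonormal basis
`u₁, …, u_r` of `𝔽^r` (the columns of `U`) and `wᵢ ∈ (-∞, ∞]`. -/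
structure ExtSelfAdjoint (r : ℕ) (𝔽 : Type*) [NormedDivisionRing 𝔽] [StarRing 𝔽] where
  U : Matrix (Fin r) (Fin r) 𝔽
  orthonormal : Uᴴ * U = 1
  w : Fin r → WithTop ℝ

section

variable {r : ℕ} {𝔽 : Type*} [NormedDivisionRing 𝔽] [StarRing 𝔽] [InnerProductSpace ℝ 𝔽]

/-- The matrix `∑ dᵢ uᵢ uᵢ†`. -/
def ExtSelfAdjoint.spectralSum (W : ExtSelfAdjoint r 𝔽) (d : Fin r → ℝ) :
    Matrix (Fin r) (Fin r) 𝔽 :=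
  W.U * Matrix.diagonal (fun i => d i • (1 : 𝔽)) * W.Uᴴ

open Classical in
/-- `Ĩ = ∑_{wᵢ < ∞} uᵢ uᵢ†`. -/
def ExtSelfAdjoint.tildeI (W : ExtSelfAdjoint r 𝔽) : Matrix (Fin r) (Fin r) 𝔽 :=
  W.spectralSum fun i => if W.w i = ⊤ then 0 else 1

/-- `W̃ = ∑_{wᵢ < ∞} wᵢ uᵢ uᵢ† + ∑_{wᵢ = ∞} uᵢ uᵢ†`. -/
def ExtSelfAdjoint.tildeW (W : ExtSelfAdjoint r 𝔽) : Matrix (Fin r) (Fin r) 𝔽 :=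
  W.spectralSum fun i => (W.w i).untopD 1

/-- `∑_{wᵢ < ∞} wᵢ uᵢ uᵢ†`, that is, `W` with its Dirichlet part set to zero. -/
def ExtSelfAdjoint.finitePart (W : ExtSelfAdjoint r 𝔽) : Matrix (Fin r) (Fin r) 𝔽 :=
  W.spectralSum fun i => (W.w i).untopD 0

/-! ### The first-order system

Below `b : ℝ → M_r(𝔽)` is a noise path, of which only the values on `[0, ∞)` matter. The operator is
`-d²/dx² + √2 b' + r x`, and `g = f' - √2 b f`. -/

/-- `(f, g)` solves `f' = √2 b f + g`, `g' = (r x - lam - 2 b²) f - √2 b g` on `[0, ∞)`. -/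
def IsSolution (b : ℝ → Matrix (Fin r) (Fin r) 𝔽) (lam : ℝ) (f g : ℝ → Fin r → 𝔽) : Prop :=
  ∀ x : ℝ, 0 ≤ x →
    HasDerivWithinAt f ((√2 : ℝ) • (b x *ᵥ f x) + g x) (Ici 0) x ∧
    HasDerivWithinAt g (((r : ℝ) * x - lam) • f x - (2 : ℝ) • (b x *ᵥ (b x *ᵥ f x))
      - (√2 : ℝ) • (b x *ᵥ g x)) (Ici 0) x

/-- Matrix solutions: each column of `F` over `G` is a solution. -/
def IsMatrixSolution (b : ℝ → Matrix (Fin r) (Fin r) 𝔽) (lam : ℝ)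
    (F G : ℝ → Matrix (Fin r) (Fin r) 𝔽) : Prop :=
  ∀ j, IsSolution b lam (fun x i => F x i j) (fun x i => G x i j)

/-- Conjoined bases: matrix solutions with `F† G = G† F` and such that `F` over `G` has rank `r`
(its columns are linearly independent). -/
structure IsConjoinedBasis (b : ℝ → Matrix (Fin r) (Fin r) 𝔽) (lam : ℝ)
    (F G : ℝ → Matrix (Fin r) (Fin r) 𝔽) : Prop where
  isMatrixSolution : IsMatrixSolution b lam F G
  symm : ∀ x : ℝ, 0 ≤ x → (F x)ᴴ * G x = (G x)ᴴ * F x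
  rank : ∀ x : ℝ, 0 ≤ x → ∀ v : Fin r → 𝔽, F x *ᵥ v = 0 → G x *ᵥ v = 0 → v = 0

/-! ### Dimensions and counting

`𝔽^r` consists of column vectors, on which matrices act from the left and scalars from the right;
right `𝔽`-spaces are modules over `𝔽ᵐᵒᵖ`. -/

/-- The dimension of a right `𝔽`-subspace, in `ℕ ∪ {∞}`. -/
def rightDim {V : Type*} [AddCommGroup V] [Module 𝔽ᵐᵒᵖ V] (S : Submodule 𝔽ᵐᵒᵖ V) : ℕ∞ :=
  Cardinal.toENat (Module.rank 𝔽ᵐᵒᵖ S)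

/-- The null space of a matrix. -/
def nullSpace (A : Matrix (Fin r) (Fin r) 𝔽) : Submodule 𝔽ᵐᵒᵖ (Fin r → 𝔽) where
  carrier := {v | A *ᵥ v = 0}
  add_mem' := by
    intro v w hv hw
    simp only [mem_ofPred_eq] at *
    rw [Matrix.mulVec_add, hv, hw, add_zero]
  zero_mem' := by simp
  smul_mem' := by
    intro c v hv
    simp only [mem_ofPred_eq] at *
    rw [Matrix.mulVec_smul, hv, smul_zero]

/-- The nullity of a matrix; it is positive exactly when the matrix is singular. -/
def nullity (A : Matrix (Fin r) (Fin r) 𝔽) : ℕ∞ := rightDim (nullSpace A)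

/-- The number of points of `S`, where `x` is counted `m x` times. -/
def countWithMult (S : Set ℝ) (m : ℝ → ℕ∞) : ℕ∞ :=
  {p : ℝ × ℕ | p.1 ∈ S ∧ (p.2 : ℕ∞) < m p.1}.encard

/-- The number of focal points of `F` in `(0, ∞)`, where `x` has multiplicity `nullity (F x)`. -/
def focalCount (F : ℝ → Matrix (Fin r) (Fin r) 𝔽) : ℕ∞ :=
  countWithMult (Ioi 0) fun x => nullity (F x)

/-! ### The eigenvalue problem: square-integrable solutions of the system

Functions on `[0, ∞)` are extended by zero to the negative half-line, so that two functions are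
equal exactly when they agree on `[0, ∞)`. -/

/-- `f` is a nonzero function in `L²(ℝ₊, 𝔽^r)` which, together with some `g`, solves the system with
spectral parameter `mu` and satisfies the boundary condition `-W̃ f(0) + Ĩ g(0) = 0`. -/
structure IsL2Eigenfunction (b : ℝ → Matrix (Fin r) (Fin r) 𝔽) (W : ExtSelfAdjoint r 𝔽) (mu : ℝ)
    (f : ℝ → Fin r → 𝔽) : Prop where
  zero_of_neg : ∀ x < 0, f x = 0
  ne_zero : f ≠ 0
  memLp : ∀ i, MemLp (fun x => f x i) 2 (volume.restrict (Ioi 0))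
  exists_solution : ∃ g : ℝ → Fin r → 𝔽, IsSolution b mu f g ∧
    -(W.tildeW *ᵥ f 0) + W.tildeI *ᵥ g 0 = 0

/-- The multiplicity of `mu` as an eigenvalue (`0` if it is not an eigenvalue). -/
def l2Mult (b : ℝ → Matrix (Fin r) (Fin r) 𝔽) (W : ExtSelfAdjoint r 𝔽) (mu : ℝ) : ℕ∞ :=
  rightDim (Submodule.span 𝔽ᵐᵒᵖ {f : ℝ → Fin r → 𝔽 | IsL2Eigenfunction b W mu f})

/-- The number of eigenvalues strictly below `lam`, counted with multiplicity. -/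
def l2EigenvalueCount (b : ℝ → Matrix (Fin r) (Fin r) 𝔽) (W : ExtSelfAdjoint r 𝔽) (lam : ℝ) : ℕ∞ :=
  countWithMult (Iio lam) (l2Mult b W)

/-! ### The eigenvalue problem: the weak form -/

/-- Test functions: smooth, compactly supported, with Dirichlet components `uᵢ† φ` (`wᵢ = ∞`)
supported away from the origin. -/
structure IsTestFunction (W : ExtSelfAdjoint r 𝔽) (φ : ℝ → Fin r → 𝔽) : Prop where
  smooth : ContDiff ℝ ((⊤ : ℕ∞) : WithTop ℕ∞) φ
  compact_support : HasCompactSupport φ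
  dirichlet : ∀ i, W.w i = ⊤ → ∃ ε > 0, ∀ x, 0 ≤ x → x < ε → (W.Uᴴ *ᵥ φ x) i = 0

/-- The form domain `L*`: `f`, with weak derivative `h`, is in the closure of the test functions
under the norm `∫ |f'|² + (1 + r x) |f|²`, i.e. this weighted Sobolev norm is finite and the
Dirichlet components of `f` vanish at `0`. -/
structure IsInFormDomain (W : ExtSelfAdjoint r 𝔽) (f h : ℝ → Fin r → 𝔽) : Prop where
  eq_integral : ∀ x : ℝ, 0 ≤ x → f x = f 0 + ∫ t in (0 : ℝ)..x, h t
  memLp_deriv : ∀ i, MemLp (fun x => h x i) 2 (volume.restrict (Ioi 0))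
  memLp_weighted : ∀ i, MemLp (fun x : ℝ => √(1 + (r : ℝ) * x) • f x i) 2 (volume.restrict (Ioi 0))
  dirichlet : ∀ i, W.w i = ⊤ → (W.Uᴴ *ᵥ f 0) i = 0

/-- The integrated potential `Y(x) = √2 b(x) + r x² / 2`. -/
def integratedPotential (b : ℝ → Matrix (Fin r) (Fin r) 𝔽) (x : ℝ) : Matrix (Fin r) (Fin r) 𝔽 :=
  (√2 : ℝ) • b x + ((r : ℝ) * x ^ 2 / 2) • (1 : Matrix (Fin r) (Fin r) 𝔽)

/-- The inner product `∫₀^∞ f† g`. -/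
def innerL2 (f g : ℝ → Fin r → 𝔽) : 𝔽 := ∫ x in Ioi (0 : ℝ), star (f x) ⬝ᵥ g x

/-- The sesquilinear form `⟨φ', f'⟩ - ⟨φ', Y f⟩ - ⟨φ, Y f'⟩ + φ(0)† W f(0)` (the Dirichlet part of
the last term being zero), where `dφ`, `h` stand for the derivatives of `φ`, `f`. -/
def airyForm (b : ℝ → Matrix (Fin r) (Fin r) 𝔽) (W : ExtSelfAdjoint r 𝔽)
    (φ dφ f h : ℝ → Fin r → 𝔽) : 𝔽 :=
  innerL2 dφ h - innerL2 dφ (fun x => integratedPotential b x *ᵥ f x)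
    - innerL2 φ (fun x => integratedPotential b x *ᵥ h x)
    + star (φ 0) ⬝ᵥ (W.finitePart *ᵥ f 0)

/-- `f ≠ 0` is in the form domain and the form of `φ` and `f` is `mu ⟨φ, f⟩` for all test
functions `φ`. -/
structure IsWeakEigenfunction (b : ℝ → Matrix (Fin r) (Fin r) 𝔽) (W : ExtSelfAdjoint r 𝔽) (mu : ℝ)
    (f : ℝ → Fin r → 𝔽) : Prop where
  zero_of_neg : ∀ x < 0, f x = 0
  ne_zero : f ≠ 0
  weak_equation : ∃ h : ℝ → Fin r → 𝔽, IsInFormDomain W f h ∧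
    ∀ φ : ℝ → Fin r → 𝔽, IsTestFunction W φ →
      airyForm b W φ (deriv φ) f h = mu • innerL2 φ f

/-- The multiplicity of `mu` as an eigenvalue of the form (`0` if it is not an eigenvalue). -/
def weakMult (b : ℝ → Matrix (Fin r) (Fin r) 𝔽) (W : ExtSelfAdjoint r 𝔽) (mu : ℝ) : ℕ∞ :=
  rightDim (Submodule.span 𝔽ᵐᵒᵖ {f : ℝ → Fin r → 𝔽 | IsWeakEigenfunction b W mu f})

/-- The number of eigenvalues of the form strictly below `lam`, counted with multiplicity. -/
def weakEigenvalueCount (b : ℝ → Matrix (Fin r) (Fin r) 𝔽) (W : ExtSelfAdjoint r 𝔽) (lam : ℝ) :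
    ℕ∞ :=
  countWithMult (Iio lam) (weakMult b W)

end

/-- The path `x ↦ B_x(ω)` as a function on the real line (constant for `x < 0`). -/
def noisePath {r : ℕ} {𝔽 Ω : Type*} (B : ℝ≥0 → Ω → Matrix (Fin r) (Fin r) 𝔽) (ω : Ω) :
    ℝ → Matrix (Fin r) (Fin r) 𝔽 :=
  fun x => B x.toNNReal ω

end StochasticAiry

end

/-! The core is a deterministic oscillation theorem (`exists_sum_finrank_eq`) for a real Hamiltonian
system `f' = A f + g`, `g' = (p - μ - A²) f - A g`, applied to almost every noise path. Its
quadratic form is q(f) = ⟨β f(0), f(0)⟩ + ∫ (|f'|² - 2⟨f', A f⟩ + ⟨p f, f⟩), and both inequalities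
compare q with λ‖f‖² on finite-dimensional subspaces of the form domain.

Focal points ≤ eigenvalues. If F(x)v = 0, the solution Fv cut off at x is still continuous, so it
lies in the form domain, and q - λ pairs it with φ as ⟨φ(x), G(x)v⟩. Since F†G = G†F, the span of
these truncations over all focal points is isotropic for q - λ (`exists_broken`). If its dimension
exceeded the number of eigenvalues below λ, some nonzero z in it would be L²-orthogonal to their
eigenspaces. Minimizing the Rayleigh quotient on the orthogonal complement then produces a further
eigenvalue κ ≤ λ. The case κ < λ is excluded by orthogonality. If κ = λ, then z itself is an
eigenfunction, which is impossible because z vanishes far out while a solution vanishing on an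
interval is zero (`sum_finrank_ker_le`).

Eigenvalues ≤ focal points. If f = F h, then the energy density of q - λ equals (⟨f, G h⟩)' + |F
h'|², which is Picone's identity; hence q(f) ≥ λ‖f‖². This survives finitely many singular points of
F as long as f takes values in the range of F there (`IsFrame.picone`). That imposes as many linear
conditions as the total nullity of F. On the span of eigenfunctions below λ one has q < λ‖·‖² away
from 0, so these conditions cut the span down to 0 (`sum_finrank_eigenspace_le`).

Finiteness and the existence of minimizers come from coercivity of q together with compactness of
the embedding of the form domain into L² (`norm_emb_sq_le`, `exists_rayleigh_minimizer`).

For the Airy system A is √2 times Brownian motion and no such coercivity bound is at hand. The gauge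
change g ↦ g + S f replaces A by A - S and p by p + S' while leaving f, hence the focal points,
unchanged. With S essentially the average of A over a unit window, A - S and S' are controlled by
increments of A over unit intervals (`exists_isCoercive_isGauge`). Almost surely the squares of
these increments are at most εx + C, by fourth moments and dyadic chaining
(`ae_exists_norm_sub_sq_le`).

Finally, square-integrable solutions, eigenvectors of the coercive form and weak eigenfunctions are
the same functions (`isL2Eigenfunction_iff`, `isWeakEigenfunction_iff`). The argument runs over ℝ,
which multiplies every right 𝔽-dimension by β = dim 𝔽; this common factor cancels at the end. -/

noncomputable section

set_option linter.unusedSectionVars false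

namespace StochasticAiry

/-! ### Integration by parts and the du Bois-Reymond lemma on the half-line -/

section Primitive

variable {E : Type*} [NormedAddCommGroup E] [InnerProductSpace ℝ E]

/-- Integrability on every interval `[0, T]`. -/
def LocInt {E : Type*} [NormedAddCommGroup E] (k : ℝ → E) : Prop :=
  ∀ T : ℝ, 0 ≤ T → IntervalIntegrable k volume 0 T

lemma LocInt.of_continuousOn {k : ℝ → E} (hk : ContinuousOn k (Ici 0)) : LocInt k := by
  intro T hT
  apply ContinuousOn.intervalIntegrable
  rw [uIcc_of_le hT]
  exact hk.mono Icc_subset_Ici_self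

lemma LocInt.add {k l : ℝ → E} (hk : LocInt k) (hl : LocInt l) : LocInt (fun x => k x + l x) :=
  fun T hT => (hk T hT).add (hl T hT)

lemma LocInt.sub {k l : ℝ → E} (hk : LocInt k) (hl : LocInt l) : LocInt (fun x => k x - l x) :=
  fun T hT => (hk T hT).sub (hl T hT)

lemma LocInt.continuousOn_smul {η : ℝ → ℝ} {k : ℝ → E} (hη : ContinuousOn η (Ici 0))
    (hk : LocInt k) : LocInt (fun x => η x • k x) := by
  intro T hT
  apply (hk T hT).continuousOn_smul
  rw [uIcc_of_le hT]
  exact hη.mono Icc_subset_Ici_self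

lemma LocInt.continuousOn_primitive [CompleteSpace E] {k : ℝ → E} (hk : LocInt k) (c : E) :
    ContinuousOn (fun x => c + ∫ t in (0 : ℝ)..x, k t) (Ici 0) := by
  intro x hx
  have hx' : (0 : ℝ) ≤ x + 1 := by have := mem_Ici.1 hx; linarith
  have h := intervalIntegral.continuousOn_primitive_interval' (hk (x + 1) hx') (left_mem_uIcc)
  rw [uIcc_of_le hx'] at h
  have h2 : ContinuousWithinAt (fun x => ∫ t in (0 : ℝ)..x, k t) (Ici 0) x := by
    refine (h x ⟨hx, by linarith⟩).mono_of_mem_nhdsWithin ?_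
    rw [← Ici_inter_Iic]
    exact Filter.inter_mem self_mem_nhdsWithin
      (mem_nhdsWithin_of_mem_nhds (Iic_mem_nhds (by linarith)))
  exact continuousWithinAt_const.add h2

/-- Primitives of integrable functions are absolutely continuous, and their derivatives are the
integrands almost everywhere. Pointwise differentiability is deliberately not assumed: elements of
the form domain have only weak derivatives. -/
lemma integral_deriv_mul_add_of_primitive {f g h k : ℝ → ℝ} {T c d : ℝ} (hT : 0 ≤ T)
    (hh : IntervalIntegrable h volume 0 T) (hk : IntervalIntegrable k volume 0 T)
    (hf : ∀ x ∈ Icc 0 T, f x = c + ∫ t in (0 : ℝ)..x, h t)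
    (hg : ∀ x ∈ Icc 0 T, g x = d + ∫ t in (0 : ℝ)..x, k t) :
    ∫ x in (0 : ℝ)..T, (h x * g x + f x * k x) = f T * g T - f 0 * g 0 := by
  have key : ∀ (h : ℝ → ℝ) (c : ℝ), IntervalIntegrable h volume 0 T →
      AbsolutelyContinuousOnInterval (fun x => c + ∫ t in (0 : ℝ)..x, h t) 0 T := by
    intro h c hh
    have h1 := hh.absolutelyContinuousOnInterval_intervalIntegral (c := 0) left_mem_uIcc
    have h2 : AbsolutelyContinuousOnInterval (fun _ : ℝ => c) 0 T :=
      (LipschitzOnWith.of_dist_le_mul (K := 0) (by simp)).absolutelyContinuousOnInterval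
    exact h2.add h1
  have hd : ∀ (h : ℝ → ℝ) (c : ℝ), IntervalIntegrable h volume 0 T →
      ∀ᵐ x, x ∈ uIcc 0 T → deriv (fun x => c + ∫ t in (0 : ℝ)..x, h t) x = h x := by
    intro h c hh
    filter_upwards [hh.ae_hasDerivAt_integral] with x hx hxm
    exact ((hx hxm 0 left_mem_uIcc).const_add c).deriv
  have h3 := (key h c hh).integral_deriv_mul_eq_sub (key k d hk)
  rw [hf T ⟨hT, le_rfl⟩, hg T ⟨hT, le_rfl⟩, hf 0 ⟨le_rfl, hT⟩, hg 0 ⟨le_rfl, hT⟩, ← h3]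
  apply intervalIntegral.integral_congr_ae
  filter_upwards [hd h c hh, hd k d hk] with x h1 h2 hx
  have hx' := uIoc_subset_uIcc hx
  rw [h1 hx', h2 hx']
  rw [uIcc_of_le hT] at hx'
  rw [hf x hx', hg x hx']

lemma integral_inner_add_of_primitive [FiniteDimensional ℝ E] {f g h k : ℝ → E} {T : ℝ} {c d : E}
    (hT : 0 ≤ T)
    (hh : IntervalIntegrable h volume 0 T) (hk : IntervalIntegrable k volume 0 T)
    (hf : ∀ x ∈ Icc 0 T, f x = c + ∫ t in (0 : ℝ)..x, h t)
    (hg : ∀ x ∈ Icc 0 T, g x = d + ∫ t in (0 : ℝ)..x, k t) :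
    ∫ x in (0 : ℝ)..T, (inner ℝ (h x) (g x) + inner ℝ (f x) (k x)) =
      inner ℝ (f T) (g T) - inner ℝ (f 0) (g 0) := by
  have : CompleteSpace E := FiniteDimensional.complete ℝ E
  let b := stdOrthonormalBasis ℝ E
  have hcoord : ∀ (h : ℝ → E) (i), IntervalIntegrable h volume 0 T →
      IntervalIntegrable (fun x => inner ℝ (b i) (h x)) volume 0 T := by
    intro h i hh
    exact ⟨(innerSL ℝ (b i)).integrable_comp hh.1, (innerSL ℝ (b i)).integrable_comp hh.2⟩
  have hprim : ∀ (h f : ℝ → E) (c : E) (i), IntervalIntegrable h volume 0 T →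
      (∀ x ∈ Icc 0 T, f x = c + ∫ t in (0 : ℝ)..x, h t) →
      ∀ x ∈ Icc 0 T, inner ℝ (b i) (f x) = inner ℝ (b i) c +
        ∫ t in (0 : ℝ)..x, inner ℝ (b i) (h t) := by
    intro h f c i hh hf x hx
    rw [hf x hx, inner_add_right]
    congr 1
    have hhx : IntervalIntegrable h volume 0 x :=
      hh.mono_set (by rw [uIcc_of_le hx.1, uIcc_of_le hT]; exact Icc_subset_Icc_right hx.2)
    exact ((innerSL ℝ (b i)).intervalIntegral_comp_comm hhx).symm
  have hcf : ContinuousOn f (Icc 0 T) := by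
    have h1 : ContinuousOn (fun x => c + ∫ t in (0 : ℝ)..x, h t) (Icc 0 T) := by
      have := intervalIntegral.continuousOn_primitive_interval' hh left_mem_uIcc
      rw [uIcc_of_le hT] at this
      exact continuousOn_const.add this
    exact h1.congr hf
  have hcg : ContinuousOn g (Icc 0 T) := by
    have h1 : ContinuousOn (fun x => d + ∫ t in (0 : ℝ)..x, k t) (Icc 0 T) := by
      have := intervalIntegral.continuousOn_primitive_interval' hk left_mem_uIcc
      rw [uIcc_of_le hT] at this
      exact continuousOn_const.add this
    exact h1.congr hg
  have key := fun i => integral_deriv_mul_add_of_primitive hT (hcoord h i hh) (hcoord k i hk)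
    (hprim h f c i hh hf) (hprim k g d i hk hg)
  have e : ∀ u v : E, inner ℝ u v = ∑ i, inner ℝ (b i) u * inner ℝ (b i) v := by
    intro u v
    rw [← b.sum_inner_mul_inner u v]
    exact Finset.sum_congr rfl fun i _ => by rw [real_inner_comm]
  have e2 : (fun x => inner ℝ (h x) (g x) + inner ℝ (f x) (k x)) = fun x =>
      ∑ i, (inner ℝ (b i) (h x) * inner ℝ (b i) (g x) +
        inner ℝ (b i) (f x) * inner ℝ (b i) (k x)) := by
    funext x; rw [e, e, Finset.sum_add_distrib]
  rw [e2, intervalIntegral.integral_finsetSum, Finset.sum_congr rfl fun i _ => key i,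
    Finset.sum_sub_distrib, e, e]
  intro i _
  refine IntervalIntegrable.add ?_ ?_
  · apply (hcoord h i hh).mul_continuousOn
    rw [uIcc_of_le hT]
    exact continuousOn_const.inner hcg
  · apply (hcoord k i hk).continuousOn_mul
    rw [uIcc_of_le hT]
    exact continuousOn_const.inner hcf

lemma setIntegral_Ioi_eq_of_eq_zero {E : Type*} [NormedAddCommGroup E] [NormedSpace ℝ E]
    {F : ℝ → E} {T : ℝ} (hT : 0 ≤ T) (h : ∀ x, T < x → F x = 0) :
    ∫ x in Ioi (0 : ℝ), F x = ∫ x in (0 : ℝ)..T, F x := by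
  rw [intervalIntegral.integral_of_le hT]
  apply setIntegral_eq_of_subset_of_forall_sdiff_eq_zero measurableSet_Ioi Ioc_subset_Ioi_self
  intro x hx
  apply h
  by_contra hxT
  exact hx.2 ⟨hx.1, not_lt.1 hxT⟩

lemma exists_forall_gt_eq_zero {η : ℝ → E} (hc : HasCompactSupport η) :
    ∃ T, 0 ≤ T ∧ ∀ x, T ≤ x → η x = 0 := by
  obtain ⟨R, hR⟩ := hc.isCompact.isBounded.subset_closedBall 0
  refine ⟨|R| + 1, by positivity, fun x hx => ?_⟩
  by_contra hne
  have := hR (subset_tsupport _ hne)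
  rw [mem_closedBall_zero_iff, Real.norm_eq_abs] at this
  have h1 := le_abs_self x
  have h2 := le_abs_self R
  linarith

/-- Integration by parts against a test function that may be nonzero at the origin. The surviving
term at 0 is what later encodes the boundary condition. -/
lemma integral_test_of_primitive [FiniteDimensional ℝ E] {u k : ℝ → E} {c : E} (hk : LocInt k)
    (hu : ∀ x, 0 ≤ x → u x = c + ∫ t in (0 : ℝ)..x, k t) {η : ℝ → ℝ}
    (hη : ContDiff ℝ 1 η) (hc : HasCompactSupport η) :
    ∫ x in Ioi (0 : ℝ), (deriv η x • u x + η x • k x) = -(η 0 • c) := by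
  have : CompleteSpace E := FiniteDimensional.complete ℝ E
  obtain ⟨T, hT, hz⟩ := exists_forall_gt_eq_zero hc
  have hdz : ∀ x, T < x → deriv η x = 0 := by
    intro x hx
    have : η =ᶠ[nhds x] fun _ => 0 := by
      filter_upwards [Ioi_mem_nhds hx] with y hy using hz y (le_of_lt hy)
    rw [this.deriv_eq]; simp
  rw [setIntegral_Ioi_eq_of_eq_zero hT (fun x hx => by simp [hdz x hx, hz x hx.le])]
  have hcu : ContinuousOn u (Icc 0 T) :=
    ((hk.continuousOn_primitive c).mono Icc_subset_Ici_self).congr fun x hx => hu x hx.1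
  have hdc : Continuous (deriv η) := hη.continuous_deriv le_rfl
  have hint : IntervalIntegrable (fun x => deriv η x • u x + η x • k x) volume 0 T := by
    refine IntervalIntegrable.add ?_ ?_
    · apply ContinuousOn.intervalIntegrable
      rw [uIcc_of_le hT]
      exact hdc.continuousOn.smul hcu
    · exact (hk T hT).continuousOn_smul hη.continuous.continuousOn
  apply ext_inner_left ℝ
  intro e
  rw [show inner ℝ e (∫ x in (0 : ℝ)..T, (deriv η x • u x + η x • k x)) =
    ∫ x in (0 : ℝ)..T, inner ℝ e (deriv η x • u x + η x • k x) from
    ((innerSL ℝ e).intervalIntegral_comp_comm hint).symm]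
  have h1 : ∀ x ∈ Icc 0 T, η x • e = η 0 • e + ∫ t in (0 : ℝ)..x, deriv η t • e := by
    intro x _
    rw [intervalIntegral.integral_smul_const, intervalIntegral.integral_deriv_eq_sub
      (fun y _ => hη.differentiable one_ne_zero y)
      (hdc.intervalIntegrable _ _), ← add_smul]
    congr 1; ring
  have h2 := integral_inner_add_of_primitive (f := fun x => η x • e) (h := fun x => deriv η x • e)
    (g := u) (k := k) (d := c) hT ((hdc.smul continuous_const).intervalIntegrable _ _) (hk T hT) h1
    (fun x hx => hu x hx.1)
  have hu0 : u 0 = c := by rw [hu 0 le_rfl]; simp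
  rw [hu0, hz T le_rfl] at h2
  rw [inner_neg_right, inner_smul_right, ← real_inner_smul_left]
  simp only [zero_smul, inner_zero_left, zero_sub] at h2
  rw [← h2]
  congr 1
  funext x
  rw [inner_add_right, real_inner_smul_left, real_inner_smul_left, inner_smul_right,
    inner_smul_right]

/-- Subtracting the primitive K of k reduces to a function whose integral against every derivative
of a test function vanishes. Derivatives of test functions are the test functions of mean zero, so
pairing with an arbitrary g depends only on ∫ g, and the function is constant. -/
lemma du_bois_reymond [FiniteDimensional ℝ E] {u k : ℝ → E} (hu : LocInt u) (hk : LocInt k)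
    (h : ∀ η : ℝ → ℝ, ContDiff ℝ ((⊤ : ℕ∞) : WithTop ℕ∞) η → HasCompactSupport η →
      (∃ ε > 0, ∀ x < ε, η x = 0) →
      ∫ x in Ioi (0 : ℝ), (deriv η x • u x + η x • k x) = 0) :
    ∃ c : E, ∀ᵐ x ∂(volume.restrict (Ioi (0 : ℝ))), u x = c + ∫ t in (0 : ℝ)..x, k t := by
  have : CompleteSpace E := FiniteDimensional.complete ℝ E
  set K : ℝ → E := fun x => 0 + ∫ t in (0 : ℝ)..x, k t with hK
  have hKc := hk.continuousOn_primitive 0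
  have hw : LocInt (fun x => u x - K x) := hu.sub (.of_continuousOn hKc)
  have hsm : ∀ (w : ℝ → E), LocInt w → ∀ η : ℝ → ℝ, Continuous η → HasCompactSupport η →
      IntegrableOn (fun x => η x • w x) (Ioi 0) := by
    intro w hw η hη hc
    obtain ⟨T, hT, hz⟩ := exists_forall_gt_eq_zero hc
    have h1 := (LocInt.continuousOn_smul hη.continuousOn hw) T hT
    rw [intervalIntegrable_iff_integrableOn_Ioc_of_le hT] at h1
    exact h1.of_forall_sdiff_eq_zero measurableSet_Ioi
      (fun x hx => by
        rw [hz x (by by_contra hxT; exact hx.2 ⟨hx.1, (not_le.1 hxT).le⟩), zero_smul])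
  have h0 : ∀ η : ℝ → ℝ, ContDiff ℝ ((⊤ : ℕ∞) : WithTop ℕ∞) η → HasCompactSupport η →
      (∃ ε > 0, ∀ x < ε, η x = 0) →
      ∫ x in Ioi (0 : ℝ), deriv η x • (u x - K x) = 0 := by
    intro η hη hc hs
    have h1 := h η hη hc hs
    have hη1 : ContDiff ℝ 1 η := hη.of_le (by exact_mod_cast le_top)
    have h2 := integral_test_of_primitive (u := K) (c := 0) hk (fun x _ => rfl)
      hη1 hc
    have hd := hη1.continuous_deriv le_rfl
    have hdc := hc.deriv
    rw [smul_zero, neg_zero] at h2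
    rw [← sub_eq_zero_of_eq (h1.trans h2.symm), ← integral_sub]
    · congr 1
      funext x
      rw [smul_sub]; abel
    · exact (hsm u hu _ hd hdc).add (hsm k hk _ hη.continuous hc)
    · exact (hsm K (.of_continuousOn hKc) _ hd hdc).add (hsm k hk _ hη.continuous hc)
  -- A normalized bump supported in [1, 3], away from the origin; pairing with it reads off the
  -- constant c.
  let B : ContDiffBump (2 : ℝ) := ⟨1 / 2, 1, by norm_num, by norm_num⟩
  set ψ : ℝ → ℝ := B.normed volume with hψ
  have hψs : ContDiff ℝ ((⊤ : ℕ∞) : WithTop ℕ∞) ψ := B.contDiff_normed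
  have hψc : HasCompactSupport ψ := B.hasCompactSupport_normed
  have hψi : ∫ x, ψ x = 1 := B.integral_normed
  have hψz : ∀ x < (1 : ℝ), ψ x = 0 := by
    intro x hx
    have : x ∉ Function.support ψ := by
      rw [hψ, B.support_normed_eq, Metric.mem_ball, Real.dist_eq, not_lt]
      change 1 ≤ _
      rw [abs_of_neg] <;> linarith
    simpa using this
  set c : E := ∫ x in Ioi (0 : ℝ), ψ x • (u x - K x) with hcdef
  refine ⟨c, ?_⟩
  have hloc : LocallyIntegrableOn (fun x => u x - K x - c) (Ioi (0 : ℝ)) := by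
    have hwc : LocInt (fun x => u x - K x - c) := hw.sub (.of_continuousOn continuousOn_const)
    intro x hx
    refine ⟨Ioc 0 (x + 1), ?_, ?_⟩
    · have : Ioc 0 (x+1) ∈ nhds x := Ioc_mem_nhds hx (by linarith)
      exact mem_nhdsWithin_of_mem_nhds this
    · have h1 := hwc (x + 1) (by have := mem_Ioi.1 hx; linarith)
      rwa [intervalIntegrable_iff_integrableOn_Ioc_of_le
        (by have := mem_Ioi.1 hx; linarith)] at h1
  suffices hsuff : ∀ g : ℝ → ℝ, ContDiff ℝ ((⊤ : ℕ∞) : WithTop ℕ∞) g → HasCompactSupport g →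
      tsupport g ⊆ Ioi 0 → ∫ x, g x • (u x - K x - c) = 0 by
    have key := isOpen_Ioi.ae_eq_zero_of_integral_contDiff_smul_eq_zero hloc hsuff
    rw [ae_restrict_iff' measurableSet_Ioi]
    filter_upwards [key] with x hx hx0
    have := hx hx0
    rw [sub_sub, sub_eq_zero] at this
    rw [this, hK]; simp [add_comm]
  intro g hg hgc hgs
  -- the mean-zero part of `g` is a derivative
  have hzero : ∃ ε > 0, ∀ x < ε, g x = 0 := by
    by_cases hne : (tsupport g).Nonempty
    · obtain ⟨a, ha, hmin⟩ := hgc.isCompact.exists_isLeast hne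
      exact ⟨a, hgs ha, fun x hx => image_eq_zero_of_notMem_tsupport
        fun hx' => absurd (hmin hx') (not_le.2 hx)⟩
    · rw [not_nonempty_iff_eq_empty, tsupport_eq_empty_iff] at hne
      exact ⟨1, one_pos, fun x _ => by simp [hne]⟩
  obtain ⟨ε, hε, hgz⟩ := hzero
  obtain ⟨T1, hT1, hz1⟩ := exists_forall_gt_eq_zero hgc
  obtain ⟨T2, hT2, hz2⟩ := exists_forall_gt_eq_zero hψc
  set m := ∫ x, g x with hm
  set ζ : ℝ → ℝ := fun x => g x - m * ψ x with hζ
  have hζs : ContDiff ℝ ((⊤ : ℕ∞) : WithTop ℕ∞) ζ := hg.sub (contDiff_const.mul hψs)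
  have hζc : Continuous ζ := hζs.continuous
  set δ := min ε 1 with hδ
  have hδ0 : 0 < δ := lt_min hε one_pos
  have hζ0 : ∀ x < δ, ζ x = 0 := fun x hx => by
    simp only [hζ]
    rw [hgz x (hx.trans_le (min_le_left _ _)), hψz x (hx.trans_le (min_le_right _ _))]; ring
  have hζT : ∀ x, max T1 T2 ≤ x → ζ x = 0 := fun x hx => by
    simp only [hζ]
    rw [hz1 x ((le_max_left _ _).trans hx), hz2 x ((le_max_right _ _).trans hx)]; ring
  have hζi : ∫ x, ζ x = 0 := by
    simp only [hζ]
    rw [integral_sub (hg.continuous.integrable_of_hasCompactSupport hgc)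
      ((hψs.continuous.integrable_of_hasCompactSupport hψc).const_mul m),
      integral_const_mul, hψi, hm]; ring
  -- ζ = g - (∫ g) ψ has mean zero and support in a compact subset of (0, ∞), so its primitive is an
  -- admissible test function.
  set η : ℝ → ℝ := fun x => ∫ t in (0 : ℝ)..x, ζ t with hηdef
  have hηd : ∀ x, HasDerivAt η (ζ x) x := fun x =>
    intervalIntegral.integral_hasDerivAt_right (hζc.intervalIntegrable _ _)
      (hζc.stronglyMeasurableAtFilter _ _) hζc.continuousAt
  have hderiv : deriv η = ζ := funext fun x => (hηd x).deriv
  have hηs : ContDiff ℝ ((⊤ : ℕ∞) : WithTop ℕ∞) η :=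
    contDiff_infty_iff_deriv.2 ⟨fun x => (hηd x).differentiableAt, hderiv ▸ hζs⟩
  have hη0 : ∀ x < δ, η x = 0 := by
    intro x hx
    simp only [hηdef]
    apply intervalIntegral.integral_zero_ae
    refine Filter.Eventually.of_forall fun t ht => hζ0 t ?_
    rcases le_total 0 x with h | h
    · rw [uIoc_of_le h] at ht; exact ht.2.trans_lt hx
    · rw [uIoc_of_ge h] at ht; exact ht.2.trans_lt hδ0
  have hηT : ∀ x, max T1 T2 ≤ x → η x = 0 := by
    intro x hx
    have hx0 : 0 ≤ x := hT1.trans ((le_max_left _ _).trans hx)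
    simp only [hηdef]
    rw [intervalIntegral.integral_of_le hx0]
    refine Eq.trans ?_ hζi
    apply setIntegral_eq_integral_of_forall_compl_eq_zero
    intro y hy
    rcases le_or_gt y 0 with h | h
    · exact hζ0 y (h.trans_lt hδ0)
    · exact hζT y (by by_contra hh; exact hy ⟨h, by linarith⟩)
  have hηc : HasCompactSupport η := by
    apply HasCompactSupport.intro (isCompact_Icc (a := 0) (b := max T1 T2))
    intro x hx
    rcases lt_or_ge x 0 with h | h
    · exact hη0 x (h.trans hδ0)
    · exact hηT x (by by_contra hh; exact hx ⟨h, by linarith⟩)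
  have h1 := h0 η hηs hηc ⟨δ, hδ0, hη0⟩
  rw [hderiv] at h1
  have i1 := hsm _ hw g hg.continuous hgc
  have i2 := hsm _ hw ψ hψs.continuous hψc
  have h2 : ∫ x in Ioi (0 : ℝ), g x • (u x - K x) = m • c := by
    rw [hcdef, ← integral_smul, ← sub_eq_zero, ← h1]
    refine (integral_sub i1 (i2.smul m)).symm.trans ?_
    congr 1
    funext x
    simp only [hζ, sub_smul, mul_smul, Pi.smul_apply]
  have h3 : ∫ x in Ioi (0 : ℝ), g x = m := by
    rw [hm]
    apply setIntegral_eq_integral_of_forall_compl_eq_zero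
    intro x hx
    exact hgz x (lt_of_le_of_lt (by simpa using hx) hε)
  have i3 := (hg.continuous.integrable_of_hasCompactSupport (μ := volume) hgc).integrableOn
    (s := Ioi (0 : ℝ))
  have h4 : ∫ x in Ioi (0 : ℝ), g x • (u x - K x - c) = 0 := by
    simp only [smul_sub _ (_ - _) c]
    rw [integral_sub i1 (i3.smul_const c), integral_smul_const, h2, h3, sub_self]
  refine Eq.trans ?_ h4
  symm
  apply setIntegral_eq_integral_of_forall_compl_eq_zero
  intro x hx
  rw [hgz x (lt_of_le_of_lt (by simpa using hx) hε), zero_smul]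

end Primitive

end StochasticAiry

namespace StochasticAiry

/-! ### Linear Hamiltonian systems in a real Euclidean space -/

section Calculus

variable {E : Type*} [NormedAddCommGroup E] [NormedSpace ℝ E]

lemma hasDerivWithinAt_of_primitive [CompleteSpace E] {f k : ℝ → E} {c : E}
    (hk : ContinuousOn k (Ici 0)) (hf : ∀ x, 0 ≤ x → f x = c + ∫ t in (0 : ℝ)..x, k t) {x : ℝ}
    (hx : 0 ≤ x) : HasDerivWithinAt f (k x) (Ici 0) x := by
  -- Extending k by its value at 0 makes it continuous on the whole line, so that the two-sided
  -- fundamental theorem applies at the endpoint too.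
  set l : ℝ → E := fun t => k (max t 0) with hl
  have hlc : Continuous l :=
    hk.comp_continuous (by fun_prop) (fun t => le_max_right t 0)
  have h1 : HasDerivAt (fun x => c + ∫ t in (0 : ℝ)..x, l t) (l x) x :=
    (intervalIntegral.integral_hasDerivAt_right (hlc.intervalIntegrable _ _)
      (hlc.stronglyMeasurableAtFilter _ _) hlc.continuousAt).const_add c
  have h2 : l x = k x := by simp [hl, hx]
  rw [← h2]
  have h3 : ∀ y ∈ Ici (0 : ℝ), f y = c + ∫ t in (0 : ℝ)..y, l t := by
    intro y hy
    rw [hf y hy]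
    congr 1
    apply intervalIntegral.integral_congr
    intro t ht
    rw [uIcc_of_le hy] at ht
    simp [hl, ht.1]
  exact h1.hasDerivWithinAt.congr h3 (h3 x hx)

lemma integral_eq_sub_of_hasDerivWithinAt [CompleteSpace E] {f k : ℝ → E}
    (hk : LocInt k) (hf : ∀ x, 0 ≤ x → HasDerivWithinAt f (k x) (Ici 0) x) {a b : ℝ}
    (ha : 0 ≤ a) (hab : a ≤ b) :
    ∫ t in a..b, k t = f b - f a := by
  apply intervalIntegral.integral_eq_sub_of_hasDeriv_right
  · rw [uIcc_of_le hab]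
    exact fun x hx => ((hf x (ha.trans hx.1)).continuousWithinAt).mono
      fun y hy => ha.trans hy.1
  · intro x hx
    rw [min_eq_left hab] at hx
    exact (hf x (ha.trans hx.1.le)).mono fun y hy => (ha.trans hx.1.le).trans (le_of_lt hy)
  · refine (hk b (ha.trans hab)).mono_set ?_
    rw [uIcc_of_le hab, uIcc_of_le (ha.trans hab)]
    exact Icc_subset_Icc_left ha

lemma primitive_of_hasDerivWithinAt [CompleteSpace E] {f k : ℝ → E}
    (hk : LocInt k) (hf : ∀ x, 0 ≤ x → HasDerivWithinAt f (k x) (Ici 0) x) {x : ℝ}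
    (hx : 0 ≤ x) : f x = f 0 + ∫ t in (0 : ℝ)..x, k t := by
  rw [integral_eq_sub_of_hasDerivWithinAt hk hf le_rfl hx]; abel

lemma LocInt.clm_apply {E F : Type*} [NormedAddCommGroup E] [NormedSpace ℝ E]
    [NormedAddCommGroup F] [NormedSpace ℝ F]
    {A : ℝ → E →L[ℝ] F} (hA : Continuous A) {k : ℝ → E} (hk : LocInt k) :
    LocInt (fun x => A x (k x)) := by
  intro T hT
  have h := hk T hT
  rw [intervalIntegrable_iff_integrableOn_Ioc_of_le hT] at h ⊢
  obtain ⟨C, hC⟩ := isCompact_Icc.exists_bound_of_continuousOn (hA.continuousOn (s := Icc 0 T))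
  refine (ContinuousLinearMap.id ℝ (E →L[ℝ] F)).integrable_of_bilin_of_bdd_left C
    (hA.continuousOn.aestronglyMeasurable measurableSet_Ioc) ?_ h
  rw [ae_restrict_iff' measurableSet_Ioc]
  exact Filter.Eventually.of_forall fun x hx => hC x (Ioc_subset_Icc_self hx)

end Calculus

/-- The data of the system `f' = A f + g`, `g' = (p - μ - A²) f - A g` on `[0, ∞)` with the
boundary condition `f(0) ∈ D`, `g(0) - β f(0) ∈ Dᗮ`. -/
structure Hamiltonian (E : Type*) [NormedAddCommGroup E] [InnerProductSpace ℝ E] where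
  A : ℝ → E →L[ℝ] E
  p : ℝ → E →L[ℝ] E
  β : E →L[ℝ] E
  D : Submodule ℝ E
  continuous_A : Continuous A
  continuous_p : Continuous p
  symm_A : ∀ x u v, inner ℝ (A x u) v = inner ℝ u (A x v)
  symm_p : ∀ x u v, inner ℝ (p x u) v = inner ℝ u (p x v)
  symm_β : ∀ u v, inner ℝ (β u) v = inner ℝ u (β v)

namespace Hamiltonian

variable {E : Type*} [NormedAddCommGroup E] [InnerProductSpace ℝ E]

/-- Solutions of the system. -/
def Sol (H : Hamiltonian E) (μ : ℝ) (f g : ℝ → E) : Prop :=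
  ∀ x : ℝ, 0 ≤ x → HasDerivWithinAt f (H.A x (f x) + g x) (Ici 0) x ∧
    HasDerivWithinAt g (H.p x (f x) - μ • f x - H.A x (H.A x (f x)) - H.A x (g x)) (Ici 0) x

/-- The self-adjoint boundary condition at the origin. -/
def BC (H : Hamiltonian E) (f g : ℝ → E) : Prop :=
  f 0 ∈ H.D ∧ ∀ d ∈ H.D, inner ℝ d (g 0 - H.β (f 0)) = 0

variable {H : Hamiltonian E} {μ : ℝ} {f g : ℝ → E}

lemma Sol.continuousOn_fst (h : H.Sol μ f g) : ContinuousOn f (Ici 0) :=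
  fun x hx => (h x hx).1.continuousWithinAt

lemma Sol.continuousOn_snd (h : H.Sol μ f g) : ContinuousOn g (Ici 0) :=
  fun x hx => (h x hx).2.continuousWithinAt

lemma continuousOn_A_apply (H : Hamiltonian E) {f : ℝ → E} {s : Set ℝ} (hf : ContinuousOn f s) :
    ContinuousOn (fun x => H.A x (f x)) s :=
  H.continuous_A.continuousOn.clm_apply hf

lemma continuousOn_p_apply (H : Hamiltonian E) {f : ℝ → E} {s : Set ℝ} (hf : ContinuousOn f s) :
    ContinuousOn (fun x => H.p x (f x)) s :=
  H.continuous_p.continuousOn.clm_apply hf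

lemma Sol.continuousOn_deriv_fst (h : H.Sol μ f g) :
    ContinuousOn (fun x => H.A x (f x) + g x) (Ici 0) :=
  (H.continuousOn_A_apply h.continuousOn_fst).add h.continuousOn_snd

lemma Sol.continuousOn_deriv_snd (h : H.Sol μ f g) :
    ContinuousOn (fun x => H.p x (f x) - μ • f x - H.A x (H.A x (f x)) - H.A x (g x)) (Ici 0) :=
  ((((H.continuousOn_p_apply h.continuousOn_fst).sub (h.continuousOn_fst.const_smul μ)).sub
    (H.continuousOn_A_apply (H.continuousOn_A_apply h.continuousOn_fst))).sub
      (H.continuousOn_A_apply h.continuousOn_snd))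

lemma Sol.add {f₁ g₁ f₂ g₂ : ℝ → E} (h₁ : H.Sol μ f₁ g₁) (h₂ : H.Sol μ f₂ g₂) :
    H.Sol μ (f₁ + f₂) (g₁ + g₂) := by
  intro x hx
  refine ⟨((h₁ x hx).1.add (h₂ x hx).1).congr_deriv ?_,
    ((h₁ x hx).2.add (h₂ x hx).2).congr_deriv ?_⟩
  · simp only [Pi.add_apply, map_add]; abel
  · simp only [Pi.add_apply, map_add, smul_add]; abel

lemma Sol.zero (H : Hamiltonian E) (μ : ℝ) : H.Sol μ 0 0 := by
  intro x _
  refine ⟨(hasDerivWithinAt_const x _ (0 : E)).congr_deriv ?_,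
    (hasDerivWithinAt_const x _ (0 : E)).congr_deriv ?_⟩ <;> simp

/-- A solution is determined by its value at one point. -/
lemma Sol.eq_zero (h : H.Sol μ f g) {a : ℝ} (ha : 0 ≤ a) (hf : f a = 0) (hg : g a = 0)
    {x : ℝ} (hx : 0 ≤ x) : f x = 0 ∧ g x = 0 := by
  -- The coefficient operator of the system on the phase space E × E. Its norm is bounded on compact
  -- intervals, which gives the uniform Lipschitz constant for ODE uniqueness in both time
  -- directions.
  let L : ℝ → (E × E) →L[ℝ] (E × E) := fun t =>
    ((H.A t).comp (.fst ℝ E E) + .snd ℝ E E).prod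
      ((H.p t).comp (.fst ℝ E E) - μ • (.fst ℝ E E) - (H.A t).comp ((H.A t).comp (.fst ℝ E E))
        - (H.A t).comp (.snd ℝ E E))
  have hL : Continuous L := by
    have hA := H.continuous_A
    have hp := H.continuous_p
    have h1 : Continuous fun t => (H.A t).comp (ContinuousLinearMap.fst ℝ E E) :=
      hA.clm_comp continuous_const
    have h2 : Continuous fun t => (H.p t).comp (ContinuousLinearMap.fst ℝ E E) :=
      hp.clm_comp continuous_const
    have h3 : Continuous fun t => (H.A t).comp (ContinuousLinearMap.snd ℝ E E) :=
      hA.clm_comp continuous_const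
    have h4 := hA.clm_comp h1
    exact (ContinuousLinearMap.prodₗᵢ (𝕜 := ℝ) (E := E × E) (F := E) (G := E) ℝ).continuous.comp
      ((h1.add continuous_const).prodMk (((h2.sub continuous_const).sub h4).sub h3))
  let y : ℝ → E × E := fun t => (f t, g t)
  have hy : ∀ t, 0 ≤ t → HasDerivWithinAt y (L t (y t)) (Ici 0) t := by
    intro t ht
    exact (h t ht).1.prodMk (h t ht).2
  have hyc : ContinuousOn y (Ici 0) := fun t ht => (hy t ht).continuousWithinAt
  set b := max a x + 1 with hb
  have hab : a < b := by rw [hb]; linarith [le_max_left a x]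
  have hxb : x < b := by rw [hb]; linarith [le_max_right a x]
  obtain ⟨C, hC⟩ : ∃ C, ∀ t ∈ Icc 0 b, ‖L t‖ ≤ C :=
    isCompact_Icc.exists_bound_of_continuousOn (f := L) hL.continuousOn
  have hlip : ∀ t ∈ Icc 0 b, LipschitzOnWith C.toNNReal (fun z => L t z) univ := by
    intro t ht
    apply (LipschitzWith.of_dist_le_mul fun u v => ?_).lipschitzOnWith
    rw [dist_eq_norm, dist_eq_norm, ← map_sub]
    refine ((L t).le_opNorm _).trans ?_
    gcongr
    exact (hC t ht).trans (Real.le_coe_toNNReal C)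
  have hz : ∀ t : ℝ, ∀ s : Set ℝ, HasDerivWithinAt (fun _ : ℝ => (0 : E × E)) (L t 0) s t := by
    intro t s
    rw [map_zero]; exact hasDerivWithinAt_const _ _ _
  have hya : y a = 0 := by simp [y, hf, hg]
  suffices y x = 0 by simpa [y] using this
  rcases le_total a x with hax | hxa
  · exact ODE_solution_unique_of_mem_Icc_right (v := fun t z => L t z) (s := fun _ => univ)
      (fun t ht => hlip t ⟨ha.trans ht.1, ht.2.le⟩)
      (hyc.mono fun t ht => ha.trans ht.1)
      (fun t ht => (hy t (ha.trans ht.1)).mono fun s hs => (ha.trans ht.1).trans hs)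
      (fun _ _ => mem_univ _) continuousOn_const (fun t _ => hz t _) (fun _ _ => mem_univ _) hya
      (show x ∈ Icc a b from ⟨hax, hxb.le⟩)
  · exact ODE_solution_unique_of_mem_Icc_left (v := fun t z => L t z) (s := fun _ => univ)
      (fun t ht => hlip t ⟨ht.1.le, ht.2.trans hab.le⟩)
      (hyc.mono fun t ht => ht.1)
      (fun t ht => ((hy t ht.1.le).hasDerivAt (Ici_mem_nhds ht.1)).hasDerivWithinAt)
      (fun _ _ => mem_univ _) continuousOn_const (fun t _ => hz t _) (fun _ _ => mem_univ _) hya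
      (show x ∈ Icc 0 a from ⟨hx, hxa⟩)

/-- The Wronskian of two solutions is constant. -/
lemma Sol.wronskian_eq {f₁ g₁ f₂ g₂ : ℝ → E} (h₁ : H.Sol μ f₁ g₁) (h₂ : H.Sol μ f₂ g₂) {x : ℝ}
    (hx : 0 ≤ x) :
    inner ℝ (f₁ x) (g₂ x) - inner ℝ (g₁ x) (f₂ x) =
      inner ℝ (f₁ 0) (g₂ 0) - inner ℝ (g₁ 0) (f₂ 0) := by
  have hd : ∀ t, 0 ≤ t →
      HasDerivWithinAt (fun x => inner ℝ (f₁ x) (g₂ x) - inner ℝ (g₁ x) (f₂ x)) 0 (Ici 0) t := by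
    intro t ht
    refine (((h₁ t ht).1.inner ℝ (h₂ t ht).2).sub ((h₁ t ht).2.inner ℝ (h₂ t ht).1)).congr_deriv ?_
    simp only [inner_add_left, inner_add_right, inner_sub_left, inner_sub_right, H.symm_A,
      H.symm_p, real_inner_smul_left, real_inner_smul_right]
    ring
  exact constant_of_has_deriv_right_zero (f := fun x => inner ℝ (f₁ x) (g₂ x) -
    inner ℝ (g₁ x) (f₂ x)) (a := 0) (b := x)
    (fun t ht => (hd t ht.1).continuousWithinAt.mono Icc_subset_Ici_self)
    (fun t ht => (hd t ht.1).mono fun s hs => ht.1.trans hs) x ⟨hx, le_rfl⟩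

/-- The boundary condition is isotropic: the values f(0) lie in D, modulo Dᗮ the values g(0) are β
f(0), and β is symmetric. -/
lemma BC.wronskian_eq_zero {f₁ g₁ f₂ g₂ : ℝ → E} (h₁ : H.BC f₁ g₁) (h₂ : H.BC f₂ g₂) :
    inner ℝ (f₁ 0) (g₂ 0) - inner ℝ (g₁ 0) (f₂ 0) = 0 := by
  have e₁ := h₁.2 _ h₂.1
  have e₂ := h₂.2 _ h₁.1
  rw [inner_sub_right, sub_eq_zero] at e₁ e₂
  rw [e₂, real_inner_comm (f₂ 0), e₁, ← H.symm_β, real_inner_comm, sub_self]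

/-- The change of variables `g ↦ g + S f`. -/
lemma Sol.gauge (h : H.Sol μ f g) {H' : Hamiltonian E} {S S' : ℝ → E →L[ℝ] E}
    (hS : ∀ x, 0 ≤ x → HasDerivWithinAt S (S' x) (Ici 0) x)
    (hA : ∀ x, 0 ≤ x → H.A x = H'.A x + S x) (hp : ∀ x, 0 ≤ x → H'.p x = H.p x + S' x) :
    H'.Sol μ f (fun x => g x + S x (f x)) := by
  intro x hx
  have h1 := (h x hx).1
  -- Since g' = p f - μ f - A f', adding (S f)' = S' f + S f' turns A into A - S and p into p + S';
  -- the term -A² needs no separate correction.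
  refine ⟨h1.congr_deriv ?_, ((h x hx).2.add ((hS x hx).clm_apply h1)).congr_deriv ?_⟩
  · rw [hA x hx]; simp only [_root_.add_apply]; abel
  · rw [hA x hx, hp x hx]
    simp only [_root_.add_apply, map_add]
    abel

lemma BC.gauge (h : H.BC f g) {H' : Hamiltonian E} {S : ℝ → E →L[ℝ] E} (hD : H'.D = H.D)
    (hβ : H'.β = H.β + S 0) : H'.BC f (fun x => g x + S x (f x)) := by
  refine ⟨hD ▸ h.1, fun d hd => ?_⟩
  refine Eq.trans ?_ (h.2 d (hD ▸ hd))
  rw [hβ]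
  refine congrArg (inner ℝ d) ?_
  simp only [_root_.add_apply]; abel

/-- Regularity: a weak solution is a solution. -/
lemma exists_sol_of_weak [FiniteDimensional ℝ E] (H : Hamiltonian E) {μ : ℝ} {f h : ℝ → E} {y : E}
    (hy : y ∈ H.D) (hh : LocInt h) (hf : ∀ x, 0 ≤ x → f x = y + ∫ t in (0 : ℝ)..x, h t)
    (hw : ∀ (η : ℝ → ℝ) (e : E), ContDiff ℝ ((⊤ : ℕ∞) : WithTop ℕ∞) η → HasCompactSupport η →
      (e ∈ H.D ∨ ∃ ε > 0, ∀ x < ε, η x = 0) →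
      (∫ x in Ioi (0 : ℝ), (deriv η x * inner ℝ e (h x - H.A x (f x)) +
        η x * inner ℝ e (H.p x (f x) - μ • f x - H.A x (h x)))) + η 0 * inner ℝ e (H.β y) = 0) :
    ∃ g, H.Sol μ f g ∧ H.BC f g := by
  have : CompleteSpace E := FiniteDimensional.complete ℝ E
  have hfc : ContinuousOn f (Ici 0) := (hh.continuousOn_primitive y).congr fun x hx => hf x hx
  set u : ℝ → E := fun x => h x - H.A x (f x) with hu
  set k : ℝ → E := fun x => H.p x (f x) - μ • f x - H.A x (h x) with hk
  have hul : LocInt u := hh.sub (.of_continuousOn (H.continuousOn_A_apply hfc))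
  have hkl : LocInt k := (LocInt.of_continuousOn ((H.continuousOn_p_apply hfc).sub
    (hfc.const_smul μ))).sub (hh.clm_apply H.continuous_A)
  have hint : ∀ η : ℝ → ℝ, ContDiff ℝ ((⊤ : ℕ∞) : WithTop ℕ∞) η → HasCompactSupport η →
      IntegrableOn (fun x => deriv η x • u x + η x • k x) (Ioi 0) := by
    intro η hη hc
    obtain ⟨T, hT, hz⟩ := exists_forall_gt_eq_zero hc
    obtain ⟨T', hT', hz'⟩ := exists_forall_gt_eq_zero hc.deriv
    have hη1 : ContDiff ℝ 1 η := hη.of_le (by exact_mod_cast le_top)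
    have h1 := ((LocInt.continuousOn_smul (hη1.continuous_deriv le_rfl).continuousOn hul).add
      (LocInt.continuousOn_smul hη.continuous.continuousOn hkl)) (max T T')
      (hT.trans (le_max_left _ _))
    rw [intervalIntegrable_iff_integrableOn_Ioc_of_le (hT.trans (le_max_left _ _))] at h1
    refine h1.of_forall_sdiff_eq_zero measurableSet_Ioi (fun x hx => ?_)
    have hx' : max T T' ≤ x := by by_contra hxT; exact hx.2 ⟨hx.1, (not_le.1 hxT).le⟩
    rw [hz x ((le_max_left _ _).trans hx'), hz' x ((le_max_right _ _).trans hx')]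
    simp
  have hinner : ∀ (η : ℝ → ℝ) (e : E), ContDiff ℝ ((⊤ : ℕ∞) : WithTop ℕ∞) η →
      HasCompactSupport η → (e ∈ H.D ∨ ∃ ε > 0, ∀ x < ε, η x = 0) →
      inner ℝ e (∫ x in Ioi (0 : ℝ), (deriv η x • u x + η x • k x)) =
        -(η 0 * inner ℝ e (H.β y)) := by
    intro η e hη hc he
    rw [eq_neg_iff_add_eq_zero]
    refine Eq.trans ?_ (hw η e hη hc he)
    congr 1
    rw [show inner ℝ e (∫ x in Ioi (0 : ℝ), (deriv η x • u x + η x • k x)) =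
      ∫ x in Ioi (0 : ℝ), inner ℝ e (deriv η x • u x + η x • k x) from
      ((innerSL ℝ e).integral_comp_comm (hint η hη hc)).symm]
    congr 1
    funext x
    rw [inner_add_right, inner_smul_right, inner_smul_right]
  -- Tests vanishing near 0 show that the quasi-derivative h - A f has an absolutely continuous
  -- representative g; a bootstrap then makes f and g continuously differentiable.
  obtain ⟨c, hc⟩ := du_bois_reymond hul hkl (fun η hη hηc hε => by
    apply ext_inner_left ℝ
    intro e
    obtain ⟨ε, hε0, hε⟩ := hε
    rw [hinner η e hη hηc (Or.inr ⟨ε, hε0, hε⟩), hε 0 hε0]; simp)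
  set g : ℝ → E := fun x => c + ∫ t in (0 : ℝ)..x, k t with hg
  have hgc : ContinuousOn g (Ici 0) := hkl.continuousOn_primitive c
  have hhg : ∀ᵐ x ∂(volume.restrict (Ioi (0 : ℝ))), h x = H.A x (f x) + g x := by
    filter_upwards [hc] with x hx
    simp only [hg]; rw [← hx, hu]; simp
  have hae : ∀ x : ℝ, 0 ≤ x → ∀ {k l : ℝ → E}, (∀ᵐ x ∂(volume.restrict (Ioi (0 : ℝ))), k x = l x) →
      ∫ t in (0 : ℝ)..x, k t = ∫ t in (0 : ℝ)..x, l t := by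
    intro x hx k l hkl
    rw [intervalIntegral.integral_of_le hx, intervalIntegral.integral_of_le hx]
    exact integral_congr_ae (ae_restrict_of_ae_restrict_of_subset Ioc_subset_Ioi_self hkl)
  have hf' : ∀ x, 0 ≤ x → f x = y + ∫ t in (0 : ℝ)..x, (H.A t (f t) + g t) := by
    intro x hx
    rw [hf x hx, hae x hx hhg]
  have hg' : ∀ x, 0 ≤ x → g x = c + ∫ t in (0 : ℝ)..x,
      (H.p t (f t) - μ • f t - H.A t (H.A t (f t)) - H.A t (g t)) := by
    intro x hx
    simp only [hg]
    congr 1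
    apply hae x hx
    filter_upwards [hhg] with t ht
    rw [hk]; simp only; rw [ht, map_add]; abel
  refine ⟨g, fun x hx => ⟨hasDerivWithinAt_of_primitive
    ((H.continuousOn_A_apply hfc).add hgc) hf' hx, hasDerivWithinAt_of_primitive
    ((((H.continuousOn_p_apply hfc).sub (hfc.const_smul μ)).sub
      (H.continuousOn_A_apply (H.continuousOn_A_apply hfc))).sub
      (H.continuousOn_A_apply hgc)) hg' hx⟩, ?_⟩
  have hf0 : f 0 = y := by rw [hf 0 le_rfl]; simp
  have hg0 : g 0 = c := by simp [hg]
  refine ⟨hf0 ▸ hy, fun d hd => ?_⟩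
  -- Testing with a plateau equal to 1 at the origin, in a direction d ∈ D, isolates the boundary
  -- term and yields the natural boundary condition.
  let B : ContDiffBump (0 : ℝ) := ⟨1, 2, by norm_num, by norm_num⟩
  have hB0 : B 0 = 1 := B.one_of_mem_closedBall (by simp [B])
  have hBs : ContDiff ℝ ((⊤ : ℕ∞) : WithTop ℕ∞) B := B.contDiff
  have h1 := hinner B d hBs B.hasCompactSupport (Or.inl hd)
  have h2 : ∫ x in Ioi (0 : ℝ), (deriv B x • u x + B x • k x) = -(B 0 • c) := by
    rw [← integral_test_of_primitive (u := g) hkl (fun x _ => rfl)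
      (hBs.of_le (by exact_mod_cast le_top)) B.hasCompactSupport]
    apply integral_congr_ae
    filter_upwards [hc] with x hx
    rw [hx]
  rw [h2, hB0, inner_neg_right, one_smul, one_mul, neg_inj] at h1
  rw [hf0, hg0, inner_sub_right, h1, sub_self]

end Hamiltonian

end StochasticAiry

namespace StochasticAiry

/-! ### Conjoined bases and the Picone identity -/

/-- In finite dimension an operator is a linear, hence differentiable, function of its values on a
basis. -/
lemma hasDerivWithinAt_clm_of_apply {E F : Type*} [NormedAddCommGroup E] [NormedSpace ℝ E]
    [FiniteDimensional ℝ E] [NormedAddCommGroup F] [NormedSpace ℝ F] [FiniteDimensional ℝ F]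
    {L : ℝ → E →L[ℝ] F} {L' : E →L[ℝ] F}
    {s : Set ℝ} {x : ℝ} (h : ∀ v, HasDerivWithinAt (fun y => L y v) (L' v) s x) :
    HasDerivWithinAt L L' s x := by
  let b := Module.finBasis ℝ E
  let T : (Fin (Module.finrank ℝ E) → F) →ₗ[ℝ] (E →L[ℝ] F) :=
    (LinearMap.toContinuousLinearMap : (E →ₗ[ℝ] F) ≃ₗ[ℝ] _).toLinearMap ∘ₗ
      (b.constr ℝ).toLinearMap
  have hT : ∀ M : E →L[ℝ] F, T (fun i => M (b i)) = M := by
    intro M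
    apply ContinuousLinearMap.coe_injective
    apply b.ext
    intro i
    simp [T]
  have h1 : HasDerivWithinAt (fun y i => L y (b i)) (fun i => L' (b i)) s x :=
    hasDerivWithinAt_pi.2 fun i => h (b i)
  have h2 := (LinearMap.toContinuousLinearMap T).hasFDerivAt.comp_hasDerivWithinAt x h1
  rw [show L = (LinearMap.toContinuousLinearMap T) ∘ (fun y i => L y (b i)) from
    funext fun y => (hT (L y)).symm]
  exact h2.congr_deriv (hT L')

/-- A smooth cutoff function of a neighbourhood of the origin. -/
def plateau : ContDiffBump (0 : ℝ) := ⟨1, 2, by norm_num, by norm_num⟩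

lemma plateau_eq_one {x : ℝ} (hx : |x| ≤ 1) : plateau x = 1 :=
  plateau.one_of_mem_closedBall (by simpa [plateau] using hx)

lemma plateau_eq_zero {x : ℝ} (hx : 2 ≤ |x|) : plateau x = 0 :=
  plateau.zero_of_le_dist (by simpa [plateau] using hx)

lemma contDiff_plateau : ContDiff ℝ 1 plateau := plateau.contDiff

lemma hasDerivAt_plateau (x : ℝ) : HasDerivAt plateau (deriv plateau x) x :=
  (contDiff_plateau.differentiable one_ne_zero x).hasDerivAt

lemma deriv_plateau_eq_zero {x : ℝ} (hx : 2 < |x|) : deriv plateau x = 0 := by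
  have : (plateau : ℝ → ℝ) =ᶠ[nhds x] fun _ => 0 := by
    have : {y : ℝ | 2 < |y|} ∈ nhds x := (isOpen_lt continuous_const continuous_abs).mem_nhds hx
    filter_upwards [this] with y hy using plateau_eq_zero (le_of_lt hy)
  rw [this.deriv_eq]; simp

lemma exists_deriv_plateau_le : ∃ M, 0 ≤ M ∧ ∀ x, |deriv plateau x| ≤ M := by
  obtain ⟨M, hM⟩ := (contDiff_plateau.continuous_deriv le_rfl).bounded_above_of_compact_support
    plateau.hasCompactSupport.deriv
  exact ⟨M, (norm_nonneg _).trans (hM 0), hM⟩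

namespace Hamiltonian

variable {E : Type*} [NormedAddCommGroup E] [InnerProductSpace ℝ E] [FiniteDimensional ℝ E]

/-- The energy density `|f' - A f|² + ⟨(p - λ - A²) f, f⟩` as a function of the position, the value
and the derivative. -/
def dens (H : Hamiltonian E) (lam x : ℝ) (u w : E) : ℝ :=
  ‖w - H.A x u‖ ^ 2 + inner ℝ (H.p x u - lam • u - H.A x (H.A x u)) u

lemma continuous_dens (H : Hamiltonian E) (lam : ℝ) :
    Continuous fun q : ℝ × E × E => H.dens lam q.1 q.2.1 q.2.2 := by
  have hA : Continuous fun q : ℝ × E × E => H.A q.1 q.2.1 :=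
    (H.continuous_A.comp continuous_fst).clm_apply (by fun_prop)
  have hAA : Continuous fun q : ℝ × E × E => H.A q.1 (H.A q.1 q.2.1) :=
    (H.continuous_A.comp continuous_fst).clm_apply hA
  have hp : Continuous fun q : ℝ × E × E => H.p q.1 q.2.1 :=
    (H.continuous_p.comp continuous_fst).clm_apply (by fun_prop)
  have hu : Continuous fun q : ℝ × E × E => q.2.1 := by fun_prop
  have hw : Continuous fun q : ℝ × E × E => q.2.2 := by fun_prop
  exact ((hw.sub hA).norm.pow 2).add (((hp.sub (hu.const_smul lam)).sub hAA).inner hu)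

lemma continuousOn_dens (H : Hamiltonian E) (lam : ℝ) {f df : ℝ → E} {s : Set ℝ}
    (hf : ContinuousOn f s) (hdf : ContinuousOn df s) :
    ContinuousOn (fun x => H.dens lam x (f x) (df x)) s :=
  (H.continuous_dens lam).comp_continuousOn (continuousOn_id.prodMk (hf.prodMk hdf))

/-- A basis of the solutions with spectral parameter `lam` which satisfy the boundary condition:
`v ↦ (F v, G v)`. -/
structure IsFrame (H : Hamiltonian E) (lam : ℝ) (F G : ℝ → E →L[ℝ] E) : Prop where
  sol : ∀ v, H.Sol lam (fun x => F x v) (fun x => G x v)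
  bc : ∀ v, H.BC (fun x => F x v) (fun x => G x v)
  surj : ∀ d ∈ H.D, ∃ v, F 0 v = d
  inj : ∀ v, F 0 v = 0 → G 0 v = 0 → v = 0

variable {H : Hamiltonian E} {lam : ℝ} {F G : ℝ → E →L[ℝ] E}

/-- The Wronskian is constant and vanishes at the origin by the boundary condition. -/
lemma IsFrame.symm (hF : H.IsFrame lam F G) {x : ℝ} (hx : 0 ≤ x) (v w : E) :
    inner ℝ (F x v) (G x w) = inner ℝ (G x v) (F x w) := by
  rw [← sub_eq_zero, (hF.sol v).wronskian_eq (hF.sol w) hx,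
    (hF.bc v).wronskian_eq_zero (hF.bc w)]

lemma IsFrame.eq_zero (hF : H.IsFrame lam F G) {x : ℝ} (hx : 0 ≤ x) {v : E} (h1 : F x v = 0)
    (h2 : G x v = 0) : v = 0 :=
  hF.inj v ((hF.sol v).eq_zero hx h1 h2 le_rfl).1 ((hF.sol v).eq_zero hx h1 h2 le_rfl).2

lemma IsFrame.hasDerivWithinAt_fst (hF : H.IsFrame lam F G) {x : ℝ} (hx : 0 ≤ x) :
    HasDerivWithinAt F ((H.A x).comp (F x) + G x) (Ici 0) x :=
  hasDerivWithinAt_clm_of_apply fun v => (hF.sol v x hx).1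

lemma IsFrame.hasDerivWithinAt_snd (hF : H.IsFrame lam F G) {x : ℝ} (hx : 0 ≤ x) :
    HasDerivWithinAt G ((H.p x).comp (F x) - lam • F x - (H.A x).comp ((H.A x).comp (F x))
      - (H.A x).comp (G x)) (Ici 0) x :=
  hasDerivWithinAt_clm_of_apply fun v => (hF.sol v x hx).2

/-- For f = F h one has f' - A f = G h + F h', and the symmetry of F†G gives (⟨f, G h⟩)' = density -
|F h'|². Integrating over [0, T] leaves ⟨f(0), β f(0)⟩ from the boundary condition at 0 and nothing
at T. -/
lemma IsFrame.picone_of_factor (hF : H.IsFrame lam F G) {f df h : ℝ → E} {T : ℝ} (hT : 0 ≤ T)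
    (hf : ∀ x, 0 ≤ x → HasDerivWithinAt f (df x) (Ici 0) x) (hdf : ContinuousOn df (Ici 0))
    (hfac : ∀ x, 0 ≤ x → f x = F x (h x))
    (hh : ∀ x, 0 ≤ x → DifferentiableWithinAt ℝ h (Ici 0) x) (hfT : f T = 0) :
    0 ≤ inner ℝ (H.β (f 0)) (f 0) + ∫ x in (0 : ℝ)..T, H.dens lam x (f x) (df x) := by
  have : CompleteSpace E := FiniteDimensional.complete ℝ E
  have hfc : ContinuousOn f (Ici 0) := fun x hx => (hf x hx).continuousWithinAt
  have hdc := H.continuousOn_dens lam hfc hdf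
  set Θ : ℝ → ℝ := fun x => inner ℝ (f x) (G x (h x)) -
    (0 + ∫ t in (0 : ℝ)..x, H.dens lam t (f t) (df t)) with hΘ
  have hder : ∀ x, 0 ≤ x →
      HasDerivWithinAt Θ (-‖df x - H.A x (f x) - G x (h x)‖ ^ 2) (Ici 0) x := by
    intro x hx
    have h1 := (hh x hx).hasDerivWithinAt
    set h' := derivWithin h (Ici 0) x
    have h2 := (hF.hasDerivWithinAt_fst hx).clm_apply h1
    have h3 : HasDerivWithinAt f (((H.A x).comp (F x) + G x) (h x) + F x h') (Ici 0) x :=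
      h2.congr (fun y hy => hfac y hy) (hfac x hx)
    have h4 : df x = H.A x (f x) + G x (h x) + F x h' := by
      rw [(uniqueDiffOn_Ici (0 : ℝ) x hx).eq_deriv _ (hf x hx) h3, hfac x hx]
      simp
    have h5 := (hf x hx).inner ℝ ((hF.hasDerivWithinAt_snd hx).clm_apply h1)
    have h6 := hasDerivWithinAt_of_primitive (c := 0) hdc (fun x _ => rfl) hx
    refine (h5.sub h6).congr_deriv ?_
    have h7 : inner ℝ (f x) (G x h') = inner ℝ (G x (h x)) (F x h') := by
      rw [hfac x hx, hF.symm hx]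
    have h8 : df x - H.A x (f x) = G x (h x) + F x h' := by rw [h4]; abel
    have h9 : df x - H.A x (f x) - G x (h x) = F x h' := by rw [h4]; abel
    rw [dens, h9, h8]
    simp only [_root_.sub_apply, _root_.smul_apply,
      ContinuousLinearMap.comp_apply, ← hfac x hx]
    rw [h4, norm_add_sq_real]
    simp only [inner_add_left, inner_add_right, inner_sub_left, inner_sub_right, h7,
      H.symm_A, H.symm_p, real_inner_smul_left, real_inner_smul_right,
      real_inner_self_eq_norm_sq]
    rw [real_inner_comm (G x (h x)) (F x h')]
    ring
  have hanti : AntitoneOn Θ (Icc 0 T) := by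
    apply antitoneOn_of_deriv_nonpos (convex_Icc 0 T)
    · exact fun x hx => (hder x hx.1).continuousWithinAt.mono Icc_subset_Ici_self
    · intro x hx
      rw [interior_Icc] at hx
      exact ((hder x hx.1.le).hasDerivAt (Ici_mem_nhds hx.1)).differentiableAt.differentiableWithinAt
    · intro x hx
      rw [interior_Icc] at hx
      rw [((hder x hx.1.le).hasDerivAt (Ici_mem_nhds hx.1)).deriv]
      have := sq_nonneg ‖df x - H.A x (f x) - G x (h x)‖
      linarith
  have h1 := hanti ⟨le_rfl, hT⟩ ⟨hT, le_rfl⟩ hT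
  have h2 := (hF.bc (h 0)).2 _ (hF.bc (h 0)).1
  simp only [← hfac 0 le_rfl] at h2
  rw [inner_sub_right, sub_eq_zero] at h2
  simp only [hΘ, hfT, inner_zero_left, intervalIntegral.integral_same, h2] at h1
  rw [real_inner_comm]
  linarith

/-- The cutoff at scale 1/n has derivative of order n, but only where |x - ξ| ≤ 2/n; there |e| ≤ K|x
- ξ| because e vanishes at ξ, so the product stays bounded uniformly in n. -/
lemma exists_bound_plateau_smul {e de : ℝ → E} {T ξ : ℝ} (hξ : ξ ∈ Icc 0 T)
    (he : ∀ x, 0 ≤ x → HasDerivWithinAt e (de x) (Ici 0) x) (hde : ContinuousOn de (Ici 0))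
    (hz : e ξ = 0) :
    ∃ C, ∀ n : ℕ, ∀ x ∈ Icc 0 T, ‖plateau (n * (x - ξ)) • e x‖ ≤ C ∧
      ‖plateau (n * (x - ξ)) • de x + (n * deriv plateau (n * (x - ξ))) • e x‖ ≤ C := by
  obtain ⟨K, hK⟩ := isCompact_Icc.exists_bound_of_continuousOn
    (hde.mono (fun x (hx : x ∈ Icc 0 T) => hx.1))
  obtain ⟨M, hM0, hM⟩ := exists_deriv_plateau_le
  have hK0 : 0 ≤ K := (norm_nonneg _).trans (hK ξ hξ)
  have hT : 0 ≤ T := hξ.1.trans hξ.2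
  have hlip : ∀ x ∈ Icc 0 T, ‖e x‖ ≤ K * |x - ξ| := by
    intro x hx
    have := (convex_Icc 0 T).norm_image_sub_le_of_norm_hasDerivWithin_le
      (fun y hy => (he y hy.1).mono Icc_subset_Ici_self) hK hξ hx
    rwa [hz, sub_zero] at this
  have hb : ∀ y, |plateau y| ≤ 1 := fun y => by
    rw [abs_of_nonneg plateau.nonneg]; exact plateau.le_one
  refine ⟨K * T + K + 2 * M * K, fun n x hx => ⟨?_, ?_⟩⟩
  · rw [norm_smul, Real.norm_eq_abs]
    have h1 : |x - ξ| ≤ T := by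
      rw [abs_le]; constructor <;> linarith [hx.1, hx.2, hξ.1, hξ.2]
    calc |plateau (n * (x - ξ))| * ‖e x‖ ≤ 1 * (K * T) := by
          gcongr
          · exact hb _
          · exact (hlip x hx).trans (by gcongr)
      _ ≤ _ := by nlinarith [mul_nonneg hM0 hK0]
  · refine (norm_add_le _ _).trans ?_
    rw [norm_smul, norm_smul, Real.norm_eq_abs, Real.norm_eq_abs]
    have h1 : |plateau (n * (x - ξ))| * ‖de x‖ ≤ 1 * K := by
      gcongr
      · exact hb _
      · exact hK x hx
    have h2 : |n * deriv plateau (n * (x - ξ))| * ‖e x‖ ≤ 2 * M * K := by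
      rcases le_or_gt |(n : ℝ) * (x - ξ)| 2 with h | h
      · rw [abs_mul, Nat.abs_cast] at *
        calc (n : ℝ) * |deriv plateau (n * (x - ξ))| * ‖e x‖
            ≤ (n : ℝ) * M * (K * |x - ξ|) := by
              gcongr
              · exact hM _
              · exact hlip x hx
          _ = M * K * (n * |x - ξ|) := by ring
          _ ≤ M * K * 2 := by gcongr
          _ = _ := by ring
      · rw [deriv_plateau_eq_zero h]; simp; positivity
    have := mul_nonneg hK0 hT
    linarith

/-- The Picone inequality: the energy of a function whose values lie in the range of `F` is
non-negative. -/
lemma IsFrame.picone (hF : H.IsFrame lam F G) {X : Finset ℝ} (hX0 : (0 : ℝ) ∈ X)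
    (hXn : ∀ ξ ∈ X, 0 ≤ ξ) (hX : ∀ x, 0 ≤ x → x ∉ X → IsUnit (F x)) {f df : ℝ → E} {T : ℝ}
    (hf : ∀ x, 0 ≤ x → HasDerivWithinAt f (df x) (Ici 0) x) (hdf : ContinuousOn df (Ici 0))
    (hr : ∀ x ∈ X, ∃ v, F x v = f x) (hXT : ∀ ξ ∈ X, ξ + 2 ≤ T) (hfT : f T = 0) :
    0 ≤ inner ℝ (H.β (f 0)) (f 0) + ∫ x in (0 : ℝ)..T, H.dens lam x (f x) (df x) := by
  have : CompleteSpace E := FiniteDimensional.complete ℝ E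
  have hfc : ContinuousOn f (Ici 0) := fun x hx => (hf x hx).continuousWithinAt
  have hT : 0 ≤ T := by linarith [hXT 0 hX0]
  choose! v hv using hr
  let e : ℝ → ℝ → E := fun ξ x => f x - F x (v ξ)
  let de : ℝ → ℝ → E := fun ξ x => df x - (H.A x (F x (v ξ)) + G x (v ξ))
  have he : ∀ ξ x, 0 ≤ x → HasDerivWithinAt (e ξ) (de ξ x) (Ici 0) x := fun ξ x hx =>
    (hf x hx).sub ((hF.sol (v ξ) x hx).1)
  have hde : ∀ ξ, ContinuousOn (de ξ) (Ici 0) := fun ξ =>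
    hdf.sub (hF.sol (v ξ)).continuousOn_deriv_fst
  -- The error e ξ = f - F v(ξ) vanishes at ξ. Removing it near ξ makes the modified function equal
  -- to F v(ξ) within distance 1/n, so it factors through F with a constant coefficient there,
  -- however singular F(ξ) is.
  let fn : ℕ → ℝ → E := fun n x => f x - ∑ ξ ∈ X, plateau (n * (x - ξ)) • e ξ x
  let dfn : ℕ → ℝ → E := fun n x => df x - ∑ ξ ∈ X, (plateau (n * (x - ξ)) • de ξ x +
    (n * deriv plateau (n * (x - ξ))) • e ξ x)
  have hfn : ∀ n x, 0 ≤ x → HasDerivWithinAt (fn n) (dfn n x) (Ici 0) x := by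
    intro n x hx
    refine (hf x hx).sub (HasDerivWithinAt.fun_sum fun ξ _ => ?_)
    have h1 : HasDerivAt (fun x : ℝ => plateau (n * (x - ξ)))
        (n * deriv plateau (n * (x - ξ))) x := by
      have h2 : HasDerivAt (fun x : ℝ => (n : ℝ) * (x - ξ)) n x := by
        simpa using ((hasDerivAt_id x).sub_const ξ).const_mul (n : ℝ)
      exact ((hasDerivAt_plateau _).comp x h2).congr_deriv (mul_comm _ _)
    exact h1.hasDerivWithinAt.smul (he ξ x hx)
  have hpc : ∀ (n : ℕ) (ξ : ℝ), Continuous fun x : ℝ => plateau (n * (x - ξ)) := fun n ξ =>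
    contDiff_plateau.continuous.comp (by fun_prop)
  have hdpc : ∀ (n : ℕ) (ξ : ℝ), Continuous fun x : ℝ => deriv plateau (n * (x - ξ)) := fun n ξ =>
    (contDiff_plateau.continuous_deriv le_rfl).comp (by fun_prop)
  have hec : ∀ ξ, ContinuousOn (e ξ) (Ici 0) := fun ξ x hx => (he ξ x hx).continuousWithinAt
  have hdfn : ∀ n, ContinuousOn (dfn n) (Ici 0) := fun n =>
    hdf.sub (continuousOn_finsetSum _ fun ξ _ => ((hpc n ξ).continuousOn.smul (hde ξ)).add
      ((continuous_const.mul (hdpc n ξ)).continuousOn.smul (hec ξ)))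
  -- the points of `X` are separated
  obtain ⟨δ, hδ0, hδ⟩ : ∃ δ > 0, ∀ ξ ∈ X, ∀ ξ' ∈ X, ξ ≠ ξ' → δ ≤ |ξ - ξ'| := by
    rcases (X.offDiag).eq_empty_or_nonempty with h | h
    · refine ⟨1, one_pos, fun ξ hξ ξ' hξ' hne => ?_⟩
      have : (ξ, ξ') ∈ X.offDiag := Finset.mem_offDiag.2 ⟨hξ, hξ', hne⟩
      rw [h] at this; simp at this
    · obtain ⟨q, hq, hmin⟩ := X.offDiag.exists_min_image (fun q => |q.1 - q.2|) h
      refine ⟨|q.1 - q.2|, abs_pos.2 (sub_ne_zero.2 (Finset.mem_offDiag.1 hq).2.2),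
        fun ξ hξ ξ' hξ' hne => hmin (ξ, ξ') (Finset.mem_offDiag.2 ⟨hξ, hξ', hne⟩)⟩
  -- With n δ ≥ 3, a point within 1/n of ξ is at least 2/n from the other points of X, outside their
  -- cutoffs. The bound n ≥ 1 keeps all cutoffs away from T, since T ≥ ξ + 2.
  obtain ⟨N, hN⟩ := exists_nat_gt (max 1 (3 / δ))
  have hlarge : ∀ n : ℕ, N ≤ n → 1 ≤ (n : ℝ) ∧ 3 ≤ n * δ := by
    intro n hn
    have h1 : max 1 (3 / δ) < (n : ℝ) := hN.trans_le (by exact_mod_cast hn)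
    refine ⟨(le_max_left _ _).trans h1.le, ?_⟩
    have h2 := (le_max_right _ _).trans h1.le
    rwa [div_le_iff₀ hδ0] at h2
  have hnear : ∀ n : ℕ, N ≤ n → ∀ ξ ∈ X, ∀ x, (n : ℝ) * |x - ξ| < 1 →
      (∀ ξ' ∈ X, ξ' ≠ ξ → 2 ≤ |(n : ℝ) * (x - ξ')|) ∧ fn n x = F x (v ξ) := by
    intro n hn ξ hξ x hx
    obtain ⟨h1, h3⟩ := hlarge n hn
    have h2 : ∀ ξ' ∈ X, ξ' ≠ ξ → 2 ≤ |(n : ℝ) * (x - ξ')| := by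
      intro ξ' hξ' hne
      have h4 := hδ ξ' hξ' ξ hξ hne
      have h5 : |ξ' - ξ| ≤ |x - ξ| + |x - ξ'| := by
        have := abs_sub_le ξ' x ξ
        rw [abs_sub_comm ξ' x] at this; linarith
      rw [abs_mul, Nat.abs_cast]
      nlinarith
    refine ⟨h2, ?_⟩
    simp only [fn]
    rw [Finset.sum_eq_single ξ, plateau_eq_one]
    · simp [e]
    · rw [abs_mul, Nat.abs_cast]; exact hx.le
    · intro ξ' hξ' hne
      rw [plateau_eq_zero (h2 ξ' hξ' hne), zero_smul]
    · exact fun h => absurd hξ h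
  have hpos : ∀ n : ℕ, N ≤ n → 0 ≤ inner ℝ (H.β (f 0)) (f 0) +
      ∫ x in (0 : ℝ)..T, H.dens lam x (fn n x) (dfn n x) := by
    intro n hn
    obtain ⟨h1, h3⟩ := hlarge n hn
    have hn0 : (0 : ℝ) < n := by linarith
    have hf0 : fn n 0 = f 0 := by
      rw [(hnear n hn 0 hX0 0 (by simp)).2, hv 0 hX0]
    rw [← hf0]
    classical
    -- Off X the coefficient is F⁻¹ applied to the modified function. Near a point ξ of X it is the
    -- constant v(ξ), so the definition on X extends it differentiably.
    refine hF.picone_of_factor (h := fun x => if x ∈ X then v x else (Ring.inverse (F x)) (fn n x))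
      hT (hfn n) (hdfn n) ?_ ?_ ?_
    · intro x hx
      by_cases hxX : x ∈ X
      · simp only [hxX, if_true]
        exact (hnear n hn x hxX x (by simp)).2
      · simp only [hxX, if_false]
        rw [← mul_apply_eq_comp, Ring.mul_inverse_cancel _ (hX x hx hxX)]; rfl
    · intro x hx
      by_cases hxX : x ∈ X
      · have hnb : {y : ℝ | (n : ℝ) * |y - x| < 1} ∈ nhdsWithin x (Ici 0) :=
          mem_nhdsWithin_of_mem_nhds ((isOpen_lt (by fun_prop) continuous_const).mem_nhds
            (by simp))
        have hev : (fun x => if x ∈ X then v x else (Ring.inverse (F x)) (fn n x))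
            =ᶠ[nhdsWithin x (Ici 0)] fun _ => v x := by
          filter_upwards [hnb, self_mem_nhdsWithin] with y hy hy0
          obtain ⟨ha, hb⟩ := hnear n hn x hxX y hy
          by_cases hyx : y = x
          · subst hyx; simp [hxX]
          · have hyX : y ∉ X := fun h => by
              have := ha y h hyx
              simp at this
              linarith
            simp only [hyX, if_false]
            rw [hb, ← mul_apply_eq_comp, Ring.inverse_mul_cancel _ (hX y hy0 hyX)]
            rfl
        exact (differentiableWithinAt_const (v x)).congr_of_eventuallyEq hev
          (hev.self_of_nhdsWithin hx)
      · have hnb : {y : ℝ | y ∉ X} ∈ nhdsWithin x (Ici 0) :=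
          mem_nhdsWithin_of_mem_nhds (X.finite_toSet.isClosed.isOpen_compl.mem_nhds hxX)
        have hev : (fun x => if x ∈ X then v x else (Ring.inverse (F x)) (fn n x))
            =ᶠ[nhdsWithin x (Ici 0)] fun x => (Ring.inverse (F x)) (fn n x) := by
          filter_upwards [hnb] with y hy
          have : y ∉ X := hy
          simp [this]
        refine DifferentiableWithinAt.congr_of_eventuallyEq ?_ hev (hev.self_of_nhdsWithin hx)
        obtain ⟨U, hU⟩ := hX x hx hxX
        have h1 := hasFDerivAt_ringInverse (𝕜 := ℝ) U
        rw [hU] at h1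
        have h2 := h1.comp_hasDerivWithinAt x (hF.hasDerivWithinAt_fst hx)
        exact (h2.clm_apply (hfn n x hx)).differentiableWithinAt
    · simp only [fn, hfT, zero_sub, neg_eq_zero]
      apply Finset.sum_eq_zero
      intro ξ hξ
      rw [plateau_eq_zero, zero_smul]
      have := hXT ξ hξ
      rw [abs_of_nonneg (mul_nonneg hn0.le (by linarith))]
      nlinarith
  -- passage to the limit
  have hbd : ∃ C, ∀ n : ℕ, ∀ x ∈ Icc 0 T, ‖fn n x‖ ≤ C ∧ ‖dfn n x‖ ≤ C := by
    have h1 : ∀ ξ ∈ X, ∃ C, ∀ n : ℕ, ∀ x ∈ Icc 0 T, ‖plateau (n * (x - ξ)) • e ξ x‖ ≤ C ∧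
      ‖plateau (n * (x - ξ)) • de ξ x + (n * deriv plateau (n * (x - ξ))) • e ξ x‖ ≤ C := by
      intro ξ hξ
      exact exists_bound_plateau_smul ⟨hXn ξ hξ, by linarith [hXT ξ hξ]⟩ (he ξ) (hde ξ)
        (by simp [e, hv ξ hξ])
    choose! C hC using h1
    obtain ⟨K1, hK1⟩ := isCompact_Icc.exists_bound_of_continuousOn
      (hfc.mono (fun x (hx : x ∈ Icc 0 T) => hx.1))
    obtain ⟨K2, hK2⟩ := isCompact_Icc.exists_bound_of_continuousOn
      (hdf.mono (fun x (hx : x ∈ Icc 0 T) => hx.1))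
    refine ⟨max K1 K2 + ∑ ξ ∈ X, C ξ, fun n x hx => ⟨?_, ?_⟩⟩
    · refine (norm_sub_le _ _).trans (add_le_add ((hK1 x hx).trans (le_max_left _ _)) ?_)
      exact norm_sum_le_of_le _ fun ξ hξ => (hC ξ hξ n x hx).1
    · refine (norm_sub_le _ _).trans (add_le_add ((hK2 x hx).trans (le_max_right _ _)) ?_)
      exact norm_sum_le_of_le _ fun ξ hξ => (hC ξ hξ n x hx).2
  obtain ⟨C, hC⟩ := hbd
  obtain ⟨M, hM⟩ := ((isCompact_Icc (a := (0 : ℝ)) (b := T)).prod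
    ((isCompact_closedBall (0 : E) C).prod (isCompact_closedBall (0 : E) C))).exists_bound_of_continuousOn
    (H.continuous_dens lam).continuousOn
  have hlim : Filter.Tendsto (fun n : ℕ => ∫ x in (0 : ℝ)..T, H.dens lam x (fn n x) (dfn n x))
      Filter.atTop (nhds (∫ x in (0 : ℝ)..T, H.dens lam x (f x) (df x))) := by
    apply intervalIntegral.tendsto_integral_filter_of_dominated_convergence (fun _ => M)
    · refine Filter.Eventually.of_forall fun n => ?_
      rw [uIoc_of_le hT]
      refine ContinuousOn.aestronglyMeasurable ?_ measurableSet_Ioc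
      exact (H.continuousOn_dens lam (fun x hx => (hfn n x hx).continuousWithinAt) (hdfn n)).mono
        (fun x hx => le_of_lt hx.1)
    · refine Filter.Eventually.of_forall fun n => Filter.Eventually.of_forall fun x hx => ?_
      rw [uIoc_of_le hT] at hx
      have hx' : x ∈ Icc 0 T := Ioc_subset_Icc_self hx
      exact hM (x, fn n x, dfn n x) ⟨hx', by simpa using (hC n x hx').1,
        by simpa using (hC n x hx').2⟩
    · exact intervalIntegrable_const
    -- Off the null set X the modified function agrees with f at x for all large n, derivative
    -- included, so pointwise convergence is trivial.
    · have hnull : ∀ᵐ x : ℝ, x ∉ (X : Set ℝ) := by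
        rw [ae_iff]
        simpa using X.finite_toSet.measure_zero volume
      filter_upwards [hnull] with x hxX _
      apply tendsto_const_nhds.congr'
      have hev : ∀ ξ ∈ X, ∀ᶠ n : ℕ in Filter.atTop, 2 < |(n : ℝ) * (x - ξ)| := by
        intro ξ hξ
        have hne : 0 < |x - ξ| := abs_pos.2 (sub_ne_zero.2 fun h => hxX (h ▸ hξ))
        filter_upwards [(tendsto_natCast_atTop_atTop (R := ℝ)).eventually_gt_atTop (2 / |x - ξ|)]
          with n hn
        rw [abs_mul, Nat.abs_cast]
        rwa [div_lt_iff₀ hne] at hn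
      filter_upwards [(Filter.eventually_all_finset X).2 hev] with n hn
      have h1 : fn n x = f x := by
        simp only [fn]
        rw [Finset.sum_eq_zero, sub_zero]
        intro ξ hξ
        rw [plateau_eq_zero (hn ξ hξ).le, zero_smul]
      have h2 : dfn n x = df x := by
        simp only [dfn]
        rw [Finset.sum_eq_zero, sub_zero]
        intro ξ hξ
        rw [plateau_eq_zero (hn ξ hξ).le, zero_smul, deriv_plateau_eq_zero (hn ξ hξ)]; simp
      rw [h1, h2]
  refine ge_of_tendsto (hlim.const_add (inner ℝ (H.β (f 0)) (f 0))) ?_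
  filter_upwards [Filter.eventually_ge_atTop N] with n hn using hpos n hn

end Hamiltonian

end StochasticAiry

namespace StochasticAiry

/-! ### Minimizers of Rayleigh quotients -/

section Rayleigh

variable {V L : Type*} [NormedAddCommGroup V] [InnerProductSpace ℝ V] [CompleteSpace V]
  [NormedAddCommGroup L] [InnerProductSpace ℝ L]

lemma eq_zero_of_forall_two_mul_add_sq_nonneg {a b : ℝ} (h : ∀ t : ℝ, 0 ≤ 2 * t * a + t ^ 2 * b) :
    a = 0 := by
  by_contra ha
  rcases lt_trichotomy b 0 with hb | hb | hb
  · have h1 := h 1; have h2 := h (-1); nlinarith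
  · have h1 := h 1; have h2 := h (-1); subst hb; apply ha; linarith
  · have h1 := h (-a / b)
    have h2 : 2 * (-a / b) * a + (-a / b) ^ 2 * b = -(a ^ 2 / b) := by field_simp; ring
    rw [h2] at h1
    have : 0 < a ^ 2 / b := by positivity
    linarith

/-- The Euler-Lagrange equation of a Rayleigh quotient. -/
lemma euler_lagrange_of_forall_le {q : LinearMap.BilinForm ℝ V} (hs : ∀ u v, q u v = q v u)
    {J : V →L[ℝ] L} {M : Submodule ℝ V} {κ : ℝ} (hmin : ∀ v ∈ M, κ * ‖J v‖ ^ 2 ≤ q v v) {u : V}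
    (hu : u ∈ M) (hq : q u u = κ * ‖J u‖ ^ 2) :
    ∀ v ∈ M, q u v = κ * inner ℝ (J u) (J v) := by
  intro v hv
  have h : ∀ t : ℝ, 0 ≤ 2 * t * (q u v - κ * inner ℝ (J u) (J v)) +
      t ^ 2 * (q v v - κ * ‖J v‖ ^ 2) := by
    intro t
    have h1 := hmin (u + t • v) (M.add_mem hu (M.smul_mem t hv))
    have h2 : q (u + t • v) (u + t • v) = q u u + 2 * t * q u v + t ^ 2 * q v v := by
      simp only [map_add, map_smul, LinearMap.add_apply, LinearMap.smul_apply, smul_eq_mul,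
        hs v u]; ring
    have h3 : ‖J (u + t • v)‖ ^ 2 = ‖J u‖ ^ 2 + 2 * t * inner ℝ (J u) (J v) + t ^ 2 * ‖J v‖ ^ 2 := by
      rw [map_add, map_smul, norm_add_sq_real, inner_smul_right, norm_smul, mul_pow,
        Real.norm_eq_abs, sq_abs]; ring
    rw [h2, h3, hq] at h1
    linarith
  linarith [eq_zero_of_forall_two_mul_add_sq_nonneg h]

/-- The direct method: coercivity bounds a minimizing sequence, compactness makes its image under J
converge along a subsequence, and the parallelogram law for q then makes the subsequence itself
Cauchy, so weak limits are not needed. The last clause matters for the strict inequality in the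
eigenvalue count: if the infimum is already lam, the trial vector z is returned. -/
lemma exists_rayleigh_minimizer {q : LinearMap.BilinForm ℝ V} (hs : ∀ u v, q u v = q v u)
    (hqc : Continuous fun u => q u u) {J : V →L[ℝ] L}
    (hJ : ∀ R : ℝ, ∃ K : Set L, IsCompact K ∧ ∀ u, ‖u‖ ≤ R → J u ∈ K) {c C : ℝ} (hc : 0 < c)
    (hcoer : ∀ u, c * ‖u‖ ^ 2 ≤ q u u + C * ‖J u‖ ^ 2) {M : Submodule ℝ V}
    (hM : IsClosed (M : Set V)) {z : V} (hz : z ∈ M) (hJz : J z ≠ 0) {lam : ℝ}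
    (hqz : q z z ≤ lam * ‖J z‖ ^ 2) :
    ∃ u ∈ M, ∃ κ ≤ lam, J u ≠ 0 ∧ (∀ v ∈ M, q u v = κ * inner ℝ (J u) (J v)) ∧
      (κ = lam → u = z) := by
  set S : Set ℝ := {t | ∃ u ∈ M, ‖J u‖ = 1 ∧ q u u = t} with hS
  have hnorm : ∀ v ∈ M, J v ≠ 0 → q v v / ‖J v‖ ^ 2 ∈ S := by
    intro v hv hJv
    have h0 : ‖J v‖ ≠ 0 := norm_ne_zero_iff.2 hJv
    refine ⟨‖J v‖⁻¹ • v, M.smul_mem _ hv, ?_, ?_⟩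
    · rw [map_smul, norm_smul, norm_inv, norm_norm, inv_mul_cancel₀ h0]
    · simp only [map_smul, LinearMap.smul_apply, smul_eq_mul]; field_simp
  have hSne : S.Nonempty := ⟨_, hnorm z hz hJz⟩
  have hSb : BddBelow S := by
    refine ⟨-C, ?_⟩
    rintro t ⟨u, _, hu1, rfl⟩
    have := hcoer u
    rw [hu1] at this
    nlinarith [sq_nonneg ‖u‖]
  set κ := sInf S with hκ
  have hmin : ∀ v ∈ M, κ * ‖J v‖ ^ 2 ≤ q v v := by
    intro v hv
    by_cases hJv : J v = 0
    · have := hcoer v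
      rw [hJv, norm_zero] at this ⊢
      nlinarith [sq_nonneg ‖v‖]
    · have h1 := csInf_le hSb (hnorm v hv hJv)
      rwa [le_div_iff₀ (by positivity)] at h1
  have hzpos : 0 < ‖J z‖ ^ 2 := by positivity
  have hκlam : κ ≤ lam := le_of_mul_le_mul_right ((hmin z hz).trans hqz) hzpos
  -- If the infimum equals lam, then z attains it and satisfies the Euler-Lagrange equation itself.
  rcases hκlam.eq_or_lt with heq | hlt
  · refine ⟨z, hz, κ, hκlam, hJz, euler_lagrange_of_forall_le hs hmin hz
      (le_antisymm (heq ▸ hqz) (hmin z hz)), fun _ => rfl⟩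
  have hseq : ∀ n : ℕ, ∃ u ∈ M, ‖J u‖ = 1 ∧ q u u < κ + 1 / ((n : ℝ) + 1) := by
    intro n
    obtain ⟨t, ⟨u, hu, hu1, rfl⟩, ht⟩ := exists_lt_of_csInf_lt hSne
      (show sInf S < κ + 1 / ((n : ℝ) + 1) by
        rw [← hκ]; have : (0 : ℝ) < 1 / ((n : ℝ) + 1) := by positivity
        linarith)
    exact ⟨u, hu, hu1, ht⟩
  choose u huM hu1 huq using hseq
  have hub : ∀ n, ‖u n‖ ≤ Real.sqrt ((κ + 1 + C) / c) := by
    intro n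
    apply Real.le_sqrt_of_sq_le
    rw [le_div_iff₀ hc]
    have h1 := hcoer (u n)
    rw [hu1 n] at h1
    have h2 : 1 / ((n : ℝ) + 1) ≤ 1 := by
      rw [div_le_one (by positivity)]; linarith [Nat.cast_nonneg (α := ℝ) n]
    have := huq n
    linarith
  obtain ⟨K, hK, hKu⟩ := hJ (Real.sqrt ((κ + 1 + C) / c))
  obtain ⟨l, -, φ, hφ, hl⟩ := hK.tendsto_subseq (fun n => hKu (u n) (hub n))
  have hcau : CauchySeq (fun n => u (φ n)) := by
    have hJc := hl.cauchySeq
    rw [Metric.cauchySeq_iff] at *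
    intro ε hε
    set ε' := c * ε ^ 2 with hε'
    have hε'0 : 0 < ε' := by positivity
    -- Half of ε' = c ε² pays for the term (κ + C)‖J(u - u')‖²; the other half is 4 · ε'/8, from the
    -- excess of q over κ in the parallelogram law.
    obtain ⟨δ, hδ0, hδ⟩ : ∃ δ > 0, (|κ| + |C|) * δ ^ 2 < ε' / 2 := by
      refine ⟨Real.sqrt (ε' / (4 * (|κ| + |C| + 1))), by positivity, ?_⟩
      rw [Real.sq_sqrt (by positivity)]
      rw [mul_div_assoc', div_lt_div_iff₀ (by positivity) (by positivity)]
      nlinarith [abs_nonneg κ, abs_nonneg C]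
    obtain ⟨N1, hN1⟩ := hJc δ hδ0
    obtain ⟨N2, hN2⟩ := exists_nat_gt (8 / ε')
    refine ⟨max N1 N2, fun m hm n hn => ?_⟩
    have hq : ∀ n, N2 ≤ n → q (u (φ n)) (u (φ n)) ≤ κ + ε' / 8 := by
      intro n hn
      refine (huq _).le.trans (add_le_add le_rfl ?_)
      rw [div_le_iff₀ (by positivity)]
      rw [div_lt_iff₀ hε'0] at hN2
      have h1 : (N2 : ℝ) ≤ φ n := by exact_mod_cast hn.trans (hφ.id_le n)
      nlinarith
    have h1 := hq m ((le_max_right _ _).trans hm)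
    have h2 := hq n ((le_max_right _ _).trans hn)
    have h3 := hN1 m ((le_max_left _ _).trans hm) n ((le_max_left _ _).trans hn)
    have h4 := hcoer (u (φ m) - u (φ n))
    have h5 := hmin (u (φ m) + u (φ n)) (M.add_mem (huM _) (huM _))
    have h6 : q (u (φ m) + u (φ n)) (u (φ m) + u (φ n)) +
        q (u (φ m) - u (φ n)) (u (φ m) - u (φ n)) =
        2 * q (u (φ m)) (u (φ m)) + 2 * q (u (φ n)) (u (φ n)) := by
      simp only [map_add, map_sub, LinearMap.add_apply, LinearMap.sub_apply]; ring
    have h7 := parallelogram_law_with_norm ℝ (J (u (φ m))) (J (u (φ n)))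
    rw [hu1, hu1, ← map_add, ← map_sub] at h7
    simp only [Function.comp_apply, dist_eq_norm, ← map_sub] at h3
    have h8 : (κ + C) * ‖J (u (φ m) - u (φ n))‖ ^ 2 ≤ (|κ| + |C|) * δ ^ 2 := by
      have h9 : ‖J (u (φ m) - u (φ n))‖ ^ 2 ≤ δ ^ 2 := by gcongr
      calc _ ≤ (|κ| + |C|) * ‖J (u (φ m) - u (φ n))‖ ^ 2 := by
            gcongr
            · exact le_abs_self κ
            · exact le_abs_self C
        _ ≤ _ := by gcongr
    rw [dist_eq_norm]
    have h10 : c * ‖u (φ m) - u (φ n)‖ ^ 2 < c * ε ^ 2 := by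
      rw [← hε']
      rw [eq_sub_of_add_eq h7] at h5
      rw [add_mul] at h8
      linarith
    exact lt_of_pow_lt_pow_left₀ 2 hε.le (lt_of_mul_lt_mul_left h10 hc.le)
  obtain ⟨w, hw⟩ := cauchySeq_tendsto_of_complete hcau
  have hwM : w ∈ M := hM.mem_of_tendsto hw (Filter.Eventually.of_forall fun n => huM _)
  have hJw : ‖J w‖ = 1 := by
    have h1 : Filter.Tendsto (fun n => ‖J (u (φ n))‖) Filter.atTop (nhds ‖J w‖) :=
      (J.continuous.norm.tendsto w).comp hw
    have h2 : (fun n => ‖J (u (φ n))‖) = fun _ => 1 := funext fun n => hu1 _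
    rw [h2] at h1
    exact tendsto_nhds_unique h1 tendsto_const_nhds
  have hqw : q w w = κ * ‖J w‖ ^ 2 := by
    apply le_antisymm _ (hmin w hwM)
    have h1 : Filter.Tendsto (fun n => q (u (φ n)) (u (φ n))) Filter.atTop (nhds (q w w)) :=
      (hqc.tendsto w).comp hw
    have h2 : Filter.Tendsto (fun n => κ + 1 / (((φ n : ℕ) : ℝ) + 1)) Filter.atTop (nhds (κ + 0)) :=
      tendsto_const_nhds.add ((tendsto_one_div_add_atTop_nhds_zero_nat).comp hφ.tendsto_atTop)
    rw [hJw]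
    have := le_of_tendsto_of_tendsto' h1 h2 (fun n => (huq _).le)
    linarith
  refine ⟨w, hwM, κ, hκlam, fun h => ?_, euler_lagrange_of_forall_le hs hmin hwM hqw,
    fun h => absurd h hlt.ne⟩
  rw [h, norm_zero] at hJw
  exact zero_ne_one hJw

end Rayleigh

end StochasticAiry

namespace StochasticAiry

/-! ### The form domain as a Hilbert space -/

/-- Lebesgue measure on the half-line. -/
abbrev halfLine : Measure ℝ := volume.restrict (Ioi (0 : ℝ))

/-- Square-integrable functions on the half-line. -/
abbrev HalfL2 (E : Type*) [NormedAddCommGroup E] := Lp E 2 halfLine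

section L2

variable {E : Type*} [NormedAddCommGroup E] [InnerProductSpace ℝ E]

lemma LocInt.of_memLp {h : ℝ → E} (hh : MemLp h 2 halfLine) : LocInt h := by
  intro T hT
  rw [intervalIntegrable_iff_integrableOn_Ioc_of_le hT]
  have h1 : MemLp h 2 (volume.restrict (Ioc 0 T)) :=
    hh.mono_measure (Measure.restrict_mono Ioc_subset_Ioi_self le_rfl)
  exact h1.integrable (by norm_num)

lemma norm_sq_halfL2 (u : HalfL2 E) : ‖u‖ ^ 2 = ∫ x in Ioi (0 : ℝ), ‖u x‖ ^ 2 := by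
  rw [← real_inner_self_eq_norm_sq, L2.inner_def]
  simp

lemma integrable_norm_sq_halfL2 (u : HalfL2 E) :
    Integrable (fun x => ‖u x‖ ^ 2) halfLine := (Lp.memLp u).integrable_norm_pow (by norm_num)

/-- Cauchy-Schwarz on [a, b], in the form that the variance of ‖h‖ around its mean m is nonnegative.
-/
lemma sq_norm_integral_le {h : ℝ → E} {a b : ℝ} (hab : a ≤ b)
    (hh : MemLp h 2 (volume.restrict (Ioc a b))) :
    ‖∫ x in a..b, h x‖ ^ 2 ≤ (b - a) * ∫ x in a..b, ‖h x‖ ^ 2 := by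
  rcases hab.eq_or_lt with rfl | hlt
  · simp
  have hi : IntervalIntegrable h volume a b := by
    rw [intervalIntegrable_iff_integrableOn_Ioc_of_le hab]; exact hh.integrable (by norm_num)
  have hi2 : IntervalIntegrable (fun x => ‖h x‖ ^ 2) volume a b := by
    rw [intervalIntegrable_iff_integrableOn_Ioc_of_le hab]
    exact hh.integrable_norm_pow (by norm_num)
  have hin := hi.norm
  set I := ∫ x in a..b, ‖h x‖ with hI
  set m := I / (b - a) with hm
  have h0 : 0 < b - a := sub_pos.2 hlt
  have h1 : 0 ≤ ∫ x in a..b, (‖h x‖ - m) ^ 2 :=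
    intervalIntegral.integral_nonneg hab fun x _ => sq_nonneg _
  have h2 : ∫ x in a..b, (‖h x‖ - m) ^ 2 =
      (∫ x in a..b, ‖h x‖ ^ 2) - 2 * m * I + m ^ 2 * (b - a) := by
    have : (fun x => (‖h x‖ - m) ^ 2) = fun x => ‖h x‖ ^ 2 - 2 * m * ‖h x‖ + m ^ 2 := by
      funext x; ring
    rw [this, intervalIntegral.integral_add (hi2.sub (hin.const_mul _)) intervalIntegrable_const,
      intervalIntegral.integral_sub hi2 (hin.const_mul _), intervalIntegral.integral_const_mul,
      intervalIntegral.integral_const, smul_eq_mul]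
    ring
  have h3 : ‖∫ x in a..b, h x‖ ^ 2 ≤ I ^ 2 := by
    gcongr
    exact intervalIntegral.norm_integral_le_integral_norm hab
  have h4 : I = m * (b - a) := by rw [hm]; field_simp
  rw [h2] at h1
  rw [h4] at h1 h3
  nlinarith

/-- The primitive at the point `x` of a square-integrable function. -/
def primL (E : Type*) [NormedAddCommGroup E] [InnerProductSpace ℝ E] (x : ℝ) : HalfL2 E →L[ℝ] E :=
  LinearMap.mkContinuous
    { toFun := fun h => ∫ t in (0 : ℝ)..(max x 0), h t
      map_add' := fun h k => by
        rw [← intervalIntegral.integral_add (LocInt.of_memLp (Lp.memLp h) _ (le_max_right _ _))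
          (LocInt.of_memLp (Lp.memLp k) _ (le_max_right _ _))]
        rw [intervalIntegral.integral_of_le (le_max_right _ _),
          intervalIntegral.integral_of_le (le_max_right _ _)]
        exact integral_congr_ae (ae_restrict_of_ae_restrict_of_subset Ioc_subset_Ioi_self
          (Lp.coeFn_add h k))
      map_smul' := fun c h => by
        rw [RingHom.id_apply, ← intervalIntegral.integral_smul]
        rw [intervalIntegral.integral_of_le (le_max_right _ _),
          intervalIntegral.integral_of_le (le_max_right _ _)]
        exact integral_congr_ae (ae_restrict_of_ae_restrict_of_subset Ioc_subset_Ioi_self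
          (Lp.coeFn_smul c h)) }
    (√(max x 0)) (fun h => by
      have h0 : (0 : ℝ) ≤ max x 0 := le_max_right _ _
      refine (sq_le_sq₀ (norm_nonneg _) (by positivity)).1 ?_
      rw [mul_pow, Real.sq_sqrt h0, norm_sq_halfL2]
      refine (sq_norm_integral_le h0 ((Lp.memLp h).mono_measure
        (Measure.restrict_mono Ioc_subset_Ioi_self le_rfl))).trans ?_
      rw [sub_zero]
      gcongr
      rw [intervalIntegral.integral_of_le h0]
      exact setIntegral_mono_set (integrable_norm_sq_halfL2 h)
        (Filter.Eventually.of_forall fun x => sq_nonneg _)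
        (Filter.Eventually.of_forall Ioc_subset_Ioi_self))

lemma primL_apply {x : ℝ} (hx : 0 ≤ x) (h : HalfL2 E) :
    primL E x h = ∫ t in (0 : ℝ)..x, h t := by
  change ∫ t in (0 : ℝ)..(max x 0), h t = _
  rw [max_eq_left hx]

/-- The weight `(1 + x) ^ (-1/2)`. -/
def wt (x : ℝ) : ℝ := (√(1 + x))⁻¹

lemma measurable_wt : Measurable wt := by unfold wt; fun_prop

lemma wt_sq {x : ℝ} (hx : 0 ≤ x) : wt x ^ 2 * (1 + x) = 1 := by
  rw [wt, inv_pow, Real.sq_sqrt (by linarith), inv_mul_cancel₀ (by linarith)]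

lemma wt_mul {x : ℝ} (hx : 0 ≤ x) : wt x * √(1 + x) = 1 := by
  have : 0 < √(1 + x) := Real.sqrt_pos.2 (by linarith)
  rw [wt, inv_mul_cancel₀ this.ne']

lemma wt_nonneg (x : ℝ) : 0 ≤ wt x := inv_nonneg.2 (Real.sqrt_nonneg _)

lemma wt_le_one {x : ℝ} (hx : 0 ≤ x) : wt x ≤ 1 :=
  inv_le_one_of_one_le₀ (Real.one_le_sqrt.2 (by linarith))

lemma ae_halfLine {P : ℝ → Prop} (h : ∀ x, 0 < x → P x) : ∀ᵐ x ∂halfLine, P x := by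
  rw [ae_restrict_iff' measurableSet_Ioi]
  exact Filter.Eventually.of_forall h

/-- Multiplication by a bounded operator-valued function. -/
def mulOp {F : Type*} [NormedAddCommGroup F] [NormedSpace ℝ F] {a : ℝ → E →L[ℝ] F}
    (ha : MemLp a ∞ halfLine) : HalfL2 E →L[ℝ] HalfL2 F :=
  (ContinuousLinearMap.id ℝ (E →L[ℝ] F)).holderL halfLine ∞ 2 2 ha.toLp

lemma mulOp_ae {F : Type*} [NormedAddCommGroup F] [NormedSpace ℝ F] {a : ℝ → E →L[ℝ] F}
    (ha : MemLp a ∞ halfLine) (u : HalfL2 E) : mulOp ha u =ᵐ[halfLine] fun x => a x (u x) := by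
  filter_upwards [(ContinuousLinearMap.id ℝ (E →L[ℝ] F)).coeFn_holder (r := 2) ha.toLp u,
    ha.coeFn_toLp] with x hx hx2
  rw [mulOp, ContinuousLinearMap.holderL_apply_apply, hx, hx2]
  rfl

lemma memLp_wt : MemLp (fun x => wt x • ContinuousLinearMap.id ℝ E) ∞ halfLine := by
  refine memLp_top_of_bound ?_ 1 (ae_halfLine fun x hx => ?_)
  · exact (measurable_wt.aestronglyMeasurable).smul_const _
  · rw [norm_smul, Real.norm_eq_abs, abs_of_nonneg (wt_nonneg x)]
    calc wt x * ‖ContinuousLinearMap.id ℝ E‖ ≤ 1 * 1 := by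
          gcongr
          · exact wt_le_one hx.le
          · exact ContinuousLinearMap.norm_id_le
      _ = 1 := one_mul 1

/-- Triples: the value at the origin, the derivative, and `√(1 + x)` times the function. -/
abbrev Triple (E : Type*) [NormedAddCommGroup E] := WithLp 2 (E × WithLp 2 (HalfL2 E × HalfL2 E))

namespace Triple

variable (E) in
/-- The value at the origin. -/
def y : Triple E →L[ℝ] E := WithLp.fstL 2 ℝ _ _

variable (E) in
/-- The derivative. -/
def h : Triple E →L[ℝ] HalfL2 E := (WithLp.fstL 2 ℝ _ _).comp (WithLp.sndL 2 ℝ _ _)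

variable (E) in
/-- The weighted function. -/
def u : Triple E →L[ℝ] HalfL2 E := (WithLp.sndL 2 ℝ _ _).comp (WithLp.sndL 2 ℝ _ _)

variable (E) in
/-- The function. -/
def emb : Triple E →L[ℝ] HalfL2 E := (mulOp memLp_wt).comp (u E)

lemma emb_ae (z : Triple E) : emb E z =ᵐ[halfLine] fun x => wt x • u E z x := mulOp_ae memLp_wt _

lemma norm_sq (z : Triple E) : ‖z‖ ^ 2 = ‖y E z‖ ^ 2 + ‖h E z‖ ^ 2 + ‖u E z‖ ^ 2 := by
  rw [WithLp.prod_norm_sq_eq_of_L2, WithLp.prod_norm_sq_eq_of_L2, add_assoc]; rfl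

lemma norm_emb_sq (z : Triple E) : ‖emb E z‖ ^ 2 = ∫ x in Ioi (0 : ℝ), ‖emb E z x‖ ^ 2 :=
  norm_sq_halfL2 _

lemma norm_u_sq (z : Triple E) :
    ‖u E z‖ ^ 2 = ∫ x in Ioi (0 : ℝ), (1 + x) * ‖emb E z x‖ ^ 2 := by
  rw [norm_sq_halfL2]
  apply integral_congr_ae
  filter_upwards [emb_ae z, ae_halfLine fun x hx => wt_sq hx.le] with x hx hx0
  rw [hx, norm_smul, mul_pow, Real.norm_eq_abs, sq_abs, ← mul_assoc, mul_comm (1 + x), hx0, one_mul]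

lemma integrable_weighted (z : Triple E) :
    Integrable (fun x => (1 + x) * ‖emb E z x‖ ^ 2) halfLine := by
  apply (integrable_norm_sq_halfL2 (u E z)).congr
  filter_upwards [emb_ae z, ae_halfLine fun x hx => wt_sq hx.le] with x hx hx0
  rw [hx, norm_smul, mul_pow, Real.norm_eq_abs, sq_abs, ← mul_assoc, mul_comm (1 + x), hx0, one_mul]

variable (E) in
/-- The value at the point `x`. -/
def ev (x : ℝ) : Triple E →L[ℝ] E := y E + (primL E x).comp (h E)

lemma ev_apply {x : ℝ} (hx : 0 ≤ x) (z : Triple E) :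
    ev E x z = y E z + ∫ t in (0 : ℝ)..x, h E z t := by
  change y E z + primL E x (h E z) = _
  rw [primL_apply hx]

variable (E) in
/-- The continuous representative, extended by zero to the negative half-line. -/
def rep : Triple E →ₗ[ℝ] (ℝ → E) := LinearMap.pi fun x => if x < 0 then 0 else (ev E x).toLinearMap

lemma rep_of_neg {x : ℝ} (hx : x < 0) (z : Triple E) : rep E z x = 0 := by
  simp [rep, hx]

lemma rep_apply {x : ℝ} (hx : 0 ≤ x) (z : Triple E) :
    rep E z x = y E z + ∫ t in (0 : ℝ)..x, h E z t := by
  rw [← ev_apply hx]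
  simp [rep, not_lt.2 hx]

lemma rep_zero (z : Triple E) : rep E z 0 = y E z := by rw [rep_apply le_rfl]; simp

lemma locInt_h (z : Triple E) : LocInt (h E z) := LocInt.of_memLp (Lp.memLp _)

lemma rep_eq (z : Triple E) {x : ℝ} (hx : 0 ≤ x) :
    rep E z x = rep E z 0 + ∫ t in (0 : ℝ)..x, h E z t := by rw [rep_zero, rep_apply hx]

lemma continuousOn_rep [CompleteSpace E] (z : Triple E) : ContinuousOn (rep E z) (Ici 0) :=
  ((locInt_h z).continuousOn_primitive (y E z)).congr fun _ hx => rep_apply hx z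

lemma ae_hasDerivAt_rep [CompleteSpace E] (z : Triple E) :
    ∀ᵐ x ∂halfLine, HasDerivAt (rep E z) (h E z x) x := by
  have : ∀ n : ℕ, ∀ᵐ x, x ∈ uIcc 0 (n : ℝ) →
      HasDerivAt (fun x => ∫ t in (0 : ℝ)..x, h E z t) (h E z x) x := fun n => by
    filter_upwards [(locInt_h z (n : ℝ) (Nat.cast_nonneg n)).ae_hasDerivAt_integral] with x hx hm
    exact hx hm 0 left_mem_uIcc
  rw [ae_restrict_iff' measurableSet_Ioi]
  filter_upwards [ae_all_iff.2 this] with x hx hx0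
  obtain ⟨n, hn⟩ := exists_nat_ge x
  refine ((hx n (by rw [uIcc_of_le (Nat.cast_nonneg n)]; exact ⟨le_of_lt hx0, hn⟩)).const_add
    (y E z)).congr_of_eventuallyEq ?_
  filter_upwards [Ioi_mem_nhds hx0] with t ht
  exact rep_apply (le_of_lt ht) z

end Triple

end L2

namespace Hamiltonian

variable {E : Type*} [NormedAddCommGroup E] [InnerProductSpace ℝ E]

open Triple

/-- The form domain: functions with `f(0) ∈ D`, `f' ∈ L²` and `√(1 + x) f ∈ L²`. -/
def formSpace (H : Hamiltonian E) : Submodule ℝ (Triple E) where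
  carrier := {z | y E z ∈ H.D ∧ ∀ᵐ x ∂halfLine, emb E z x = rep E z x}
  add_mem' := by
    rintro z w ⟨hz, hz'⟩ ⟨hw, hw'⟩
    refine ⟨by rw [map_add]; exact H.D.add_mem hz hw, ?_⟩
    filter_upwards [hz', hw', Lp.coeFn_add (emb E z) (emb E w)] with x h1 h2 h3
    rw [map_add, h3, map_add, Pi.add_apply, Pi.add_apply, h1, h2]
  zero_mem' := by
    refine ⟨by rw [map_zero]; exact H.D.zero_mem, ?_⟩
    filter_upwards [Lp.coeFn_zero E 2 halfLine] with x hx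
    rw [map_zero, hx, map_zero]
  smul_mem' := by
    rintro c z ⟨hz, hz'⟩
    refine ⟨by rw [map_smul]; exact H.D.smul_mem c hz, ?_⟩
    filter_upwards [hz', Lp.coeFn_smul c (emb E z)] with x h1 h3
    rw [map_smul, h3, map_smul, Pi.smul_apply, Pi.smul_apply, h1]

/-- L²-convergence of the functions gives almost everywhere convergence along a subsequence, while
the representatives converge pointwise because evaluation is continuous in the triple. -/
lemma isClosed_formSpace [FiniteDimensional ℝ E] (H : Hamiltonian E) :
    IsClosed (H.formSpace : Set (Triple E)) := by
  apply IsSeqClosed.isClosed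
  intro zn z hzn hz
  constructor
  · exact (Submodule.closed_of_finiteDimensional H.D).mem_of_tendsto
      (((y E).continuous.tendsto z).comp hz) (Filter.Eventually.of_forall fun n => (hzn n).1)
  · have h1 := tendstoInMeasure_of_tendsto_Lp (((emb E).continuous.tendsto z).comp hz)
    obtain ⟨φ, hφ, hφ'⟩ := h1.exists_seq_tendsto_ae
    have h2 : ∀ᵐ x ∂halfLine, ∀ n, emb E (zn n) x = rep E (zn n) x :=
      ae_all_iff.2 fun n => (hzn n).2
    filter_upwards [hφ', h2, ae_halfLine fun x hx => hx.le] with x h3 h4 hx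
    refine tendsto_nhds_unique h3 ?_
    have h5 : Filter.Tendsto (fun n => ev E x (zn (φ n))) Filter.atTop (nhds (ev E x z)) :=
      ((ev E x).continuous.tendsto z).comp (hz.comp hφ.tendsto_atTop)
    rw [rep_apply hx, ← ev_apply hx]
    refine h5.congr fun n => ?_
    rw [Function.comp_apply, h4, rep_apply hx, ← ev_apply hx]

/-- The representative determines all three components: its value at 0, its almost everywhere
derivative, and the function up to a positive weight. -/
lemma rep_injOn (H : Hamiltonian E) {z : Triple E} (hz : z ∈ H.formSpace) (h0 : rep E z = 0)
    [CompleteSpace E] : z = 0 := by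
  have hy : y E z = 0 := by rw [← rep_zero, h0]; rfl
  have hJ : ∀ᵐ x ∂halfLine, emb E z x = 0 := by
    filter_upwards [hz.2] with x hx
    rw [hx, h0]; rfl
  have hu : u E z = 0 := by
    apply Lp.ext
    filter_upwards [hJ, emb_ae z, Lp.coeFn_zero E 2 halfLine, ae_halfLine fun x hx => wt_sq hx.le]
      with x h1 h2 h3 h4
    rw [h3, Pi.zero_apply]
    rw [h1] at h2
    rcases smul_eq_zero.1 h2.symm with h | h
    · rw [h] at h4; norm_num at h4
    · exact h
  have hh : h E z = 0 := by
    apply Lp.ext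
    filter_upwards [ae_hasDerivAt_rep z, Lp.coeFn_zero E 2 halfLine] with x h1 h3
    rw [h3, Pi.zero_apply]
    rw [h0] at h1
    exact h1.unique (hasDerivAt_const x (0 : E))
  have := norm_sq z
  rw [hy, hu, hh] at this
  simpa using this

lemma exists_mem_formSpace (H : Hamiltonian E) {f h' : ℝ → E} (h0 : f 0 ∈ H.D)
    (hh : MemLp h' 2 halfLine) (hu : MemLp (fun x => √(1 + x) • f x) 2 halfLine)
    (hf : ∀ x, 0 ≤ x → f x = f 0 + ∫ t in (0 : ℝ)..x, h' t) :
    ∃ z ∈ H.formSpace, h E z =ᵐ[halfLine] h' ∧ emb E z =ᵐ[halfLine] f ∧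
      ∀ x, 0 ≤ x → rep E z x = f x := by
  set z : Triple E := WithLp.toLp 2 (f 0, WithLp.toLp 2 (hh.toLp, hu.toLp)) with hz
  have hhz : h E z =ᵐ[halfLine] h' := hh.coeFn_toLp
  have huz : u E z =ᵐ[halfLine] fun x => √(1 + x) • f x := hu.coeFn_toLp
  have hJ : emb E z =ᵐ[halfLine] f := by
    filter_upwards [emb_ae z, huz, ae_halfLine fun x hx => wt_mul hx.le] with x h1 h2 h3
    rw [h1, h2, smul_smul, h3, one_smul]
  have hr : ∀ x, 0 ≤ x → rep E z x = f x := by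
    intro x hx
    rw [rep_apply hx, hf x hx]
    congr 1
    rw [intervalIntegral.integral_of_le hx, intervalIntegral.integral_of_le hx]
    exact integral_congr_ae (ae_restrict_of_ae_restrict_of_subset Ioc_subset_Ioi_self hhz)
  refine ⟨z, ⟨h0, ?_⟩, hhz, hJ, hr⟩
  filter_upwards [hJ, ae_halfLine fun x hx => hx.le] with x h1 h2
  rw [h1, hr x h2]

end Hamiltonian

end StochasticAiry

namespace StochasticAiry

/-! ### Compactness from approximation by operators of finite rank -/

section Compactness

variable {V L : Type*} [NormedAddCommGroup V] [NormedSpace ℝ V]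
  [NormedAddCommGroup L] [NormedSpace ℝ L]

/-- A finite net for the bounded, finite-dimensional image of the ball under l pulls back to a net
for its image under J: ε/4 from the net, at most ε/2 from the error term, as differences in the ball
have norm at most 2R. -/
lemma exists_isCompact_of_forall_norm_le [CompleteSpace L] {E : Type*} [NormedAddCommGroup E]
    [NormedSpace ℝ E] [FiniteDimensional ℝ E] {J : V →L[ℝ] L}
    (hJ : ∀ ε > 0, ∃ (N : ℕ) (l : V →L[ℝ] (Fin N → E)), ∀ v, ‖J v‖ ≤ ‖l v‖ + ε * ‖v‖) (R : ℝ) :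
    ∃ K : Set L, IsCompact K ∧ ∀ v, ‖v‖ ≤ R → J v ∈ K := by
  refine ⟨closure (J '' {v | ‖v‖ ≤ R}), ?_, fun v hv => subset_closure ⟨v, hv, rfl⟩⟩
  refine TotallyBounded.isCompact_of_isClosed (TotallyBounded.closure ?_) isClosed_closure
  rw [Metric.totallyBounded_iff]
  intro ε hε
  rcases lt_or_ge R 0 with hR | hR
  · refine ⟨∅, finite_empty, ?_⟩
    rintro _ ⟨v, hv, rfl⟩
    exact absurd (hv.trans_lt hR) (not_lt.2 (norm_nonneg v))
  obtain ⟨N, l, hl⟩ := hJ (ε / (4 * (R + 1))) (by positivity)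
  have hb : TotallyBounded (l '' {v | ‖v‖ ≤ R}) := by
    have : Bornology.IsBounded (l '' {v | ‖v‖ ≤ R}) := by
      refine (Metric.isBounded_closedBall (x := (0 : Fin N → E)) (r := ‖l‖ * R)).subset ?_
      rintro _ ⟨v, hv, rfl⟩
      rw [mem_closedBall_zero_iff]
      exact l.le_opNorm_of_le hv
    exact (Metric.isBounded_iff_subset_closedBall 0).1 this |>.elim fun r hr =>
      (isCompact_closedBall _ _).totallyBounded.subset hr
  obtain ⟨t, ht, htf, hcov⟩ := Metric.finite_approx_of_totallyBounded hb (ε / 4) (by positivity)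
  choose! w hw using fun y (hy : y ∈ t) => ht hy
  refine ⟨(fun y => J (w y)) '' t, htf.image _, ?_⟩
  rintro _ ⟨v, hv, rfl⟩
  obtain ⟨y, hy, hvy⟩ := mem_iUnion₂.1 (hcov ⟨v, hv, rfl⟩)
  refine mem_iUnion₂.2 ⟨_, mem_image_of_mem _ hy, ?_⟩
  rw [mem_ball_iff_norm, ← map_sub]
  rw [mem_ball_iff_norm, ← (hw y hy).2, ← map_sub] at hvy
  have h1 : ‖v - w y‖ ≤ 2 * R := by
    have := norm_sub_le v (w y)
    have h2 : ‖w y‖ ≤ R := (hw y hy).1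
    have h3 : ‖v‖ ≤ R := hv
    linarith
  have h2 : ε / (4 * (R + 1)) * ‖v - w y‖ ≤ ε / 2 := by
    calc ε / (4 * (R + 1)) * ‖v - w y‖ ≤ ε / (4 * (R + 1)) * (2 * R) := by gcongr
      _ = ε / 2 * (R / (R + 1)) := by field_simp; ring
      _ ≤ ε / 2 * 1 := by
          gcongr
          rw [div_le_one (by linarith)]; linarith
      _ = ε / 2 := mul_one _
  linarith [hl (v - w y)]

/-- On a subspace where ‖z‖ ≤ K‖J z‖, the error term can be absorbed, so the finite-rank map l is
injective. The bound n depends only on K; this uniformity gives finiteness of focal points and of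
eigenvalues. -/
lemma finiteDimensional_of_forall_norm_le {E : Type*} [NormedAddCommGroup E]
    [NormedSpace ℝ E] [FiniteDimensional ℝ E] {J : V →L[ℝ] L}
    (hJ : ∀ ε > 0, ∃ (N : ℕ) (l : V →L[ℝ] (Fin N → E)), ∀ v, ‖J v‖ ≤ ‖l v‖ + ε * ‖v‖)
    (K : ℝ) : ∃ n : ℕ, ∀ Z : Submodule ℝ V, (∀ z ∈ Z, ‖z‖ ≤ K * ‖J z‖) →
      FiniteDimensional ℝ Z ∧ Module.finrank ℝ Z ≤ n := by
  obtain ⟨N, l, hl⟩ := hJ (1 / (2 * (|K| + 1))) (by positivity)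
  refine ⟨Module.finrank ℝ (Fin N → E), fun Z hZ => ?_⟩
  have hinj : Function.Injective (l.toLinearMap.comp Z.subtype) := by
    rw [← LinearMap.ker_eq_bot, LinearMap.ker_eq_bot']
    rintro ⟨z, hz⟩ h0
    have h0' : l z = 0 := h0
    have h1 := hZ z hz
    have h2 := hl z
    rw [h0', norm_zero, zero_add] at h2
    have h3 : ‖z‖ ≤ (|K| + 1) * ‖J z‖ :=
      h1.trans (mul_le_mul_of_nonneg_right (by linarith [le_abs_self K]) (norm_nonneg _))
    have h4 : (|K| + 1) * ‖J z‖ ≤ ‖z‖ / 2 := by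
      calc (|K| + 1) * ‖J z‖ ≤ (|K| + 1) * (1 / (2 * (|K| + 1)) * ‖z‖) := by gcongr
        _ = ‖z‖ / 2 := by field_simp
    have h5 : ‖z‖ = 0 := le_antisymm (by linarith) (norm_nonneg z)
    exact Subtype.ext (norm_eq_zero.1 h5)
  exact ⟨FiniteDimensional.of_injective _ hinj, LinearMap.finrank_le_finrank_of_injective hinj⟩

end Compactness

namespace Hamiltonian

open Triple

variable {E : Type*} [NormedAddCommGroup E] [InnerProductSpace ℝ E]

lemma integral_cell_le [CompleteSpace E] {f h : ℝ → E} {a b : ℝ} (hab : a ≤ b)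
    (hh : MemLp h 2 (volume.restrict (Ioc a b))) (hfc : ContinuousOn f (Icc a b))
    (hf : ∀ x ∈ Icc a b, f x = f a + ∫ t in a..x, h t) :
    ∫ x in a..b, ‖f x‖ ^ 2 ≤ 2 * (b - a) * ‖f a‖ ^ 2 + 2 * (b - a) ^ 2 * ∫ x in a..b, ‖h x‖ ^ 2 := by
  have hi2 : IntervalIntegrable (fun x => ‖h x‖ ^ 2) volume a b := by
    rw [intervalIntegrable_iff_integrableOn_Ioc_of_le hab]
    exact hh.integrable_norm_pow (by norm_num)
  have key : ∀ x ∈ Icc a b, ‖f x‖ ^ 2 ≤ 2 * ‖f a‖ ^ 2 + 2 * (b - a) * ∫ x in a..b, ‖h x‖ ^ 2 := by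
    intro x hx
    have h1 := sq_norm_integral_le hx.1
      (hh.mono_measure (Measure.restrict_mono (Ioc_subset_Ioc_right hx.2) le_rfl))
    have h2 : ∫ t in a..x, ‖h t‖ ^ 2 ≤ ∫ t in a..b, ‖h t‖ ^ 2 :=
      intervalIntegral.integral_mono_interval le_rfl hx.1 hx.2
        (Filter.Eventually.of_forall fun x => sq_nonneg _) hi2
    have h3 : (x - a) * ∫ t in a..x, ‖h t‖ ^ 2 ≤ (b - a) * ∫ t in a..b, ‖h t‖ ^ 2 := by
      apply mul_le_mul (by linarith [hx.2]) h2 _ (by linarith)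
      exact intervalIntegral.integral_nonneg hx.1 fun _ _ => sq_nonneg _
    have h4 : ‖f x‖ ≤ ‖f a‖ + ‖∫ t in a..x, h t‖ := by rw [hf x hx]; exact norm_add_le _ _
    have h5 : ‖f x‖ ^ 2 ≤ (‖f a‖ + ‖∫ t in a..x, h t‖) ^ 2 := by gcongr
    nlinarith [sq_nonneg (‖f a‖ - ‖∫ t in a..x, h t‖)]
  have hfi : IntervalIntegrable (fun x => ‖f x‖ ^ 2) volume a b :=
    (ContinuousOn.intervalIntegrable (by rw [uIcc_of_le hab]; exact (hfc.norm.pow 2)))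
  calc ∫ x in a..b, ‖f x‖ ^ 2
      ≤ ∫ _ in a..b, (2 * ‖f a‖ ^ 2 + 2 * (b - a) * ∫ x in a..b, ‖h x‖ ^ 2) :=
        intervalIntegral.integral_mono_on hab hfi intervalIntegrable_const key
    _ = _ := by rw [intervalIntegral.integral_const, smul_eq_mul]; ring

/-- A quantitative Rellich lemma: functions in the form domain are small in `L²` if they are small
on a finite grid. -/
lemma norm_emb_sq_le [FiniteDimensional ℝ E] (H : Hamiltonian E) {z : Triple E}
    (hz : z ∈ H.formSpace) {n : ℕ} (hn : 0 < n) :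
    ‖emb E z‖ ^ 2 ≤ 2 * ∑ k ∈ Finset.range (n * n), ‖ev E (k / n : ℝ) z‖ ^ 2 + 3 / n * ‖z‖ ^ 2 := by
  have : CompleteSpace E := FiniteDimensional.complete ℝ E
  have hn0 : (0 : ℝ) < n := Nat.cast_pos.2 hn
  have hn1 : (1 : ℝ) ≤ n := Nat.one_le_cast.2 hn
  set f := rep E z with hf
  have hfc := continuousOn_rep z
  have hi2 := integrable_norm_sq_halfL2 (h E z)
  have hcont : ∀ a b : ℝ, 0 ≤ a → a ≤ b → IntervalIntegrable (fun x => ‖f x‖ ^ 2) volume a b :=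
    fun a b ha hab => ContinuousOn.intervalIntegrable (by
      rw [uIcc_of_le hab]
      exact ((hfc.mono fun x hx => ha.trans hx.1).norm.pow 2))
  -- The interval [0, n] is split into n² cells of length 1/n; on each cell f is controlled by its
  -- value at the left end and the energy of its derivative.
  have hcell : ∀ k : ℕ, ∫ x in (k / n : ℝ)..((k + 1 : ℕ) / n : ℝ), ‖f x‖ ^ 2 ≤
      2 * ‖ev E (k / n : ℝ) z‖ ^ 2 +
        2 / n ^ 2 * ∫ x in (k / n : ℝ)..((k + 1 : ℕ) / n : ℝ), ‖h E z x‖ ^ 2 := by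
    intro k
    have h0 : (0 : ℝ) ≤ k / n := by positivity
    have hab : (k / n : ℝ) ≤ (k + 1 : ℕ) / n := by gcongr; simp
    have hd : ((k + 1 : ℕ) / n : ℝ) - k / n = 1 / n := by push_cast; field_simp; ring
    have h1 := integral_cell_le (f := f) (h := h E z) hab
      ((Lp.memLp (h E z)).mono_measure (Measure.restrict_mono (fun x hx => h0.trans_lt hx.1) le_rfl))
      (hfc.mono fun x hx => h0.trans hx.1) (fun x hx => by
        rw [hf, rep_apply (h0.trans hx.1), rep_apply h0, add_assoc,
          intervalIntegral.integral_add_adjacent_intervals]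
        · exact locInt_h z _ h0
        · exact (locInt_h z _ h0).symm.trans (locInt_h z _ (h0.trans hx.1)))
    rw [hd] at h1
    have h2 : f (k / n) = ev E (k / n : ℝ) z := by rw [hf, rep_apply h0, ev_apply h0]
    rw [h2] at h1
    refine h1.trans ?_
    have h3 : 2 * (1 / n : ℝ) * ‖ev E (k / n : ℝ) z‖ ^ 2 ≤ 2 * ‖ev E (k / n : ℝ) z‖ ^ 2 := by
      have : (1 / n : ℝ) ≤ 1 := by rw [div_le_one hn0]; exact hn1
      nlinarith [sq_nonneg ‖ev E (k / n : ℝ) z‖]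
    have h4 : 2 * (1 / n : ℝ) ^ 2 = 2 / n ^ 2 := by ring
    rw [h4]; linarith
  have hsum : ∫ x in (0 : ℝ)..n, ‖f x‖ ^ 2 ≤
      2 * ∑ k ∈ Finset.range (n * n), ‖ev E (k / n : ℝ) z‖ ^ 2 + 2 / n ^ 2 * ‖h E z‖ ^ 2 := by
    have hend : ((n * n : ℕ) / n : ℝ) = n := by push_cast; field_simp
    have h1 := intervalIntegral.sum_integral_adjacent_intervals (n := n * n)
      (a := fun k : ℕ => (k / n : ℝ)) (f := fun x => ‖f x‖ ^ 2) (μ := volume)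
      (fun k _ => hcont _ _ (by positivity) (by gcongr; simp))
    have h2 := intervalIntegral.sum_integral_adjacent_intervals (n := n * n)
      (a := fun k : ℕ => (k / n : ℝ)) (f := fun x => ‖h E z x‖ ^ 2) (μ := volume)
      (fun k _ => by
        have hab : (k / n : ℝ) ≤ (k + 1 : ℕ) / n := by gcongr; simp
        have h0 : (0 : ℝ) ≤ k / n := by positivity
        rw [intervalIntegrable_iff_integrableOn_Ioc_of_le hab]
        exact hi2.mono_measure (Measure.restrict_mono (fun x hx => h0.trans_lt hx.1) le_rfl))
    simp only [hend, Nat.cast_zero, zero_div] at h1 h2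
    rw [← h1]
    have h3 : ∫ x in (0 : ℝ)..n, ‖h E z x‖ ^ 2 ≤ ‖h E z‖ ^ 2 := by
      rw [norm_sq_halfL2, intervalIntegral.integral_of_le hn0.le]
      exact setIntegral_mono_set hi2 (Filter.Eventually.of_forall fun x => sq_nonneg _)
        (Filter.Eventually.of_forall Ioc_subset_Ioi_self)
    calc _ ≤ ∑ k ∈ Finset.range (n * n), (2 * ‖ev E (k / n : ℝ) z‖ ^ 2 +
        2 / n ^ 2 * ∫ x in (k / n : ℝ)..((k + 1 : ℕ) / n : ℝ), ‖h E z x‖ ^ 2) :=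
          Finset.sum_le_sum fun k _ => hcell k
      _ ≤ _ := by
          rw [Finset.sum_add_distrib, ← Finset.mul_sum, ← Finset.mul_sum, h2]
          gcongr
  have hint : Integrable (fun x => ‖f x‖ ^ 2) halfLine :=
    (integrable_norm_sq_halfL2 (emb E z)).congr (by filter_upwards [hz.2] with x hx; rw [hx])
  have hsplit : ‖emb E z‖ ^ 2 = (∫ x in (0 : ℝ)..n, ‖f x‖ ^ 2) + ∫ x in Ioi (n : ℝ), ‖f x‖ ^ 2 := by
    rw [intervalIntegral.integral_interval_add_Ioi hint
      (hint.mono_measure (Measure.restrict_mono (fun x (hx : (n : ℝ) < x) => hn0.trans hx) le_rfl)),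
      norm_emb_sq]
    exact integral_congr_ae (by filter_upwards [hz.2] with x hx; rw [hx])
  -- Beyond n the weight 1 + x exceeds n, which is the source of compactness on the unbounded
  -- half-line.
  have htail : ∫ x in Ioi (n : ℝ), ‖f x‖ ^ 2 ≤ 1 / n * ‖u E z‖ ^ 2 := by
    rw [norm_u_sq, ← integral_const_mul]
    have hw : Integrable (fun x => 1 / (n : ℝ) * ((1 + x) * ‖emb E z x‖ ^ 2)) halfLine :=
      (integrable_weighted z).const_mul _
    calc ∫ x in Ioi (n : ℝ), ‖f x‖ ^ 2
        ≤ ∫ x in Ioi (n : ℝ), 1 / (n : ℝ) * ((1 + x) * ‖emb E z x‖ ^ 2) := by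
          have hsub : Ioi (n : ℝ) ⊆ Ioi 0 := fun x (hx : (n : ℝ) < x) => hn0.trans hx
          refine setIntegral_mono_ae_restrict (hint.mono_measure (Measure.restrict_mono hsub le_rfl))
            (hw.mono_measure (Measure.restrict_mono hsub le_rfl)) ?_
          filter_upwards [ae_restrict_of_ae_restrict_of_subset hsub hz.2,
            ae_restrict_mem measurableSet_Ioi] with x h1 h2
          rw [h1, ← mul_assoc]
          have h2' : (n : ℝ) < x := h2
          have : 1 ≤ 1 / (n : ℝ) * (1 + x) := by
            rw [one_div, ← div_eq_inv_mul, one_le_div hn0]; linarith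
          exact le_mul_of_one_le_left (sq_nonneg _) this
      _ ≤ _ := setIntegral_mono_set hw (ae_halfLine fun x hx => by positivity)
          (Filter.Eventually.of_forall fun x (hx : (n : ℝ) < x) => hn0.trans hx)
  have hns := norm_sq z
  have hc2 : 2 / (n : ℝ) ^ 2 ≤ 3 / n := by
    rw [div_le_div_iff₀ (by positivity) hn0]; nlinarith
  have hc1 : 1 / (n : ℝ) ≤ 3 / n := by gcongr; norm_num
  have e1 : 2 / (n : ℝ) ^ 2 * ‖h E z‖ ^ 2 ≤ 3 / n * ‖h E z‖ ^ 2 := by gcongr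
  have e2 : 1 / (n : ℝ) * ‖u E z‖ ^ 2 ≤ 3 / n * ‖u E z‖ ^ 2 := by gcongr
  have e3 : 0 ≤ 3 / (n : ℝ) * ‖y E z‖ ^ 2 := by positivity
  rw [hsplit, hns]
  linarith

lemma exists_norm_emb_le [FiniteDimensional ℝ E] (H : Hamiltonian E) {ε : ℝ} (hε : 0 < ε) :
    ∃ (N : ℕ) (l : H.formSpace →L[ℝ] (Fin N → E)),
      ∀ z : H.formSpace, ‖emb E z‖ ≤ ‖l z‖ + ε * ‖z‖ := by
  obtain ⟨n, hn⟩ := exists_nat_gt (3 / ε ^ 2)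
  have hn0 : 0 < (n : ℝ) := lt_trans (by positivity) hn
  have hn' : 3 / (n : ℝ) ≤ ε ^ 2 := by
    rw [div_lt_iff₀ (by positivity)] at hn
    rw [div_le_iff₀ hn0]; linarith
  set c : ℝ := √(2 * (n * n : ℕ)) with hc
  refine ⟨n * n, c • (ContinuousLinearMap.pi fun k : Fin (n * n) =>
    (ev E (k / n : ℝ)).comp H.formSpace.subtypeL), fun z => ?_⟩
  have h1 := H.norm_emb_sq_le z.2 (Nat.cast_pos.1 hn0)
  set l := ContinuousLinearMap.pi fun k : Fin (n * n) =>
    (ev E (k / n : ℝ)).comp H.formSpace.subtypeL with hl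
  have h2 : ∑ k ∈ Finset.range (n * n), ‖ev E (k / n : ℝ) z.1‖ ^ 2 ≤ (n * n : ℕ) * ‖l z‖ ^ 2 := by
    calc _ ≤ ∑ k ∈ Finset.range (n * n), ‖l z‖ ^ 2 := by
          refine Finset.sum_le_sum fun k hk => ?_
          gcongr
          exact norm_le_pi_norm (l z) ⟨k, Finset.mem_range.1 hk⟩
      _ = _ := by rw [Finset.sum_const, Finset.card_range, nsmul_eq_mul]
  have h3 : 3 / (n : ℝ) * ‖z.1‖ ^ 2 ≤ ε ^ 2 * ‖z‖ ^ 2 := by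
    rw [Submodule.coe_norm]; gcongr
  have h4 : ‖(c • l) z‖ = c * ‖l z‖ := by
    rw [_root_.smul_apply, norm_smul, Real.norm_eq_abs, abs_of_nonneg (Real.sqrt_nonneg _)]
  have hcs : c ^ 2 = 2 * (n * n : ℕ) := Real.sq_sqrt (by positivity)
  rw [h4]
  refine (sq_le_sq₀ (norm_nonneg _) (by positivity)).1 ?_
  have h5 : 0 ≤ c * ‖l z‖ * (ε * ‖z‖) := by positivity
  nlinarith

/-! ### The quadratic form -/

/-- Bounds for a Hamiltonian system which make its form coercive. -/
structure IsCoercive (H : Hamiltonian E) (c C : ℝ) : Prop where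
  pos : 0 < c
  nonneg : 0 ≤ C
  lower : ∀ x, 0 ≤ x → ∀ v,
    c * ((1 + x) * ‖v‖ ^ 2) - C * ‖v‖ ^ 2 ≤ inner ℝ (H.p x v) v - 2 * ‖H.A x v‖ ^ 2
  bound_A : ∀ x, 0 ≤ x → ‖H.A x‖ ^ 2 ≤ C * (1 + x)
  bound_p : ∀ x, 0 ≤ x → ‖H.p x‖ ≤ C * (1 + x)
  le_β : ∀ v, ‖v‖ ^ 2 ≤ inner ℝ (H.β v) v

namespace IsCoercive

variable {H : Hamiltonian E} {c C : ℝ}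

lemma memLp_A (hH : H.IsCoercive c C) : MemLp (fun x => wt x • H.A x) ∞ halfLine := by
  refine memLp_top_of_bound ?_ √C (ae_halfLine fun x hx => ?_)
  · exact (measurable_wt.aestronglyMeasurable).smul H.continuous_A.aestronglyMeasurable
  · rw [norm_smul, Real.norm_eq_abs, abs_of_nonneg (wt_nonneg x)]
    refine Real.le_sqrt_of_sq_le ?_
    rw [mul_pow]
    calc wt x ^ 2 * ‖H.A x‖ ^ 2 ≤ wt x ^ 2 * (C * (1 + x)) := by
          gcongr; exact hH.bound_A x hx.le
      _ = C := by linear_combination C * wt_sq hx.le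

lemma memLp_p (hH : H.IsCoercive c C) : MemLp (fun x => (wt x ^ 2) • H.p x) ∞ halfLine := by
  refine memLp_top_of_bound ?_ C (ae_halfLine fun x hx => ?_)
  · exact ((measurable_wt.pow_const 2).aestronglyMeasurable).smul
      H.continuous_p.aestronglyMeasurable
  · rw [norm_smul, Real.norm_eq_abs, abs_of_nonneg (sq_nonneg _)]
    calc wt x ^ 2 * ‖H.p x‖ ≤ wt x ^ 2 * (C * (1 + x)) := by
          gcongr; exact hH.bound_p x hx.le
      _ = C := by linear_combination C * wt_sq hx.le

/-- Multiplication of the function by `A`. -/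
def mulA (hH : H.IsCoercive c C) : Triple E →L[ℝ] HalfL2 E := (mulOp hH.memLp_A).comp (u E)

/-- Multiplication of the function by `(1 + x) ^ (-1/2) p`. -/
def mulP (hH : H.IsCoercive c C) : Triple E →L[ℝ] HalfL2 E := (mulOp hH.memLp_p).comp (u E)

lemma mulA_ae (hH : H.IsCoercive c C) (z : Triple E) :
    hH.mulA z =ᵐ[halfLine] fun x => H.A x (emb E z x) := by
  filter_upwards [mulOp_ae hH.memLp_A (u E z), emb_ae z] with x h1 h2
  rw [h2, map_smul]
  exact h1

lemma mulP_ae (hH : H.IsCoercive c C) (z : Triple E) :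
    hH.mulP z =ᵐ[halfLine] fun x => wt x • H.p x (emb E z x) := by
  filter_upwards [mulOp_ae hH.memLp_p (u E z), emb_ae z] with x h1 h2
  rw [h2, map_smul, smul_smul, ← sq]
  exact h1

lemma inner_mulP_ae (hH : H.IsCoercive c C) (z w : Triple E) :
    (fun x => inner ℝ (hH.mulP z x) (u E w x)) =ᵐ[halfLine]
      fun x => inner ℝ (H.p x (emb E z x)) (emb E w x) := by
  filter_upwards [hH.mulP_ae z, emb_ae w] with x h1 h2
  rw [h1, h2, real_inner_smul_left, real_inner_smul_right]

/-- The form of the system. -/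
def form (hH : H.IsCoercive c C) : LinearMap.BilinForm ℝ (Triple E) :=
  (innerₗ E).compl₁₂ (H.β.comp (y E)).toLinearMap (y E).toLinearMap
  + (innerₗ (HalfL2 E)).compl₁₂ (h E).toLinearMap (h E).toLinearMap
  - (innerₗ (HalfL2 E)).compl₁₂ (h E).toLinearMap hH.mulA.toLinearMap
  - (innerₗ (HalfL2 E)).compl₁₂ hH.mulA.toLinearMap (h E).toLinearMap
  + (innerₗ (HalfL2 E)).compl₁₂ hH.mulP.toLinearMap (u E).toLinearMap

lemma form_apply (hH : H.IsCoercive c C) (z w : Triple E) :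
    hH.form z w = inner ℝ (H.β (y E z)) (y E w) + inner ℝ (h E z) (h E w)
      - inner ℝ (h E z) (hH.mulA w) - inner ℝ (hH.mulA z) (h E w)
      + inner ℝ (hH.mulP z) (u E w) := rfl

lemma inner_mulP (hH : H.IsCoercive c C) (z w : Triple E) :
    inner ℝ (hH.mulP z) (u E w) = ∫ x in Ioi (0 : ℝ), inner ℝ (H.p x (emb E z x)) (emb E w x) := by
  rw [L2.inner_def]
  exact integral_congr_ae (hH.inner_mulP_ae z w)

lemma form_symm (hH : H.IsCoercive c C) (z w : Triple E) : hH.form z w = hH.form w z := by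
  rw [form_apply, form_apply, H.symm_β, real_inner_comm (H.β (y E w)), real_inner_comm (h E w),
    real_inner_comm (hH.mulA w), real_inner_comm (h E w) (hH.mulA z), inner_mulP, inner_mulP]
  have : ∀ x, inner ℝ (H.p x (emb E z x)) (emb E w x) = inner ℝ (H.p x (emb E w x)) (emb E z x) :=
    fun x => by rw [H.symm_p, real_inner_comm]
  simp_rw [this]
  ring

lemma continuous_form_self (hH : H.IsCoercive c C) : Continuous fun z => hH.form z z := by
  simp only [form_apply]
  fun_prop

/-- The integrand of the form. -/
def integrand (H : Hamiltonian E) (z w : Triple E) (x : ℝ) : ℝ :=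
  inner ℝ (h E z x) (h E w x) - inner ℝ (h E z x) (H.A x (emb E w x))
    - inner ℝ (H.A x (emb E z x)) (h E w x) + inner ℝ (H.p x (emb E z x)) (emb E w x)

lemma integrand_ae (hH : H.IsCoercive c C) (z w : Triple E) :
    (fun x => inner ℝ (h E z x) (h E w x) - inner ℝ (h E z x) (hH.mulA w x)
      - inner ℝ (hH.mulA z x) (h E w x) + inner ℝ (hH.mulP z x) (u E w x)) =ᵐ[halfLine]
      integrand H z w := by
  filter_upwards [hH.mulA_ae z, hH.mulA_ae w, hH.inner_mulP_ae z w] with x h1 h2 h3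
  rw [h1, h2, h3]; rfl

lemma integrable_integrand (hH : H.IsCoercive c C) (z w : Triple E) :
    Integrable (integrand H z w) halfLine :=
  ((((L2.integrable_inner (𝕜 := ℝ) (h E z) (h E w)).sub
    (L2.integrable_inner (𝕜 := ℝ) (h E z) (hH.mulA w))).sub
    (L2.integrable_inner (𝕜 := ℝ) (hH.mulA z) (h E w))).add
    (L2.integrable_inner (𝕜 := ℝ) (hH.mulP z) (u E w))).congr (hH.integrand_ae z w)

lemma form_eq_integral (hH : H.IsCoercive c C) (z w : Triple E) :
    hH.form z w = inner ℝ (H.β (y E z)) (y E w) + ∫ x in Ioi (0 : ℝ), integrand H z w x := by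
  rw [← integral_congr_ae (hH.integrand_ae z w), form_apply]
  have i1 := L2.integrable_inner (𝕜 := ℝ) (h E z) (h E w)
  have i2 := L2.integrable_inner (𝕜 := ℝ) (h E z) (hH.mulA w)
  have i3 := L2.integrable_inner (𝕜 := ℝ) (hH.mulA z) (h E w)
  have i4 := L2.integrable_inner (𝕜 := ℝ) (hH.mulP z) (u E w)
  have i12 : Integrable (fun x => inner ℝ (h E z x) (h E w x) - inner ℝ (h E z x) (hH.mulA w x))
      halfLine := i1.sub i2
  have i123 : Integrable (fun x => inner ℝ (h E z x) (h E w x) - inner ℝ (h E z x) (hH.mulA w x)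
      - inner ℝ (hH.mulA z x) (h E w x)) halfLine := i12.sub i3
  rw [integral_add i123 i4, integral_sub i12 i3, integral_sub i1 i2]
  simp only [L2.inner_def]
  ring

/-- Expanding |f' - A f|² produces |A f|², which cancels the term -⟨A² f, f⟩ of the density. -/
lemma dens_ae {z : Triple E} (hz : z ∈ H.formSpace) (lam : ℝ) :
    (fun x => integrand H z z x - lam * ‖emb E z x‖ ^ 2) =ᵐ[halfLine]
      fun x => H.dens lam x (rep E z x) (h E z x) := by
  filter_upwards [hz.2] with x hx
  rw [← hx, integrand, dens, norm_sub_sq_real, inner_sub_left, inner_sub_left,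
    H.symm_A x (H.A x _), real_inner_self_eq_norm_sq, real_inner_self_eq_norm_sq,
    real_inner_smul_left, real_inner_self_eq_norm_sq, real_inner_comm (h E z x)]
  ring

lemma form_sub_eq_integral_dens (hH : H.IsCoercive c C) {z : Triple E} (hz : z ∈ H.formSpace)
    (lam : ℝ) : hH.form z z - lam * ‖emb E z‖ ^ 2 = inner ℝ (H.β (rep E z 0)) (rep E z 0) +
      ∫ x in Ioi (0 : ℝ), H.dens lam x (rep E z x) (h E z x) := by
  rw [← integral_congr_ae (dens_ae hz lam), integral_sub (hH.integrable_integrand z z)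
    ((integrable_norm_sq_halfL2 (emb E z)).const_mul lam), integral_const_mul, ← norm_emb_sq,
    form_eq_integral, rep_zero]
  ring

/-- The cross term satisfies 2⟨f', A f⟩ ≤ |f'|²/2 + 2|A f|², which is why the lower bound in
`IsCoercive` subtracts twice |A v|². The value at 0 is controlled by the boundary term alone. -/
lemma coercive (hH : H.IsCoercive c C) (z : Triple E) :
    min (1 / 2) c * ‖z‖ ^ 2 ≤ hH.form z z + C * ‖emb E z‖ ^ 2 := by
  have h1 : ∫ x in Ioi (0 : ℝ), (1 / 2 * ‖h E z x‖ ^ 2 + c * ((1 + x) * ‖emb E z x‖ ^ 2)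
      - C * ‖emb E z x‖ ^ 2) ≤ ∫ x in Ioi (0 : ℝ), integrand H z z x := by
    refine setIntegral_mono_on (((integrable_norm_sq_halfL2 _).const_mul _).add
      ((integrable_weighted z).const_mul _) |>.sub ((integrable_norm_sq_halfL2 _).const_mul _))
      (hH.integrable_integrand z z) measurableSet_Ioi fun x hx => ?_
    have h2 := hH.lower x (le_of_lt hx) (emb E z x)
    have h3 := sq_nonneg ‖h E z x - (2 : ℝ) • H.A x (emb E z x)‖
    have h4 : 0 ≤ ‖h E z x - (2 : ℝ) • H.A x (emb E z x)‖ ^ 2 := h3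
    rw [norm_sub_sq_real, real_inner_smul_right, norm_smul, mul_pow] at h4
    norm_num at h4
    rw [integrand, real_inner_self_eq_norm_sq, real_inner_comm (h E z x)]
    nlinarith
  have i12 : Integrable (fun x => 1 / 2 * ‖h E z x‖ ^ 2 + c * ((1 + x) * ‖emb E z x‖ ^ 2))
      halfLine := ((integrable_norm_sq_halfL2 _).const_mul _).add
      ((integrable_weighted z).const_mul _)
  rw [integral_sub i12 ((integrable_norm_sq_halfL2 _).const_mul _),
    integral_add ((integrable_norm_sq_halfL2 _).const_mul _) ((integrable_weighted z).const_mul _),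
    integral_const_mul, integral_const_mul, integral_const_mul, ← norm_u_sq, ← norm_emb_sq,
    ← norm_sq_halfL2] at h1
  rw [form_eq_integral, norm_sq]
  have h5 := hH.le_β (y E z)
  have e1 : min (1 / 2) c * ‖h E z‖ ^ 2 ≤ 1 / 2 * ‖h E z‖ ^ 2 := by gcongr; exact min_le_left _ _
  have e2 : min (1 / 2) c * ‖u E z‖ ^ 2 ≤ c * ‖u E z‖ ^ 2 := by gcongr; exact min_le_right _ _
  have e3 : min (1 / 2) c * ‖y E z‖ ^ 2 ≤ 1 * ‖y E z‖ ^ 2 := by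
    gcongr; exact (min_le_left _ _).trans (by norm_num)
  linarith

end IsCoercive

end Hamiltonian

end StochasticAiry

/-! ### Eigenvectors of the form versus square-integrable solutions of the system -/

namespace StochasticAiry

namespace Hamiltonian

open Triple

variable {E : Type*} [NormedAddCommGroup E] [InnerProductSpace ℝ E]

lemma exists_smul_mem_formSpace [FiniteDimensional ℝ E] (H : Hamiltonian E) {η : ℝ → ℝ} {e : E}
    (hη : ContDiff ℝ ((⊤ : ℕ∞) : WithTop ℕ∞) η) (hc : HasCompactSupport η) (he : η 0 • e ∈ H.D) :
    ∃ z ∈ H.formSpace, h E z =ᵐ[halfLine] (fun x => deriv η x • e) ∧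
      emb E z =ᵐ[halfLine] (fun x => η x • e) ∧ ∀ x, 0 ≤ x → rep E z x = η x • e := by
  have : CompleteSpace E := FiniteDimensional.complete ℝ E
  have hd : Continuous (deriv η) := hη.continuous_deriv (by simp)
  refine H.exists_mem_formSpace (f := fun x => η x • e) he ?_ ?_ ?_
  · exact Continuous.memLp_of_hasCompactSupport (by fun_prop) (hc.deriv.smul_right)
  · refine Continuous.memLp_of_hasCompactSupport ?_ (hc.smul_right.smul_left)
    have := hη.continuous
    fun_prop
  · intro x hx
    refine primitive_of_hasDerivWithinAt (f := fun x => η x • e)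
      (k := fun x => deriv η x • e) (LocInt.of_continuousOn (by fun_prop)) (fun x _ => ?_) hx
    exact ((hη.differentiable (by simp) x).hasDerivAt.smul_const e).hasDerivWithinAt

namespace IsCoercive

variable {H : Hamiltonian E} {c C : ℝ} {μ : ℝ}

/-- The products η • e with η(0) e ∈ D belong to the form domain, so the form equation implies the
weak one and the regularity lemma applies. -/
lemma exists_sol_of_form_eq [FiniteDimensional ℝ E] (hH : H.IsCoercive c C) {z : Triple E}
    (hz : z ∈ H.formSpace)
    (hw : ∀ φ ∈ H.formSpace, hH.form z φ = μ * inner ℝ (emb E z) (emb E φ)) :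
    ∃ g, H.Sol μ (rep E z) g ∧ H.BC (rep E z) g := by
  have : CompleteSpace E := FiniteDimensional.complete ℝ E
  refine H.exists_sol_of_weak hz.1 (locInt_h z) (fun x hx => rep_apply hx z) ?_
  intro η e hη hc he
  have he' : η 0 • e ∈ H.D := by
    rcases he with he | ⟨ε, hε, h0⟩
    · exact H.D.smul_mem _ he
    · rw [h0 0 hε, zero_smul]; exact H.D.zero_mem
  obtain ⟨φ, hφ, hφh, hφJ, hφr⟩ := H.exists_smul_mem_formSpace hη hc he'
  have h1 := hw φ hφ
  rw [form_eq_integral, L2.inner_def, ← integral_const_mul, ← sub_eq_zero, add_sub_assoc,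
    ← integral_sub (hH.integrable_integrand z φ)
      ((L2.integrable_inner (𝕜 := ℝ) (emb E z) (emb E φ)).const_mul μ)] at h1
  refine Eq.trans ?_ h1
  rw [add_comm]
  congr 1
  · rw [← rep_zero φ, hφr 0 le_rfl, real_inner_smul_right, real_inner_comm]
  · apply integral_congr_ae
    filter_upwards [hφh, hφJ, hz.2] with x e1 e2 e3
    have s1 : inner ℝ (H.A x e) (h E z x) = inner ℝ e (H.A x (h E z x)) := H.symm_A x _ _
    rw [integrand, e1, e2, ← e3, map_smul]
    simp only [real_inner_smul_right, inner_sub_right]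
    rw [real_inner_comm (h E z x) e, real_inner_comm (emb E z x) e,
      real_inner_comm (H.p x (emb E z x)) e, real_inner_comm (H.A x (emb E z x)) e, ← s1,
      real_inner_comm (h E z x) (H.A x e)]
    ring

/-- Green's formula on [0, T]: with f' - A f = g, the integrand is the derivative of ⟨φ, g⟩. The
triple z needs to agree with the solution only up to T, which also covers truncated solutions. -/
lemma integral_integrand_sub [FiniteDimensional ℝ E] {f g : ℝ → E}
    (hs : H.Sol μ f g) {z φ : Triple E} (hφ : φ ∈ H.formSpace) {T : ℝ} (hT : 0 ≤ T)
    (hz : ∀ᵐ x ∂halfLine, x ≤ T → h E z x = H.A x (f x) + g x ∧ emb E z x = f x) :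
    ∫ x in (0 : ℝ)..T, (integrand H z φ x - μ * inner ℝ (emb E z x) (emb E φ x)) =
      inner ℝ (rep E φ T) (g T) - inner ℝ (rep E φ 0) (g 0) := by
  have : CompleteSpace E := FiniteDimensional.complete ℝ E
  have hk := LocInt.of_continuousOn hs.continuousOn_deriv_snd
  rw [← integral_inner_add_of_primitive hT (locInt_h φ T hT) (hk T hT)
    (fun x hx => rep_eq φ hx.1)
    (fun x hx => primitive_of_hasDerivWithinAt hk (fun x hx => (hs x hx).2) hx.1)]
  rw [intervalIntegral.integral_of_le hT, intervalIntegral.integral_of_le hT]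
  apply integral_congr_ae
  filter_upwards [ae_restrict_of_ae_restrict_of_subset Ioc_subset_Ioi_self hz,
    ae_restrict_of_ae_restrict_of_subset Ioc_subset_Ioi_self hφ.2,
    ae_restrict_mem measurableSet_Ioc] with x h1 h2 h3
  obtain ⟨e1, e2⟩ := h1 h3.2
  rw [integrand, e1, e2, ← h2]
  have s1 : inner ℝ (H.A x (emb E φ x)) (H.A x (f x)) =
      inner ℝ (emb E φ x) (H.A x (H.A x (f x))) := H.symm_A x _ _
  have s2 : inner ℝ (H.A x (emb E φ x)) (g x) = inner ℝ (emb E φ x) (H.A x (g x)) :=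
    H.symm_A x _ _
  simp only [inner_add_left, inner_sub_right, real_inner_smul_right]
  rw [real_inner_comm (g x) (h E φ x), real_inner_comm (f x) (emb E φ x), ← s1, ← s2,
    real_inner_comm (H.p x (f x)) (emb E φ x), real_inner_comm (H.A x (f x)) (H.A x (emb E φ x)),
    real_inner_comm (g x) (H.A x (emb E φ x))]
  ring

/-- For a solution cut off at T, the boundary condition cancels the endpoint term at 0 against β, so
only the jump of the quasi-derivative at T remains. -/
lemma form_sub_eq_of_eq_zero [FiniteDimensional ℝ E] (hH : H.IsCoercive c C) {f g : ℝ → E}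
    (hs : H.Sol μ f g) (hbc : H.BC f g) {z φ : Triple E} (hφ : φ ∈ H.formSpace) {T : ℝ}
    (hT : 0 ≤ T) (h0 : rep E z 0 = f 0)
    (hz : ∀ᵐ x ∂halfLine, x ≤ T → h E z x = H.A x (f x) + g x ∧ emb E z x = f x)
    (hz' : ∀ᵐ x ∂halfLine, T < x → h E z x = 0 ∧ emb E z x = 0) :
    hH.form z φ - μ * inner ℝ (emb E z) (emb E φ) = inner ℝ (rep E φ T) (g T) := by
  have h1 := integral_integrand_sub hs hφ hT hz
  have h2 : ∫ x in (0 : ℝ)..T, (integrand H z φ x - μ * inner ℝ (emb E z x) (emb E φ x)) =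
      ∫ x in Ioi (0 : ℝ), (integrand H z φ x - μ * inner ℝ (emb E z x) (emb E φ x)) := by
    rw [intervalIntegral.integral_of_le hT]
    refine (setIntegral_eq_of_subset_of_ae_sdiff_eq_zero measurableSet_Ioi.nullMeasurableSet
      Ioc_subset_Ioi_self ?_).symm
    rw [ae_restrict_iff' measurableSet_Ioi] at hz'
    filter_upwards [hz'] with x hx hm
    obtain ⟨e1, e2⟩ := hx hm.1 (by by_contra hc; exact hm.2 ⟨hm.1, not_lt.1 hc⟩)
    simp [integrand, e1, e2]
  rw [h1, integral_sub (hH.integrable_integrand z φ)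
      ((L2.integrable_inner (𝕜 := ℝ) (emb E z) (emb E φ)).const_mul μ), integral_const_mul,
      ← L2.inner_def] at h2
  have h3 := hbc.2 (rep E φ 0) (by rw [rep_zero]; exact hφ.1)
  rw [inner_sub_right, sub_eq_zero] at h3
  rw [form_eq_integral, ← rep_zero, ← rep_zero, h0, real_inner_comm, ← h3]
  linarith

lemma dens_lower (hH : H.IsCoercive c C) {x : ℝ} (hx : 0 ≤ x) (u w : E) :
    1 / 2 * ‖w‖ ^ 2 + c * ((1 + x) * ‖u‖ ^ 2) - (C + μ) * ‖u‖ ^ 2 ≤ H.dens μ x u w := by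
  have h2 := hH.lower x hx u
  have h4 := sq_nonneg ‖w - (2 : ℝ) • H.A x u‖
  rw [norm_sub_sq_real, real_inner_smul_right, norm_smul, mul_pow] at h4
  norm_num at h4
  rw [dens, norm_sub_sq_real, inner_sub_left, inner_sub_left, H.symm_A x (H.A x u),
    real_inner_smul_left, real_inner_self_eq_norm_sq, real_inner_self_eq_norm_sq]
  nlinarith

end IsCoercive

/-! ### Cutoffs at large scale and membership in the form domain -/

lemma deriv_plateau_eq_zero_of_le {x : ℝ} (hx : |x| ≤ 1) : deriv plateau x = 0 := by
  -- On the plateau the cutoff attains its maximal value 1, so the derivative vanishes even at the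
  -- edge.
  apply IsLocalMax.deriv_eq_zero
  filter_upwards with y
  rw [plateau_eq_one hx]
  exact plateau.le_one

/-- The cutoff function at scale `n`. -/
def cutoff (n : ℕ) (x : ℝ) : ℝ := plateau (x / n)

/-- The derivative of the cutoff function. -/
def dcutoff (n : ℕ) (x : ℝ) : ℝ := deriv plateau (x / n) / n

lemma hasDerivAt_cutoff (n : ℕ) (x : ℝ) : HasDerivAt (cutoff n) (dcutoff n x) x := by
  have := (hasDerivAt_plateau (x / n)).comp x ((hasDerivAt_id x).div_const (n : ℝ))
  rwa [mul_one_div] at this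

lemma continuous_cutoff (n : ℕ) : Continuous (cutoff n) :=
  continuous_iff_continuousAt.2 fun x => (hasDerivAt_cutoff n x).continuousAt

lemma continuous_dcutoff (n : ℕ) : Continuous (dcutoff n) := by
  have := contDiff_plateau.continuous_deriv le_rfl
  unfold dcutoff
  fun_prop

lemma cutoff_nonneg (n : ℕ) (x : ℝ) : 0 ≤ cutoff n x := plateau.nonneg

lemma cutoff_le_one (n : ℕ) (x : ℝ) : cutoff n x ≤ 1 := plateau.le_one

lemma cutoff_eq_one {n : ℕ} {x : ℝ} (hx : 0 ≤ x) (hxn : x ≤ n) : cutoff n x = 1 := by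
  apply plateau_eq_one
  rw [abs_of_nonneg (by positivity)]
  exact div_le_one_of_le₀ hxn (by positivity)

lemma dcutoff_eq_zero {n : ℕ} {x : ℝ} (hx : 0 ≤ x) (hxn : x ≤ n) : dcutoff n x = 0 := by
  rw [dcutoff, deriv_plateau_eq_zero_of_le, zero_div]
  rw [abs_of_nonneg (by positivity)]
  exact div_le_one_of_le₀ hxn (by positivity)

lemma cutoff_eq_zero {n : ℕ} (hn : 0 < n) {x : ℝ} (hxn : 2 * n ≤ x) : cutoff n x = 0 := by
  apply plateau_eq_zero
  have : (0 : ℝ) < n := Nat.cast_pos.2 hn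
  refine le_trans ?_ (le_abs_self _)
  rwa [le_div_iff₀ this]

lemma dcutoff_eq_zero_of_lt {n : ℕ} (hn : 0 < n) {x : ℝ} (hxn : 2 * n < x) : dcutoff n x = 0 := by
  rw [dcutoff, deriv_plateau_eq_zero, zero_div]
  have : (0 : ℝ) < n := Nat.cast_pos.2 hn
  refine lt_of_lt_of_le ?_ (le_abs_self _)
  rwa [lt_div_iff₀ this]

lemma exists_abs_dcutoff_le : ∃ M : ℝ, 0 ≤ M ∧ ∀ n : ℕ, 0 < n → ∀ x, |dcutoff n x| ≤ M := by
  obtain ⟨M, hM, h⟩ := exists_deriv_plateau_le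
  refine ⟨M, hM, fun n hn x => ?_⟩
  have : (1 : ℝ) ≤ n := Nat.one_le_cast.2 hn
  rw [dcutoff, abs_div, abs_of_nonneg (by linarith : (0 : ℝ) ≤ n)]
  exact div_le_of_le_mul₀ (by linarith) hM ((h _).trans (le_mul_of_one_le_right hM this))

namespace IsCoercive

variable {H : Hamiltonian E} {c C : ℝ} {μ : ℝ}

/-- The localization identity: for a solution, (χ²⟨f, g⟩)' is the energy density of χ f minus
χ'²|f|², so the energy of the cut-off solution involves no derivative of f. -/
lemma Sol.integral_dens_cutoff [FiniteDimensional ℝ E] {f g : ℝ → E} (hs : H.Sol μ f g)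
    (hbc : H.BC f g) {n : ℕ} (hn : 0 < n) :
    inner ℝ (H.β (f 0)) (f 0) + ∫ x in (0 : ℝ)..(2 * n), H.dens μ x (cutoff n x • f x)
      (dcutoff n x • f x + cutoff n x • (H.A x (f x) + g x)) =
      ∫ x in (0 : ℝ)..(2 * n), dcutoff n x ^ 2 * ‖f x‖ ^ 2 := by
  have : CompleteSpace E := FiniteDimensional.complete ℝ E
  have hn0 : (0 : ℝ) ≤ 2 * n := by positivity
  have cf := hs.continuousOn_fst
  have cd := hs.continuousOn_deriv_fst
  have c1 := (continuous_cutoff n).continuousOn (s := Ici 0)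
  have c2 := (continuous_dcutoff n).continuousOn (s := Ici 0)
  have hdens : ContinuousOn (fun x => H.dens μ x (cutoff n x • f x)
      (dcutoff n x • f x + cutoff n x • (H.A x (f x) + g x))) (Ici 0) :=
    H.continuousOn_dens μ (c1.smul cf) ((c2.smul cf).add (c1.smul cd))
  have hcs : ContinuousOn (fun x => dcutoff n x ^ 2 * ‖f x‖ ^ 2) (Ici 0) :=
    (c2.pow 2).mul (cf.norm.pow 2)
  have key : ∀ x, 0 ≤ x → HasDerivWithinAt
      (fun x => cutoff n x ^ 2 * inner ℝ (f x) (g x)) (H.dens μ x (cutoff n x • f x)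
      (dcutoff n x • f x + cutoff n x • (H.A x (f x) + g x)) - dcutoff n x ^ 2 * ‖f x‖ ^ 2)
      (Ici 0) x := by
    intro x hx
    have h1 := ((hasDerivAt_cutoff n x).hasDerivWithinAt (s := Ici 0)).pow 2
    have h2 := (hs x hx).1.inner ℝ (hs x hx).2
    refine (h1.mul h2).congr_deriv ?_
    have e1 : dcutoff n x • f x + cutoff n x • (H.A x (f x) + g x) - H.A x (cutoff n x • f x) =
        dcutoff n x • f x + cutoff n x • g x := by
      rw [map_smul, smul_add]; abel
    rw [dens, e1, norm_add_sq_real]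
    simp only [map_smul, norm_smul, mul_pow, Real.norm_eq_abs, sq_abs, inner_add_left,
      inner_sub_right, inner_sub_left, real_inner_smul_left, real_inner_smul_right, H.symm_A,
      real_inner_self_eq_norm_sq]
    rw [real_inner_comm (H.p x (f x)) (f x)]
    norm_num
    ring
  have h1 := integral_eq_sub_of_hasDerivWithinAt (k := fun x => H.dens μ x (cutoff n x • f x)
      (dcutoff n x • f x + cutoff n x • (H.A x (f x) + g x)) - dcutoff n x ^ 2 * ‖f x‖ ^ 2)
    (LocInt.of_continuousOn (hdens.sub hcs)) key le_rfl hn0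
  rw [intervalIntegral.integral_sub (LocInt.of_continuousOn hdens _ hn0)
    (LocInt.of_continuousOn hcs _ hn0), cutoff_eq_zero hn le_rfl,
    cutoff_eq_one le_rfl (Nat.cast_nonneg n)] at h1
  have h3 := hbc.2 (f 0) hbc.1
  rw [inner_sub_right, sub_eq_zero] at h3
  rw [real_inner_comm, ← h3]
  linarith

/-- A Caccioppoli estimate: the localization identity and coercivity bound the weighted energy on
[0, n] by a multiple of ‖f‖² independent of n. Hence an L² solution automatically has f' and √(1 +
x) f in L². -/
lemma exists_rep_eq_of_memLp [FiniteDimensional ℝ E] (hH : H.IsCoercive c C) {f g : ℝ → E}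
    (hs : H.Sol μ f g) (hbc : H.BC f g) (hf : MemLp f 2 halfLine) :
    ∃ z ∈ H.formSpace, h E z =ᵐ[halfLine] (fun x => H.A x (f x) + g x) ∧
      emb E z =ᵐ[halfLine] f ∧ ∀ x, 0 ≤ x → rep E z x = f x := by
  have : CompleteSpace E := FiniteDimensional.complete ℝ E
  obtain ⟨M, hM, hMn⟩ := exists_abs_dcutoff_le
  have cf := hs.continuousOn_fst
  have cd := hs.continuousOn_deriv_fst
  have hf2 : Integrable (fun x => ‖f x‖ ^ 2) halfLine := hf.integrable_norm_pow (by norm_num)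
  set e : ℝ → ℝ := fun x => 1 / 2 * ‖H.A x (f x) + g x‖ ^ 2 + c * ((1 + x) * ‖f x‖ ^ 2) with he
  have ce : ContinuousOn e (Ici 0) :=
    (continuousOn_const.mul (cd.norm.pow 2)).add (continuousOn_const.mul
      ((by fun_prop : ContinuousOn (fun x : ℝ => 1 + x) (Ici 0)).mul (cf.norm.pow 2)))
  have hpos := hH.pos
  have he0 : ∀ x, 0 ≤ x → 0 ≤ e x := fun x hx => by
    have : 0 ≤ 1 + x := by linarith
    positivity
  have hbound : ∀ n : ℕ, 0 < n →
      ∫ x in (0 : ℝ)..n, e x ≤ (M ^ 2 + |C + μ|) * ∫ x in Ioi (0 : ℝ), ‖f x‖ ^ 2 := by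
    intro n hn
    have hn0 : (0 : ℝ) ≤ n := Nat.cast_nonneg n
    have hn2 : (0 : ℝ) ≤ 2 * n := by positivity
    have c1 := (continuous_cutoff n).continuousOn (s := Ici 0)
    have c2 := (continuous_dcutoff n).continuousOn (s := Ici 0)
    set v : ℝ → E := fun x => cutoff n x • f x with hv
    set dv : ℝ → E := fun x => dcutoff n x • f x + cutoff n x • (H.A x (f x) + g x) with hdv
    have cv : ContinuousOn v (Ici 0) := c1.smul cf
    have cdv : ContinuousOn dv (Ici 0) := (c2.smul cf).add (c1.smul cd)
    set e' : ℝ → ℝ := fun x => 1 / 2 * ‖dv x‖ ^ 2 + c * ((1 + x) * ‖v x‖ ^ 2) with he'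
    have ce' : ContinuousOn e' (Ici 0) :=
      (continuousOn_const.mul (cdv.norm.pow 2)).add (continuousOn_const.mul
        ((by fun_prop : ContinuousOn (fun x : ℝ => 1 + x) (Ici 0)).mul (cv.norm.pow 2)))
    have h1 := Sol.integral_dens_cutoff hs hbc hn
    have hcs : ContinuousOn (fun x => dcutoff n x ^ 2 * ‖f x‖ ^ 2) (Ici 0) :=
      (c2.pow 2).mul (cf.norm.pow 2)
    have hcv : ContinuousOn (fun x => (C + μ) * ‖v x‖ ^ 2) (Ici 0) :=
      continuousOn_const.mul (cv.norm.pow 2)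
    have h2 : ∫ x in (0 : ℝ)..(2 * n), e' x ≤
        ∫ x in (0 : ℝ)..(2 * n), (H.dens μ x (v x) (dv x) + (C + μ) * ‖v x‖ ^ 2) := by
      refine intervalIntegral.integral_mono_on hn2 (LocInt.of_continuousOn ce' _ hn2)
        (LocInt.of_continuousOn ((H.continuousOn_dens μ cv cdv).add hcv) _ hn2) fun x hx => ?_
      have := hH.dens_lower (μ := μ) hx.1 (v x) (dv x)
      simp only [he']; linarith
    rw [intervalIntegral.integral_add (LocInt.of_continuousOn (H.continuousOn_dens μ cv cdv) _ hn2)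
      (LocInt.of_continuousOn hcv _ hn2)] at h2
    have h3 : ∫ x in (0 : ℝ)..n, e x ≤ ∫ x in (0 : ℝ)..(2 * n), e' x := by
      have : ∫ x in (0 : ℝ)..n, e x = ∫ x in (0 : ℝ)..n, e' x := by
        apply intervalIntegral.integral_congr
        intro x hx
        rw [uIcc_of_le hn0] at hx
        simp only [he, he', hv, hdv, cutoff_eq_one hx.1 hx.2, dcutoff_eq_zero hx.1 hx.2, one_smul,
          zero_smul, zero_add]
      rw [this]
      refine intervalIntegral.integral_mono_interval le_rfl hn0 (by linarith) ?_
        (LocInt.of_continuousOn ce' _ hn2)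
      filter_upwards [ae_restrict_mem measurableSet_Ioc] with x hx
      have : 0 ≤ 1 + x := by linarith [hx.1]
      simp only [he', Pi.zero_apply]
      positivity
    have h4 : (∫ x in (0 : ℝ)..(2 * n), dcutoff n x ^ 2 * ‖f x‖ ^ 2) +
        ∫ x in (0 : ℝ)..(2 * n), (C + μ) * ‖v x‖ ^ 2 ≤
        (M ^ 2 + |C + μ|) * ∫ x in Ioi (0 : ℝ), ‖f x‖ ^ 2 := by
      rw [← intervalIntegral.integral_add (LocInt.of_continuousOn hcs _ hn2)
        (LocInt.of_continuousOn hcv _ hn2), ← integral_const_mul]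
      calc _ ≤ ∫ x in (0 : ℝ)..(2 * n), (M ^ 2 + |C + μ|) * ‖f x‖ ^ 2 := by
            refine intervalIntegral.integral_mono_on hn2
              (LocInt.of_continuousOn (hcs.add hcv) _ hn2) (LocInt.of_continuousOn
                (continuousOn_const.mul (cf.norm.pow 2)) _ hn2) fun x hx => ?_
            rw [add_mul (M ^ 2)]
            apply add_le_add
            · refine mul_le_mul_of_nonneg_right ?_ (sq_nonneg _)
              rw [← sq_abs]
              exact pow_le_pow_left₀ (abs_nonneg _) (hMn n hn x) 2
            · have h5 : ‖v x‖ ≤ ‖f x‖ := by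
                rw [hv]
                simp only
                rw [norm_smul, Real.norm_eq_abs, abs_of_nonneg (cutoff_nonneg n x)]
                exact mul_le_of_le_one_left (norm_nonneg _) (cutoff_le_one n x)
              calc (C + μ) * ‖v x‖ ^ 2 ≤ |C + μ| * ‖v x‖ ^ 2 := by gcongr; exact le_abs_self _
                _ ≤ _ := by gcongr
        _ ≤ _ := by
            rw [intervalIntegral.integral_of_le hn2]
            exact setIntegral_mono_set (hf2.const_mul _)
              (Filter.Eventually.of_forall fun x => by positivity)
              (Filter.Eventually.of_forall Ioc_subset_Ioi_self)
    have h6 := hH.le_β (f 0)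
    have h7 := sq_nonneg ‖f 0‖
    linarith
  have hei : IntegrableOn e (Ioi 0) := by
    refine integrableOn_Ioi_of_intervalIntegral_norm_bounded (l := Filter.atTop)
      (b := fun n : ℕ => (n : ℝ)) ((M ^ 2 + |C + μ|) * ∫ x in Ioi (0 : ℝ), ‖f x‖ ^ 2) 0
      (fun n => ?_) tendsto_natCast_atTop_atTop ?_
    · exact (intervalIntegrable_iff_integrableOn_Ioc_of_le (Nat.cast_nonneg n)).1
        (LocInt.of_continuousOn ce _ (Nat.cast_nonneg n))
    · filter_upwards [Filter.eventually_gt_atTop 0] with n hn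
      refine le_trans (le_of_eq ?_) (hbound n hn)
      apply intervalIntegral.integral_congr
      intro x hx
      rw [uIcc_of_le (Nat.cast_nonneg n)] at hx
      simp only
      rw [Real.norm_eq_abs, abs_of_nonneg (he0 x hx.1)]
  have hmf : AEStronglyMeasurable f halfLine := hf.1
  have hmd : AEStronglyMeasurable (fun x => H.A x (f x) + g x) halfLine :=
    (cd.mono Ioi_subset_Ici_self).aestronglyMeasurable measurableSet_Ioi
  have hms : AEStronglyMeasurable (fun x => √(1 + x) • f x) halfLine :=
    (by fun_prop : Measurable fun x : ℝ => √(1 + x)).aestronglyMeasurable.smul hmf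
  refine H.exists_mem_formSpace hbc.1 ?_ ?_ fun x hx => primitive_of_hasDerivWithinAt
    (LocInt.of_continuousOn cd) (fun x hx => (hs x hx).1) hx
  · rw [memLp_two_iff_integrable_sq_norm hmd]
    refine (hei.const_mul 2).mono' (hmd.norm.pow 2) (ae_halfLine fun x hx => ?_)
    rw [Real.norm_eq_abs, abs_of_nonneg (by positivity)]
    have : 0 ≤ c * ((1 + x) * ‖f x‖ ^ 2) := by positivity
    simp only [he]; linarith
  · rw [memLp_two_iff_integrable_sq_norm hms]
    refine (Integrable.const_mul hei c⁻¹).mono' (hms.norm.pow 2) (ae_halfLine fun x hx => ?_)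
    rw [Real.norm_eq_abs, abs_of_nonneg (by positivity), norm_smul, mul_pow, Real.norm_eq_abs,
      sq_abs, Real.sq_sqrt (by linarith)]
    have h1 : 0 ≤ 1 / 2 * ‖H.A x (f x) + g x‖ ^ 2 := by positivity
    have h2 : (1 + x) * ‖f x‖ ^ 2 = c⁻¹ * (c * ((1 + x) * ‖f x‖ ^ 2)) := by field_simp
    rw [h2]
    gcongr
    simp only [he]; linarith

lemma eq_zero_of_tendsto_of_integrableOn {F : ℝ → ℝ} {l : ℝ}
    (hF : Filter.Tendsto F Filter.atTop (nhds l)) (hi : IntegrableOn F (Ioi 0)) : l = 0 := by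
  by_contra hl
  have h1 : ∀ᶠ x in Filter.atTop, |l| / 2 < |F x| :=
    hF.abs.eventually (lt_mem_nhds (by linarith [abs_pos.2 hl]))
  obtain ⟨N, hN⟩ := Filter.eventually_atTop.1 h1
  have h2 : IntegrableOn (fun _ : ℝ => |l| / 2) (Ioi (max N 0)) := by
    refine (IntegrableOn.mono_set (f := fun x => ‖F x‖) hi.norm
      (Ioi_subset_Ioi (le_max_right _ _))).mono'
      aestronglyMeasurable_const ?_
    filter_upwards [ae_restrict_mem measurableSet_Ioi] with x hx
    have := hN x ((le_max_left _ _).trans (le_of_lt hx))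
    rw [Real.norm_eq_abs, abs_of_nonneg (by positivity)]
    exact this.le
  rw [integrableOn_const_iff] at h2
  rcases h2 with h2 | h2
  · have := abs_pos.2 hl
    rw [enorm_eq_zero] at h2
    linarith
  · simp at h2

/-- No boundary term survives at infinity: by Green's formula ⟨φ(T), g(T)⟩ converges as T → ∞, and
it is integrable because φ and g = f' - A f are in L², so the limit is 0. -/
lemma form_eq_of_sol [FiniteDimensional ℝ E] (hH : H.IsCoercive c C) {f g : ℝ → E}
    (hs : H.Sol μ f g) (hbc : H.BC f g) {z : Triple E}
    (hzh : h E z =ᵐ[halfLine] (fun x => H.A x (f x) + g x)) (hzJ : emb E z =ᵐ[halfLine] f)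
    (h0 : rep E z 0 = f 0) {φ : Triple E} (hφ : φ ∈ H.formSpace) :
    hH.form z φ = μ * inner ℝ (emb E z) (emb E φ) := by
  have hI : Integrable (fun x => integrand H z φ x - μ * inner ℝ (emb E z x) (emb E φ x))
      halfLine := (hH.integrable_integrand z φ).sub
      ((L2.integrable_inner (𝕜 := ℝ) (emb E z) (emb E φ)).const_mul μ)
  have h1 : Filter.Tendsto (fun T : ℝ => inner ℝ (rep E φ T) (g T)) Filter.atTop
      (nhds ((∫ x in Ioi (0 : ℝ), (integrand H z φ x - μ * inner ℝ (emb E z x) (emb E φ x))) +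
        inner ℝ (rep E φ 0) (g 0))) := by
    refine ((intervalIntegral_tendsto_integral_Ioi 0 hI Filter.tendsto_id).add_const _).congr' ?_
    filter_upwards [Filter.eventually_ge_atTop 0] with T hT
    rw [id, integral_integrand_sub hs hφ hT
      (by filter_upwards [hzh, hzJ] with x e1 e2 _ using ⟨e1, e2⟩)]
    ring
  have h2 : IntegrableOn (fun T : ℝ => inner ℝ (rep E φ T) (g T)) (Ioi 0) := by
    refine (L2.integrable_inner (𝕜 := ℝ) (emb E φ) (h E z - hH.mulA z)).congr ?_
    filter_upwards [hφ.2, hzh, hzJ, hH.mulA_ae z, Lp.coeFn_sub (h E z) (hH.mulA z)]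
      with x e1 e2 e3 e4 e5
    rw [e5, Pi.sub_apply, e4, e2, e3, e1, add_sub_cancel_left]
  have h3 := eq_zero_of_tendsto_of_integrableOn h1 h2
  rw [integral_sub (hH.integrable_integrand z φ)
      ((L2.integrable_inner (𝕜 := ℝ) (emb E z) (emb E φ)).const_mul μ), integral_const_mul,
      ← L2.inner_def] at h3
  have h4 := hbc.2 (rep E φ 0) (by rw [rep_zero]; exact hφ.1)
  rw [inner_sub_right, sub_eq_zero] at h4
  rw [form_eq_integral, ← rep_zero, ← rep_zero, h0, real_inner_comm, ← h4]
  linarith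

end IsCoercive

end Hamiltonian

end StochasticAiry

/-! ### Picone's inequality on the form domain and the lower bound for the number of focal points -/

namespace StochasticAiry

namespace Hamiltonian

open Triple

variable {E : Type*} [NormedAddCommGroup E] [InnerProductSpace ℝ E] [FiniteDimensional ℝ E]
  {H : Hamiltonian E} {c C lam : ℝ} {F G : ℝ → E →L[ℝ] E}

namespace IsCoercive

lemma abs_dens_le (hH : H.IsCoercive c C) {x : ℝ} (hx : 0 ≤ x) (lam : ℝ) (u w : E) :
    |H.dens lam x u w| ≤ (4 * C + |lam| + 2) * ((1 + x) * ‖u‖ ^ 2 + ‖w‖ ^ 2) := by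
  have hC := hH.nonneg
  have hA : ‖H.A x u‖ ^ 2 ≤ C * (1 + x) * ‖u‖ ^ 2 := by
    calc ‖H.A x u‖ ^ 2 ≤ (‖H.A x‖ * ‖u‖) ^ 2 := by gcongr; exact (H.A x).le_opNorm u
      _ = ‖H.A x‖ ^ 2 * ‖u‖ ^ 2 := mul_pow _ _ _
      _ ≤ _ := by gcongr; exact hH.bound_A x hx
  have hp : |inner ℝ (H.p x u) u| ≤ C * (1 + x) * ‖u‖ ^ 2 := by
    calc |inner ℝ (H.p x u) u| ≤ ‖H.p x u‖ * ‖u‖ := abs_real_inner_le_norm _ _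
      _ ≤ (‖H.p x‖ * ‖u‖) * ‖u‖ := by gcongr; exact (H.p x).le_opNorm u
      _ = ‖H.p x‖ * ‖u‖ ^ 2 := by ring
      _ ≤ _ := by gcongr; exact hH.bound_p x hx
  have hw : ‖w - H.A x u‖ ^ 2 ≤ 2 * ‖w‖ ^ 2 + 2 * ‖H.A x u‖ ^ 2 := by
    have h1 : ‖w - H.A x u‖ ^ 2 ≤ (‖w‖ + ‖H.A x u‖) ^ 2 := by gcongr; exact norm_sub_le _ _
    nlinarith [sq_nonneg (‖w‖ - ‖H.A x u‖)]
  have hl : |lam * ‖u‖ ^ 2| ≤ |lam| * ((1 + x) * ‖u‖ ^ 2) := by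
    rw [abs_mul, abs_of_nonneg (sq_nonneg ‖u‖)]
    gcongr
    exact le_mul_of_one_le_left (sq_nonneg _) (by linarith)
  have e1 : H.dens lam x u w =
      ‖w - H.A x u‖ ^ 2 + inner ℝ (H.p x u) u - lam * ‖u‖ ^ 2 - ‖H.A x u‖ ^ 2 := by
    rw [dens, inner_sub_left, inner_sub_left, H.symm_A x (H.A x u), real_inner_smul_left,
      real_inner_self_eq_norm_sq, real_inner_self_eq_norm_sq]
    ring
  have h0 : 0 ≤ (1 + x) * ‖u‖ ^ 2 := by positivity
  have h1 := sq_nonneg ‖w - H.A x u‖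
  have h2 := sq_nonneg ‖H.A x u‖
  have h3 : 0 ≤ C * ‖w‖ ^ 2 := by positivity
  have h4 : 0 ≤ |lam| * ‖w‖ ^ 2 := by positivity
  have h5 : 0 ≤ C * (1 + x) * ‖u‖ ^ 2 := by positivity
  have h6 := sq_nonneg ‖w‖
  rw [abs_le] at hp hl
  rw [e1, abs_le]
  constructor <;> nlinarith

/-- Picone's inequality in the form domain. -/
lemma form_nonneg_of_mem_range (hH : H.IsCoercive c C) (hF : H.IsFrame lam F G) {X : Finset ℝ}
    (hX0 : ∀ ξ ∈ X, 0 < ξ) (hX : ∀ x, 0 < x → x ∉ X → IsUnit (F x)) {z : Triple E}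
    (hz : z ∈ H.formSpace) {df : ℝ → E}
    (hd : ∀ x, 0 ≤ x → HasDerivWithinAt (rep E z) (df x) (Ici 0) x)
    (hdf : ContinuousOn df (Ici 0)) (hr : ∀ ξ ∈ X, ∃ v, F ξ v = rep E z ξ) :
    lam * ‖emb E z‖ ^ 2 ≤ hH.form z z := by
  have : CompleteSpace E := FiniteDimensional.complete ℝ E
  obtain ⟨M, hM, hMn⟩ := exists_abs_dcutoff_le
  set f := rep E z with hf
  have cf : ContinuousOn f (Ici 0) := continuousOn_rep z
  set Fn : ℕ → ℝ → ℝ := fun n x => H.dens lam x (cutoff n x • f x)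
    (dcutoff n x • f x + cutoff n x • df x) with hFn
  have c1 := fun n => (continuous_cutoff n).continuousOn (s := Ici 0)
  have c2 := fun n => (continuous_dcutoff n).continuousOn (s := Ici 0)
  have cdv : ∀ n, ContinuousOn (fun x => dcutoff n x • f x + cutoff n x • df x) (Ici 0) :=
    fun n => ((c2 n).smul cf).add ((c1 n).smul hdf)
  have hFc : ∀ n, ContinuousOn (Fn n) (Ici 0) := fun n =>
    H.continuousOn_dens lam ((c1 n).smul cf) (cdv n)
  have hae : df =ᵐ[halfLine] h E z := by
    filter_upwards [ae_hasDerivAt_rep z, ae_halfLine fun x hx => hx] with x h1 hx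
    exact ((hd x (le_of_lt hx)).hasDerivAt (Ici_mem_nhds hx)).unique h1
  -- The origin is added to the exceptional set, since F(0) may be singular at a Dirichlet
  -- condition. There the range condition holds because f(0) ∈ D and D lies in the range of F(0).
  obtain ⟨N, hN⟩ : ∃ N : ℕ, ∀ ξ ∈ insert 0 X, ξ + 2 ≤ N := by
    obtain ⟨R, hR⟩ := (insert 0 X).finite_toSet.bddAbove
    obtain ⟨N, hN⟩ := exists_nat_ge (R + 2)
    exact ⟨N, fun ξ hξ => by linarith [hR hξ]⟩
  have hNpos : 0 < N := by
    have := hN 0 (Finset.mem_insert_self _ _)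
    have h2 : (0 : ℝ) < N := by linarith
    exact_mod_cast h2
  have hpic : ∀ n : ℕ, N ≤ n →
      0 ≤ inner ℝ (H.β (f 0)) (f 0) + ∫ x in Ioi (0 : ℝ), Fn n x := by
    intro n hn
    have hn0 : 0 < n := hNpos.trans_le hn
    have h1 := hF.picone (X := insert 0 X) (T := 2 * n) (f := fun x => cutoff n x • f x)
      (df := fun x => dcutoff n x • f x + cutoff n x • df x) (Finset.mem_insert_self _ _)
      (by simpa using fun ξ hξ => (hX0 ξ hξ).le)
      (fun x hx hxX => by
        simp only [Finset.mem_insert, not_or] at hxX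
        exact hX x (lt_of_le_of_ne hx (Ne.symm hxX.1)) hxX.2)
      (fun x hx => by
        refine ((hasDerivAt_cutoff n x).hasDerivWithinAt.smul (hd x hx)).congr_deriv ?_
        rw [add_comm])
      (cdv n)
      (fun x hx => by
        rcases Finset.mem_insert.1 hx with rfl | hx
        · obtain ⟨v, hv⟩ := hF.surj (f 0) (by rw [hf, rep_zero]; exact hz.1)
          exact ⟨cutoff n 0 • v, by rw [map_smul, hv]⟩
        · obtain ⟨v, hv⟩ := hr x hx
          exact ⟨cutoff n x • v, by rw [map_smul, hv]⟩)
      (fun ξ hξ => by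
        have h2 := hN ξ hξ
        have h3 : (N : ℝ) ≤ n := Nat.cast_le.2 hn
        have h4 : (0 : ℝ) ≤ n := Nat.cast_nonneg n
        linarith)
      (by rw [cutoff_eq_zero hn0 le_rfl, zero_smul])
    rw [cutoff_eq_one le_rfl (Nat.cast_nonneg n), one_smul] at h1
    rw [setIntegral_Ioi_eq_of_eq_zero (T := 2 * n) (by positivity)]
    · exact h1
    · intro x hx
      simp [hFn, dens, cutoff_eq_zero hn0 hx.le, dcutoff_eq_zero_of_lt hn0 hx]
  -- The cutoffs have bounded derivative, so the densities are dominated by a multiple of (1 +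
  -- x)|f|² + |f'|², which is integrable on the form domain.
  have hlim : Filter.Tendsto (fun n => ∫ x in Ioi (0 : ℝ), Fn n x) Filter.atTop
      (nhds (∫ x in Ioi (0 : ℝ), H.dens lam x (f x) (h E z x))) := by
    set K := 4 * C + |lam| + 2 with hK
    have hK0 : 0 ≤ K := by have := hH.nonneg; positivity
    have hbi : Integrable (fun x => K * ((1 + 2 * M ^ 2) * ((1 + x) * ‖emb E z x‖ ^ 2) +
        2 * ‖h E z x‖ ^ 2)) halfLine :=
      (((integrable_weighted z).const_mul (1 + 2 * M ^ 2)).add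
        ((integrable_norm_sq_halfL2 (h E z)).const_mul 2)).const_mul K
    refine tendsto_integral_filter_of_dominated_convergence
      (fun x => K * ((1 + 2 * M ^ 2) * ((1 + x) * ‖emb E z x‖ ^ 2) + 2 * ‖h E z x‖ ^ 2))
      (Filter.Eventually.of_forall fun n =>
        ((hFc n).mono Ioi_subset_Ici_self).aestronglyMeasurable measurableSet_Ioi)
      ?_ hbi ?_
    · filter_upwards [Filter.eventually_gt_atTop 0] with n hn
      filter_upwards [hz.2, hae, ae_halfLine fun x hx => hx.le] with x e1 e2 hx
      rw [e1, ← e2, Real.norm_eq_abs]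
      refine (hH.abs_dens_le hx lam _ _).trans ?_
      have h1 : ‖cutoff n x • f x‖ ^ 2 ≤ ‖f x‖ ^ 2 := by
        rw [norm_smul, Real.norm_eq_abs, abs_of_nonneg (cutoff_nonneg n x)]
        exact pow_le_pow_left₀ (mul_nonneg (cutoff_nonneg n x) (norm_nonneg (f x)))
          (mul_le_of_le_one_left (norm_nonneg (f x)) (cutoff_le_one n x)) 2
      have h2 : ‖dcutoff n x • f x + cutoff n x • df x‖ ^ 2 ≤
          2 * M ^ 2 * ‖f x‖ ^ 2 + 2 * ‖df x‖ ^ 2 := by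
        have h3 : ‖dcutoff n x • f x + cutoff n x • df x‖ ≤ M * ‖f x‖ + ‖df x‖ := by
          refine (norm_add_le _ _).trans (add_le_add ?_ ?_)
          · rw [norm_smul, Real.norm_eq_abs]; gcongr; exact hMn n hn x
          · rw [norm_smul, Real.norm_eq_abs, abs_of_nonneg (cutoff_nonneg n x)]
            exact mul_le_of_le_one_left (norm_nonneg _) (cutoff_le_one n x)
        have h4 : ‖dcutoff n x • f x + cutoff n x • df x‖ ^ 2 ≤ (M * ‖f x‖ + ‖df x‖) ^ 2 := by
          gcongr
        nlinarith [sq_nonneg (M * ‖f x‖ - ‖df x‖)]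
      have h3 : ‖f x‖ ^ 2 ≤ (1 + x) * ‖f x‖ ^ 2 :=
        le_mul_of_one_le_left (sq_nonneg _) (by linarith)
      have h4 : 2 * M ^ 2 * ‖f x‖ ^ 2 ≤ 2 * M ^ 2 * ((1 + x) * ‖f x‖ ^ 2) := by gcongr
      have h5 : (1 + x) * ‖cutoff n x • f x‖ ^ 2 ≤ (1 + x) * ‖f x‖ ^ 2 := by gcongr
      refine mul_le_mul_of_nonneg_left ?_ hK0
      linarith
    · filter_upwards [hae, ae_halfLine fun x hx => hx.le] with x e2 hx
      refine tendsto_const_nhds.congr' ?_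
      obtain ⟨n₀, hn₀⟩ := exists_nat_ge x
      filter_upwards [Filter.eventually_ge_atTop n₀] with n hn
      have hxn : x ≤ n := hn₀.trans (Nat.cast_le.2 hn)
      rw [hFn]
      simp only
      rw [cutoff_eq_one hx hxn, dcutoff_eq_zero hx hxn, e2, one_smul, zero_smul, zero_add, one_smul]
  have h1 : 0 ≤ inner ℝ (H.β (f 0)) (f 0) + ∫ x in Ioi (0 : ℝ), H.dens lam x (f x) (h E z x) :=
    ge_of_tendsto (hlim.const_add _) (by
      filter_upwards [Filter.eventually_ge_atTop N] with n hn using hpic n hn)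
  rw [← hH.form_sub_eq_integral_dens hz] at h1
  linarith

/-! ### Eigenspaces -/

/-- The eigenspaces of the form. -/
def eigenspace (hH : H.IsCoercive c C) (μ : ℝ) : Submodule ℝ H.formSpace where
  carrier := {z | ∀ φ ∈ H.formSpace, hH.form z φ = μ * inner ℝ (emb E z) (emb E φ)}
  add_mem' := by
    intro z w hz hw φ hφ
    rw [Submodule.coe_add, map_add, map_add, LinearMap.add_apply, hz φ hφ, hw φ hφ, inner_add_left]
    ring
  zero_mem' := by intro φ _; simp
  smul_mem' := by
    intro a z hz φ hφ
    rw [Submodule.coe_smul, map_smul, map_smul, LinearMap.smul_apply, hz φ hφ,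
      real_inner_smul_left, smul_eq_mul]
    ring

lemma inner_eq_zero_of_ne (hH : H.IsCoercive c C) {μ ν : ℝ} (hne : μ ≠ ν) {z w : H.formSpace}
    (hz : z ∈ hH.eigenspace μ) (hw : w ∈ hH.eigenspace ν) :
    inner ℝ (emb E z.1) (emb E w.1) = 0 := by
  have h1 := hz w.1 w.2
  have h2 := hw z.1 z.2
  rw [hH.form_symm, h1, real_inner_comm, ← sub_eq_zero, ← sub_mul] at h2
  rcases mul_eq_zero.1 h2 with h | h
  · exact absurd (sub_eq_zero.1 h) hne
  · rw [real_inner_comm]; exact h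

/-- Coercivity: where the form is at most μ times the squared L² norm, the L² norm controls the full
norm. This is the hypothesis under which compactness bounds dimensions. -/
lemma norm_sq_le_of_form_le (hH : H.IsCoercive c C) {z : Triple E} {μ : ℝ}
    (hz : hH.form z z ≤ μ * ‖emb E z‖ ^ 2) :
    ‖z‖ ≤ √((|μ| + C) / min (1 / 2) c) * ‖emb E z‖ := by
  have hm : 0 < min (1 / 2) c := lt_min (by norm_num) hH.pos
  have h1 := hH.coercive z
  have h2 : 0 ≤ |μ| + C := add_nonneg (abs_nonneg _) hH.nonneg
  refine (sq_le_sq₀ (norm_nonneg _) (by positivity)).1 ?_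
  rw [mul_pow, Real.sq_sqrt (by positivity), div_mul_eq_mul_div, le_div_iff₀ hm]
  have h3 : μ * ‖emb E z‖ ^ 2 ≤ |μ| * ‖emb E z‖ ^ 2 := by gcongr; exact le_abs_self μ
  linarith

lemma eq_zero_of_form_le (hH : H.IsCoercive c C) {z : Triple E} {μ : ℝ}
    (hz : hH.form z z ≤ μ * ‖emb E z‖ ^ 2) (h0 : emb E z = 0) : z = 0 := by
  have := hH.norm_sq_le_of_form_le hz
  rw [h0, norm_zero, mul_zero] at this
  exact norm_eq_zero.1 (le_antisymm this (norm_nonneg _))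

lemma eq_zero_of_mem_eigenspace (hH : H.IsCoercive c C) {z : H.formSpace} {μ : ℝ}
    (hz : z ∈ hH.eigenspace μ) (h0 : emb E z.1 = 0) : z = 0 :=
  Subtype.ext (hH.eq_zero_of_form_le (μ := μ)
    (by rw [hz z.1 z.2, real_inner_self_eq_norm_sq]) h0)

lemma exists_finrank_le (hH : H.IsCoercive c C) (μ : ℝ) : ∃ n : ℕ, ∀ Z : Submodule ℝ H.formSpace,
    (∀ z ∈ Z, hH.form z.1 z.1 ≤ μ * ‖emb E z.1‖ ^ 2) →
      FiniteDimensional ℝ Z ∧ Module.finrank ℝ Z ≤ n := by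
  obtain ⟨n, hn⟩ := finiteDimensional_of_forall_norm_le (E := E)
    (J := (emb E).comp H.formSpace.subtypeL) (fun ε hε => H.exists_norm_emb_le hε)
    (√((|μ| + C) / min (1 / 2) c))
  exact ⟨n, fun Z hZ => hn Z fun z hz => hH.norm_sq_le_of_form_le (hZ z hz)⟩

instance finiteDimensional_eigenspace (hH : H.IsCoercive c C) (μ : ℝ) :
    FiniteDimensional ℝ (hH.eigenspace μ) := by
  obtain ⟨n, hn⟩ := hH.exists_finrank_le μ
  exact (hn (hH.eigenspace μ) fun z hz => by
    rw [hz z.1 z.2, real_inner_self_eq_norm_sq]).1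

/-- The sum of the eigenspaces is mapped to the quotients E / range F(ξ) over the focal points ξ. On
the kernel Picone gives q ≥ lam‖·‖², while orthogonality of eigenspaces with μ < lam gives q <
lam‖·‖² unless the vector is 0. So the map is injective, and by rank-nullity its target has
dimension the total nullity. -/
lemma sum_finrank_eigenspace_le (hH : H.IsCoercive c C) (hF : H.IsFrame lam F G) {X : Finset ℝ}
    (hX0 : ∀ ξ ∈ X, 0 < ξ) (hX : ∀ x, 0 < x → x ∉ X → IsUnit (F x)) {t : Finset ℝ}
    (ht : ∀ μ ∈ t, μ < lam) :
    ∑ μ ∈ t, Module.finrank ℝ (hH.eigenspace μ) ≤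
      ∑ x ∈ X, Module.finrank ℝ (LinearMap.ker (F x).toLinearMap) := by
  have : CompleteSpace E := FiniteDimensional.complete ℝ E
  let S : ((μ : t) → hH.eigenspace μ) →ₗ[ℝ] H.formSpace :=
    ∑ μ : t, (hH.eigenspace μ).subtype.comp (LinearMap.proj μ)
  have hS : ∀ z, S z = ∑ μ : t, (z μ : H.formSpace) := fun z => by simp [S]
  let Φ : ((μ : t) → hH.eigenspace μ) →ₗ[ℝ] ((ξ : X) → E ⧸ LinearMap.range (F ξ).toLinearMap) :=
    LinearMap.pi fun ξ => (LinearMap.range (F ξ).toLinearMap).mkQ.comp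
      ((LinearMap.proj (ξ : ℝ)).comp ((rep E).comp (H.formSpace.subtype.comp S)))
  have hinj : Function.Injective Φ := by
    rw [← LinearMap.ker_eq_bot, LinearMap.ker_eq_bot']
    intro z hz
    choose g hg using fun μ : t => hH.exists_sol_of_form_eq (z μ).1.2 (z μ).2
    have hrep : ∀ x, rep E (S z).1 x = ∑ μ : t, rep E (z μ).1.1 x := fun x => by
      rw [hS]; simp
    have h1 : lam * ‖emb E (S z).1‖ ^ 2 ≤ hH.form (S z).1 (S z).1 := by
      refine hH.form_nonneg_of_mem_range hF hX0 hX (S z).2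
        (df := fun x => ∑ μ : t, (H.A x (rep E (z μ).1.1 x) + g μ x)) ?_ ?_ ?_
      · intro x hx
        have : rep E (S z).1 = fun x => ∑ μ : t, rep E (z μ).1.1 x := funext hrep
        rw [this]
        exact HasDerivWithinAt.fun_sum fun μ _ => ((hg μ).1 x hx).1
      · exact continuousOn_finsetSum _ fun μ _ => (hg μ).1.continuousOn_deriv_fst
      · intro ξ hξ
        have h2 : Φ z ⟨ξ, hξ⟩ = 0 := by rw [hz]; rfl
        exact (Submodule.Quotient.mk_eq_zero _).1 h2
    have horth : ∀ μ ν : t, μ ≠ ν →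
        inner ℝ (emb E (z μ).1.1) (emb E (z ν).1.1) = 0 := fun μ ν hne =>
      hH.inner_eq_zero_of_ne (fun h => hne (Subtype.ext h)) (z μ).2 (z ν).2
    have hval : (S z).1 = ∑ μ : t, (z μ).1.1 := by rw [hS]; simp
    have h2 : hH.form (S z).1 (S z).1 = ∑ μ : t, (μ : ℝ) * ‖emb E (z μ).1.1‖ ^ 2 := by
      rw [hval]
      simp only [map_sum, LinearMap.sum_apply]
      refine Finset.sum_congr rfl fun μ _ => ?_
      rw [Finset.sum_eq_single μ]
      · rw [(z μ).2 _ (z μ).1.2, real_inner_self_eq_norm_sq]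
      · intro ν _ hne
        rw [(z ν).2 _ (z μ).1.2, horth ν μ hne, mul_zero]
      · simp
    have h3 : ‖emb E (S z).1‖ ^ 2 = ∑ μ : t, ‖emb E (z μ).1.1‖ ^ 2 := by
      rw [← real_inner_self_eq_norm_sq, hval, map_sum, sum_inner]
      refine Finset.sum_congr rfl fun μ _ => ?_
      rw [inner_sum, Finset.sum_eq_single μ]
      · rw [real_inner_self_eq_norm_sq]
      · intro ν _ hne
        exact horth μ ν (Ne.symm hne)
      · simp
    rw [h2, h3, Finset.mul_sum, ← sub_nonneg, ← Finset.sum_sub_distrib] at h1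
    have hnn : ∀ μ ∈ (Finset.univ : Finset t),
        0 ≤ lam * ‖emb E (z μ).1.1‖ ^ 2 - (μ : ℝ) * ‖emb E (z μ).1.1‖ ^ 2 := fun μ _ => by
      rw [← sub_mul]
      exact mul_nonneg (sub_nonneg.2 (ht μ μ.2).le) (sq_nonneg _)
    have h4 : ∑ μ : t, (lam * ‖emb E (z μ).1.1‖ ^ 2 - (μ : ℝ) * ‖emb E (z μ).1.1‖ ^ 2) = 0 := by
      refine le_antisymm ?_ (Finset.sum_nonneg hnn)
      rw [← neg_nonneg, ← Finset.sum_neg_distrib]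
      simpa using h1
    funext μ
    have h5 := (Finset.sum_eq_zero_iff_of_nonneg hnn).1 h4 μ (Finset.mem_univ _)
    rw [← sub_mul] at h5
    have h6 : emb E (z μ).1.1 = 0 := by
      rcases mul_eq_zero.1 h5 with h | h
      · exact absurd h (sub_pos.2 (ht μ μ.2)).ne'
      · exact norm_eq_zero.1 (pow_eq_zero_iff (two_ne_zero)|>.1 h)
    exact Subtype.ext (hH.eq_zero_of_mem_eigenspace (z μ).2 h6)
  have h1 := LinearMap.finrank_le_finrank_of_injective hinj
  rw [Module.finrank_pi_fintype, Module.finrank_pi_fintype] at h1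
  rw [← Finset.sum_coe_sort t, ← Finset.sum_coe_sort X]
  refine h1.trans (le_of_eq (Finset.sum_congr rfl fun ξ _ => ?_))
  have h2 := (LinearMap.range (F ξ).toLinearMap).finrank_quotient_add_finrank
  have h3 := LinearMap.finrank_range_add_finrank_ker (F ξ).toLinearMap
  omega

end IsCoercive

end Hamiltonian

end StochasticAiry

/-! ### Orthogonality to eigenspaces and the production of new eigenvectors -/

namespace StochasticAiry

section Orthogonality

variable {V L : Type*} [NormedAddCommGroup V] [InnerProductSpace ℝ V]
  [NormedAddCommGroup L] [InnerProductSpace ℝ L]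

/-- A dimension count: orthogonality imposes fewer linear conditions than K has dimensions. -/
lemma exists_ne_zero_forall_inner_eq_zero {ι K : Type*} [Fintype ι] [AddCommGroup K] [Module ℝ K]
    [FiniteDimensional ℝ K] (J : V →L[ℝ] L) (W : ι → Submodule ℝ V)
    [∀ i, FiniteDimensional ℝ (W i)] (b : K →ₗ[ℝ] V)
    (hlt : ∑ i, Module.finrank ℝ (W i) < Module.finrank ℝ K) :
    ∃ v, v ≠ 0 ∧ ∀ i, ∀ e ∈ W i, inner ℝ (J (b v)) (J e) = 0 := by
  let Ψ : K →ₗ[ℝ] ((i : ι) → Module.Dual ℝ (W i)) :=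
    LinearMap.pi fun i => ((innerₗ L).compl₁₂ J.toLinearMap
      (J.toLinearMap.comp (W i).subtype)).comp b
  have h1 : LinearMap.ker Ψ ≠ ⊥ := by
    apply LinearMap.ker_ne_bot_of_finrank_lt
    rw [Module.finrank_pi_fintype]
    refine lt_of_le_of_lt (le_of_eq ?_) hlt
    exact Finset.sum_congr rfl fun i _ => Subspace.dual_finrank_eq
  obtain ⟨v, hv, hv0⟩ := (Submodule.ne_bot_iff _).1 h1
  refine ⟨v, hv0, fun i e he => ?_⟩
  have h2 : Ψ v i ⟨e, he⟩ = 0 := by rw [LinearMap.mem_ker.1 hv]; rfl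
  exact h2

lemma exists_mem_forall_inner_sub_eq_zero (J : V →L[ℝ] L) (W : Submodule ℝ V)
    [FiniteDimensional ℝ W] (w : V) :
    ∃ e ∈ W, ∀ e' ∈ W, inner ℝ (J (w - e)) (J e') = 0 := by
  let S := W.map J.toLinearMap
  obtain ⟨e, he, hew⟩ := S.starProjection_apply_mem (J w)
  refine ⟨e, he, fun e' he' => ?_⟩
  have h1 : J w - S.starProjection (J w) ∈ Sᗮ := Submodule.sub_starProjection_mem_orthogonal _
  have h2 := Submodule.inner_left_of_mem_orthogonal (𝕜 := ℝ) (K := S) (u := J e')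
    ⟨e', he', rfl⟩ h1
  rw [← hew] at h2
  rw [map_sub]
  exact h2

/-- The vectors whose images are orthogonal to the images of a family of subspaces. -/
def orthogonalTo {ι : Type*} (J : V →L[ℝ] L) (W : ι → Submodule ℝ V) : Submodule ℝ V where
  carrier := {u | ∀ i, ∀ e ∈ W i, inner ℝ (J u) (J e) = 0}
  add_mem' := fun {a b} ha hb i e he => by
    rw [map_add, inner_add_left, ha i e he, hb i e he, add_zero]
  zero_mem' := fun i e he => by rw [map_zero, inner_zero_left]
  smul_mem' := fun r a ha i e he => by
    rw [map_smul, real_inner_smul_left, ha i e he, mul_zero]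

lemma mem_orthogonalTo {ι : Type*} {J : V →L[ℝ] L} {W : ι → Submodule ℝ V} {u : V} :
    u ∈ orthogonalTo J W ↔ ∀ i, ∀ e ∈ W i, inner ℝ (J u) (J e) = 0 := Iff.rfl

lemma isClosed_orthogonalTo {ι : Type*} (J : V →L[ℝ] L) (W : ι → Submodule ℝ V) :
    IsClosed (orthogonalTo J W : Set V) := by
  have : (orthogonalTo J W : Set V) = ⋂ (i : ι), ⋂ (e : V), ⋂ (_ : e ∈ W i),
      {u | inner ℝ (J u) (J e) = 0} := by
    ext u; simp [orthogonalTo]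
  rw [this]
  exact isClosed_iInter fun μ => isClosed_iInter fun e => isClosed_iInter fun _ =>
    isClosed_eq (by fun_prop) continuous_const

lemma exists_mem_iSup_sub_mem {ι : Type*} [Finite ι] (J : V →L[ℝ] L) (W : ι → Submodule ℝ V)
    [∀ i, FiniteDimensional ℝ (W i)] (w : V) : ∃ e ∈ ⨆ i, W i, w - e ∈ orthogonalTo J W := by
  obtain ⟨e, he, h⟩ := exists_mem_forall_inner_sub_eq_zero J (⨆ i, W i) w
  exact ⟨e, he, fun i e' he' => h e' (Submodule.mem_iSup_of_mem i he')⟩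

/-- A Rayleigh minimizer on the orthogonal complement satisfies the Euler-Lagrange equation only for
test vectors of the complement. It extends to all vectors because the minimizer is orthogonal to the
given eigenspaces both for q and for the L² product, and every vector splits into a part in their
sum and a part in the complement. -/
lemma exists_eigenvector_of_orthogonalTo [CompleteSpace V] {q : LinearMap.BilinForm ℝ V}
    (hs : ∀ u v, q u v = q v u) (hqc : Continuous fun u => q u u) {J : V →L[ℝ] L}
    (hJ : ∀ R : ℝ, ∃ K : Set L, IsCompact K ∧ ∀ u, ‖u‖ ≤ R → J u ∈ K) {c C : ℝ} (hc : 0 < c)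
    (hcoer : ∀ u, c * ‖u‖ ^ 2 ≤ q u u + C * ‖J u‖ ^ 2) {t : Finset ℝ} (W : ℝ → Submodule ℝ V)
    [∀ μ, FiniteDimensional ℝ (W μ)]
    (hW : ∀ μ, ∀ e ∈ W μ, ∀ v, q e v = μ * inner ℝ (J e) (J v)) {z : V}
    (hz : ∀ μ ∈ t, ∀ e ∈ W μ, inner ℝ (J z) (J e) = 0) (hJz : J z ≠ 0) {lam : ℝ}
    (hqz : q z z ≤ lam * ‖J z‖ ^ 2) :
    ∃ u, (∀ μ ∈ t, ∀ e ∈ W μ, inner ℝ (J u) (J e) = 0) ∧ ∃ κ ≤ lam, J u ≠ 0 ∧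
      (∀ v, q u v = κ * inner ℝ (J u) (J v)) ∧ (κ = lam → u = z) := by
  obtain ⟨u, huM, κ, hκ, huJ, hueq, hulam⟩ := exists_rayleigh_minimizer hs hqc hJ hc hcoer
    (isClosed_orthogonalTo J (fun μ : t => W μ))
    (mem_orthogonalTo.2 fun μ e he => hz μ μ.2 e he) hJz hqz
  rw [mem_orthogonalTo] at huM
  refine ⟨u, fun μ hμ e he => huM ⟨μ, hμ⟩ e he, κ, hκ, huJ, fun w => ?_, hulam⟩
  have hV0 : ∀ e ∈ ⨆ μ : t, W μ, inner ℝ (J u) (J e) = 0 ∧ q u e = 0 := by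
    intro e he
    induction he using Submodule.iSup_induction' with
    | mem μ e he =>
      exact ⟨huM μ e he, by rw [hs, hW μ e he u, real_inner_comm, huM μ e he, mul_zero]⟩
    | zero => simp
    | add x y _ _ hx hy =>
      rw [map_add, map_add, inner_add_right, hx.1, hx.2, hy.1, hy.2]; simp
  obtain ⟨e, he, hew⟩ := exists_mem_iSup_sub_mem J (fun μ : t => W μ) w
  have h1 := hueq _ hew
  have h2 := hV0 e he
  rw [map_sub, map_sub, inner_sub_right, h2.1, h2.2, sub_zero, sub_zero] at h1
  exact h1

end Orthogonality

/-! ### Truncated solutions, the upper bound for the number of focal points, and the oscillation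
theorem -/

namespace Hamiltonian

open Triple

variable {E : Type*} [NormedAddCommGroup E] [InnerProductSpace ℝ E] [FiniteDimensional ℝ E]
  {H : Hamiltonian E} {c C lam : ℝ} {F G : ℝ → E →L[ℝ] E}

/-- A solution of the system which vanishes near a point vanishes. -/
lemma Sol.eq_zero_of_eqOn {μ : ℝ} {f g : ℝ → E} (hs : H.Sol μ f g) {a b : ℝ} (ha : 0 ≤ a)
    (hab : a < b) (h0 : ∀ x ∈ Ioo a b, f x = 0) {x : ℝ} (hx : 0 ≤ x) : f x = 0 ∧ g x = 0 := by
  have : CompleteSpace E := FiniteDimensional.complete ℝ E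
  set m := (a + b) / 2 with hm
  have hma : a < m := by rw [hm]; linarith
  have hmb : m < b := by rw [hm]; linarith
  have h1 : HasDerivAt f (H.A m (f m) + g m) m :=
    (hs m (ha.trans hma.le)).1.hasDerivAt (Ici_mem_nhds (ha.trans_lt hma))
  have h2 : HasDerivAt f 0 m := (hasDerivAt_const m (0 : E)).congr_of_eventuallyEq (by
    filter_upwards [Ioo_mem_nhds hma hmb] with y hy using h0 y hy)
  have h3 := h1.unique h2
  have hfm := h0 m ⟨hma, hmb⟩
  rw [hfm, map_zero, zero_add] at h3
  exact hs.eq_zero (ha.trans hma.le) hfm h3 hx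

/-- The frame applied to a vector, cut off at the point `x`. -/
def broken (F : ℝ → E →L[ℝ] E) (x : ℝ) : E →ₗ[ℝ] (ℝ → E) :=
  LinearMap.pi fun t => if 0 ≤ t ∧ t < x then (F t).toLinearMap else 0

lemma broken_of_lt {x t : ℝ} (ht : 0 ≤ t) (htx : t < x) (v : E) : broken F x v t = F t v := by
  simp [broken, ht, htx]

lemma broken_of_le {x t : ℝ} (htx : x ≤ t) (v : E) : broken F x v t = 0 := by
  simp [broken, not_lt.2 htx]

lemma broken_of_neg {x t : ℝ} (ht : t < 0) (v : E) : broken F x v t = 0 := by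
  simp [broken, not_le.2 ht]

variable (H) in
/-- The map from the form domain to functions. -/
def repS : H.formSpace →ₗ[ℝ] (ℝ → E) := (rep E).comp H.formSpace.subtype

variable (H) in
lemma repS_injective : Function.Injective H.repS := by
  have : CompleteSpace E := FiniteDimensional.complete ℝ E
  rw [← LinearMap.ker_eq_bot, LinearMap.ker_eq_bot']
  exact fun z hz => Subtype.ext (H.rep_injOn z.2 hz)

namespace IsCoercive

/-- Because F(x) v = 0, cutting off at x creates a jump only in the derivative, so the function
stays in the form domain and the form detects just that jump. -/
lemma exists_rep_eq_broken (hH : H.IsCoercive c C) (hF : H.IsFrame lam F G) {x : ℝ} (hx : 0 < x)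
    {v : E} (hv : F x v = 0) : ∃ z : H.formSpace, rep E z.1 = broken F x v ∧
      ∀ φ ∈ H.formSpace, hH.form z.1 φ - lam * inner ℝ (emb E z.1) (emb E φ) =
        inner ℝ (rep E φ x) (G x v) := by
  have : CompleteSpace E := FiniteDimensional.complete ℝ E
  have hs := hF.sol v
  have cd := hs.continuousOn_deriv_fst
  have cf := hs.continuousOn_fst
  set k : ℝ → E := fun t => H.A t (F t v) + G t v with hk
  set f : ℝ → E := fun t => if t ≤ x then F t v else 0 with hf
  have hrange : Ioi (0 : ℝ) ∩ Iic x ⊆ Icc 0 x := fun t ht => ⟨le_of_lt ht.1, ht.2⟩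
  have hmem : ∀ {l : ℝ → E}, ContinuousOn l (Ici 0) → MemLp ((Iic x).indicator l) 2 halfLine := by
    intro l hl
    rw [memLp_indicator_iff_restrict measurableSet_Iic, Measure.restrict_restrict measurableSet_Iic,
      inter_comm, Ioi_inter_Iic]
    have hl' : ContinuousOn l (Icc 0 x) := hl.mono fun t ht => ht.1
    obtain ⟨K, hK⟩ := isCompact_Icc.exists_bound_of_continuousOn hl'
    refine MemLp.of_bound ((hl'.mono Ioc_subset_Icc_self).aestronglyMeasurable measurableSet_Ioc) K ?_
    filter_upwards [ae_restrict_mem measurableSet_Ioc] with t ht using hK t ⟨ht.1.le, ht.2⟩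
  have hprim : ∀ t, 0 ≤ t → F t v = F 0 v + ∫ s in (0 : ℝ)..t, k s := fun t ht =>
    primitive_of_hasDerivWithinAt (LocInt.of_continuousOn cd) (fun x hx => (hs x hx).1) ht
  obtain ⟨z, hz, hzh, hzJ, hzr⟩ := H.exists_mem_formSpace (f := f) (h' := (Iic x).indicator k)
    (by simp only [hf, hx.le, if_true]; exact (hF.bc v).1) (hmem cd)
    (by
      refine (hmem (l := fun t => √(1 + t) • F t v) ?_).ae_eq ?_
      · exact ContinuousOn.smul (by fun_prop) cf
      · refine Filter.Eventually.of_forall fun t => ?_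
        by_cases ht : t ≤ x <;> simp [hf, ht, indicator])
    (by
      intro t ht
      simp only [hf, hx.le, if_true]
      by_cases htx : t ≤ x
      · rw [if_pos htx, hprim t ht]
        congr 1
        apply intervalIntegral.integral_congr
        intro s hs
        rw [uIcc_of_le ht] at hs
        exact (indicator_of_mem (show s ∈ Iic x from hs.2.trans htx) k).symm
      · rw [if_neg htx, ← hv, hprim x hx.le]
        congr 1
        exact (intervalIntegral.integral_indicator (f := k) (μ := volume)
          ⟨hx.le, (not_le.1 htx).le⟩).symm)
  refine ⟨⟨z, hz⟩, ?_, fun φ hφ => ?_⟩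
  · funext t
    rcases lt_or_ge t 0 with ht | ht
    · rw [rep_of_neg ht, broken_of_neg ht]
    · simp only
      rw [hzr t ht]
      simp only [hf]
      rcases lt_trichotomy t x with h | h | h
      · rw [broken_of_lt ht h, if_pos h.le]
      · rw [if_pos h.le, broken_of_le h.ge, h, hv]
      · rw [broken_of_le h.le, if_neg (not_le.2 h)]
  · refine hH.form_sub_eq_of_eq_zero hs (hF.bc v) hφ hx.le ?_ ?_ ?_
    · rw [hzr 0 le_rfl]; simp [hf, hx.le]
    · filter_upwards [hzh, hzJ] with t h1 h2 ht
      rw [h1, h2, indicator_of_mem (show t ∈ Iic x from ht)]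
      simp [hf, ht, hk]
    · filter_upwards [hzh, hzJ] with t h1 h2 ht
      rw [h1, h2, indicator_of_notMem (show t ∉ Iic x from not_le.2 ht)]
      simp [hf, not_le.2 ht]

/-- The isotropic subspace of broken solutions. -/
lemma exists_broken (hH : H.IsCoercive c C) (hF : H.IsFrame lam F G) {s : Finset ℝ}
    (hs : ∀ x ∈ s, 0 < x) :
    ∃ b : ((x : s) → LinearMap.ker (F x).toLinearMap) →ₗ[ℝ] H.formSpace,
      Function.Injective b ∧ (∀ v, hH.form (b v).1 (b v).1 = lam * ‖emb E (b v).1‖ ^ 2) ∧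
      ∃ T, 0 ≤ T ∧ ∀ v, ∀ x, T ≤ x → rep E (b v).1 x = 0 := by
  classical
  have : CompleteSpace E := FiniteDimensional.complete ℝ E
  let K := (x : s) → LinearMap.ker (F x).toLinearMap
  let T : K →ₗ[ℝ] (ℝ → E) := ∑ x : s, (broken F x).comp
    ((LinearMap.ker (F x).toLinearMap).subtype.comp (LinearMap.proj x))
  have hT : ∀ v t, T v t = ∑ x : s, broken F x (v x) t := fun v t => by
    rw [LinearMap.sum_apply, Finset.sum_apply]; rfl
  have hker : ∀ (v : K) (x : s), F x (v x) = 0 := fun v x => (v x).2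
  choose z hz hzφ using fun (v : K) (x : s) =>
    hH.exists_rep_eq_broken hF (hs x x.2) (hker v x)
  have hTr : ∀ v, T v ∈ LinearMap.range H.repS := by
    intro v
    refine ⟨∑ x : s, z v x, ?_⟩
    rw [map_sum]
    funext t
    rw [hT, Finset.sum_apply]
    exact Finset.sum_congr rfl fun x _ => congrFun (hz v x) t
  -- The chosen elements z need not depend linearly on v by construction; linearity is obtained by
  -- inverting the injective map from the form domain to functions.
  let b : K →ₗ[ℝ] H.formSpace := (LinearEquiv.ofInjective H.repS H.repS_injective).symm.toLinearMap
    ∘ₗ T.codRestrict _ hTr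
  have hb : ∀ v, H.repS (b v) = T v := by
    intro v
    have := congrArg Subtype.val
      ((LinearEquiv.ofInjective H.repS H.repS_injective).apply_symm_apply (T.codRestrict _ hTr v))
    exact this
  have hbz : ∀ v, b v = ∑ x : s, z v x := by
    intro v
    apply H.repS_injective
    rw [hb, map_sum]
    funext t
    rw [hT, Finset.sum_apply]
    exact Finset.sum_congr rfl fun x _ => (congrFun (hz v x) t).symm
  refine ⟨b, ?_, ?_, ?_⟩
  · rw [← LinearMap.ker_eq_bot, LinearMap.ker_eq_bot']
    intro v hv
    have h0 : ∀ t, ∑ x : s, broken F x (v x) t = 0 := fun t => by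
      rw [← hT, ← hb, hv, map_zero]; rfl
    by_contra hne
    obtain ⟨x₀, hx₀⟩ := Function.ne_iff.1 hne
    have hfil : (Finset.univ.filter fun x : s => v x ≠ 0).Nonempty := ⟨x₀, by simpa using hx₀⟩
    -- At the largest point x with nonzero component, and between its predecessor a and x, only the
    -- summand of x is alive. A vanishing sum would make that solution zero on an interval, hence
    -- everywhere.
    obtain ⟨x, hx, hmax⟩ := Finset.exists_max_image _ (fun x : s => (x : ℝ)) hfil
    rw [Finset.mem_filter] at hx
    obtain ⟨a, ha0, hax, ha⟩ : ∃ a : ℝ, 0 ≤ a ∧ a < x ∧ ∀ y : s, (y : ℝ) < x → (y : ℝ) ≤ a := by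
      rcases (Finset.univ.filter fun y : s => (y : ℝ) < x).eq_empty_or_nonempty with he | hne
      · refine ⟨0, le_rfl, hs x x.2, fun y hy => ?_⟩
        have : y ∈ (Finset.univ.filter fun y : s => (y : ℝ) < x) := by simpa using hy
        rw [he] at this
        exact absurd this (Finset.notMem_empty _)
      · obtain ⟨y, hy, hym⟩ := Finset.exists_max_image _ (fun y : s => (y : ℝ)) hne
        rw [Finset.mem_filter] at hy
        exact ⟨y, (hs y y.2).le, hy.2, fun w hw => hym w (by simpa using hw)⟩
    have hzero : ∀ t ∈ Ioo a (x : ℝ), F t (v x) = 0 := by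
      intro t ht
      have h1 := h0 t
      rw [Finset.sum_eq_single x] at h1
      · rwa [broken_of_lt (ha0.trans ht.1.le) ht.2] at h1
      · intro y _ hyx
        rcases lt_trichotomy (y : ℝ) x with h | h | h
        · exact broken_of_le ((ha y h).trans ht.1.le) _
        · exact absurd (Subtype.ext h) hyx
        · have : v y = 0 := by
            by_contra hvy
            exact absurd (hmax y (by simpa using hvy)) (not_le.2 h)
          rw [this, Submodule.coe_zero, map_zero]; rfl
      · simp
    have h2 := Sol.eq_zero_of_eqOn (hF.sol (v x)) ha0 hax hzero le_rfl
    exact hx.2 (Subtype.ext (hF.inj _ h2.1 h2.2))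
  · intro v
    have h1 : hH.form (b v).1 (b v).1 - lam * inner ℝ (emb E (b v).1) (emb E (b v).1) =
        ∑ x : s, inner ℝ (rep E (b v).1 x) (G x (v x)) := by
      have h2 : ∀ φ : H.formSpace, hH.form (b v).1 φ.1 - lam * inner ℝ (emb E (b v).1) (emb E φ.1) =
          ∑ x : s, inner ℝ (rep E φ.1 x) (G x (v x)) := by
        intro φ
        have h3 : (b v).1 = ∑ x : s, (z v x).1 := by rw [hbz]; simp
        rw [h3, map_sum, map_sum, LinearMap.sum_apply, sum_inner, Finset.mul_sum,
          ← Finset.sum_sub_distrib]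
        exact Finset.sum_congr rfl fun x _ => hzφ v x φ.1 φ.2
      exact h2 (b v)
    -- Summands truncated at or before x vanish at x. For y > x the term is ⟨F(x) v_y, G(x) v_x⟩ =
    -- ⟨G(x) v_y, F(x) v_x⟩ = 0 by the conjoined property.
    have h4 : ∀ x : s, inner ℝ (rep E (b v).1 x) (G x (v x)) = 0 := by
      intro x
      have h5 : rep E (b v).1 x = ∑ y : s, broken F y (v y) x := by
        rw [← hT, ← hb]; rfl
      rw [h5, sum_inner]
      refine Finset.sum_eq_zero fun y _ => ?_
      rcases lt_or_ge (x : ℝ) y with h | h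
      · rw [broken_of_lt (hs x x.2).le h, hF.symm (hs x x.2).le, hker, inner_zero_right]
      · rw [broken_of_le h, inner_zero_left]
    rw [Finset.sum_eq_zero fun x _ => h4 x, real_inner_self_eq_norm_sq] at h1
    linarith
  · obtain ⟨R, hR⟩ := s.finite_toSet.bddAbove
    refine ⟨max R 0, le_max_right _ _, fun v x hx => ?_⟩
    have h5 : rep E (b v).1 x = ∑ y : s, broken F y (v y) x := by
      rw [← hT, ← hb]; rfl
    rw [h5]
    exact Finset.sum_eq_zero fun y _ =>
      broken_of_le ((hR y.2).trans ((le_max_left _ _).trans hx)) _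

/-- The number of focal points is bounded. -/
lemma exists_sum_finrank_ker_le (hH : H.IsCoercive c C) (hF : H.IsFrame lam F G) :
    ∃ n : ℕ, ∀ s : Finset ℝ, (∀ x ∈ s, 0 < x) →
      ∑ x ∈ s, Module.finrank ℝ (LinearMap.ker (F x).toLinearMap) ≤ n := by
  obtain ⟨n, hn⟩ := hH.exists_finrank_le lam
  refine ⟨n, fun s hs => ?_⟩
  obtain ⟨b, hb, hiso, -⟩ := hH.exists_broken hF hs
  have h1 := (hn (LinearMap.range b) (by rintro _ ⟨v, rfl⟩; exact (hiso v).le)).2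
  rwa [LinearMap.finrank_range_of_inj hb, Module.finrank_pi_fintype,
    Finset.sum_coe_sort s (fun x => Module.finrank ℝ (LinearMap.ker (F x).toLinearMap))] at h1

variable (H) in
/-- The embedding of the form domain into `L²`. -/
def embS : H.formSpace →L[ℝ] HalfL2 E := (emb E).comp H.formSpace.subtypeL

/-- The form on the form domain. -/
def formS (hH : H.IsCoercive c C) : LinearMap.BilinForm ℝ H.formSpace :=
  hH.form.compl₁₂ H.formSpace.subtype H.formSpace.subtype

lemma exists_eigenvector (hH : H.IsCoercive c C) {t : Finset ℝ} {z : H.formSpace}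
    (hz : ∀ μ ∈ t, ∀ e ∈ hH.eigenspace μ, inner ℝ (embS H z) (embS H e) = 0) (hzJ : embS H z ≠ 0)
    (hqz : hH.formS z z ≤ lam * ‖embS H z‖ ^ 2) :
    ∃ u : H.formSpace, ∃ κ ≤ lam, embS H u ≠ 0 ∧ u ∈ hH.eigenspace κ ∧
      (∀ μ ∈ t, ∀ e ∈ hH.eigenspace μ, inner ℝ (embS H u) (embS H e) = 0) ∧ (κ = lam → u = z) := by
  have : CompleteSpace E := FiniteDimensional.complete ℝ E
  have hcl : IsClosed (H.formSpace : Set (Triple E)) := H.isClosed_formSpace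
  have : CompleteSpace H.formSpace := hcl.completeSpace_coe
  have h1 : ∀ u v, hH.formS u v = hH.formS v u := fun u v => hH.form_symm u.1 v.1
  have h2 : Continuous fun u => hH.formS u u :=
    (hH.continuous_form_self).comp continuous_subtype_val
  have h3 := exists_isCompact_of_forall_norm_le (E := E) (J := embS H)
    fun ε hε => H.exists_norm_emb_le hε
  have h4 : ∀ u : H.formSpace, min (1 / 2) c * ‖u‖ ^ 2 ≤ hH.formS u u + C * ‖embS H u‖ ^ 2 :=
    fun u => hH.coercive u.1
  have h5 : ∀ μ, ∀ e ∈ hH.eigenspace μ, ∀ v, hH.formS e v = μ * inner ℝ (embS H e) (embS H v) :=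
    fun μ e he v => he v.1 v.2
  have h6 : 0 < min (1 / 2) c := lt_min (by norm_num) hH.pos
  obtain ⟨u, huM, κ, hκ, huJ, hu, hulam⟩ := @exists_eigenvector_of_orthogonalTo
    H.formSpace (HalfL2 E) _ _ _ _ _ hH.formS h1 h2 (embS H) h3 _ _ h6 h4 t hH.eigenspace _ h5 z
    hz hzJ lam hqz
  have hmem : u ∈ hH.eigenspace κ := by
    intro w hw
    have h8 : hH.formS u ⟨w, hw⟩ = κ * inner ℝ (embS H u) (embS H ⟨w, hw⟩) := hu ⟨w, hw⟩
    exact h8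
  exact ⟨u, κ, hκ, huJ, hmem, huM, hulam⟩

/-- If the isotropic space were larger than the sum of the eigenspaces below lam, it would contain z
≠ 0 orthogonal to all of them, and a further eigenvector u with eigenvalue κ ≤ lam would exist. For
κ < lam, u would be orthogonal to itself. For κ = lam, u = z vanishes beyond T, against uniqueness
for the ODE. The second case explains why only eigenvalues strictly below lam are counted. -/
lemma sum_finrank_ker_le (hH : H.IsCoercive c C) (hF : H.IsFrame lam F G) {s : Finset ℝ}
    (hs : ∀ x ∈ s, 0 < x) {t : Finset ℝ}
    (ht' : ∀ μ < lam, μ ∉ t → hH.eigenspace μ = ⊥) :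
    ∑ x ∈ s, Module.finrank ℝ (LinearMap.ker (F x).toLinearMap) ≤
      ∑ μ ∈ t, Module.finrank ℝ (hH.eigenspace μ) := by
  have : CompleteSpace E := FiniteDimensional.complete ℝ E
  obtain ⟨b, hb, hiso, T, hT0, hT⟩ := hH.exists_broken hF hs
  by_contra! hlt
  obtain ⟨v, hv0, hvo⟩ := exists_ne_zero_forall_inner_eq_zero
    (K := (x : s) → LinearMap.ker (F x).toLinearMap) (V := H.formSpace) (embS H)
    (fun μ : t => hH.eigenspace μ) b (by
      rw [Module.finrank_pi_fintype,
        Finset.sum_coe_sort s (fun x => Module.finrank ℝ (LinearMap.ker (F x).toLinearMap)),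
        Finset.sum_coe_sort t (fun μ => Module.finrank ℝ (hH.eigenspace μ))]
      exact hlt)
  set z := b v with hz
  have hz0 : z ≠ 0 := fun h => hv0 (hb (by rw [← hz, h, map_zero]))
  have hzJ : embS H z ≠ 0 := fun h => hz0 (Subtype.ext (hH.eq_zero_of_form_le (hiso v).le h))
  obtain ⟨u, κ, hκ, huJ, hu, huM, hulam⟩ := hH.exists_eigenvector (fun μ hμ => hvo ⟨μ, hμ⟩) hzJ (hiso v).le
  have hu0 : u ≠ 0 := fun h => huJ (by rw [h, map_zero])
  rcases hκ.lt_or_eq with hlt' | heq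
  · by_cases hκt : κ ∈ t
    · exact huJ (inner_self_eq_zero (𝕜 := ℝ).1 (huM κ hκt u hu))
    · rw [ht' κ hlt' hκt] at hu
      exact hu0 ((Submodule.mem_bot ℝ).1 hu)
  · have huz := hulam heq
    obtain ⟨g, hg, -⟩ := hH.exists_sol_of_form_eq u.2 hu
    have h3 := fun x hx => (Sol.eq_zero_of_eqOn hg hT0 (by linarith : T < T + 1)
      (fun x hx => by rw [huz]; exact hT v x hx.1.le) (x := x) hx).1
    refine hu0 (Subtype.ext (H.rep_injOn u.2 (funext fun x => ?_)))
    rcases lt_or_ge x 0 with hx | hx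
    · exact rep_of_neg hx _
    · exact h3 x hx

/-- **Oscillation theorem**: the number of focal points of a frame is the number of eigenvalues
below the spectral parameter, with multiplicities. -/
theorem exists_sum_finrank_eq (hH : H.IsCoercive c C) (hF : H.IsFrame lam F G) :
    ∃ X t : Finset ℝ, (∀ x ∈ X, 0 < x) ∧ (∀ μ ∈ t, μ < lam) ∧
      (∀ x, 0 < x → x ∉ X → LinearMap.ker (F x).toLinearMap = ⊥) ∧
      (∀ μ < lam, μ ∉ t → hH.eigenspace μ = ⊥) ∧
      ∑ x ∈ X, Module.finrank ℝ (LinearMap.ker (F x).toLinearMap) =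
        ∑ μ ∈ t, Module.finrank ℝ (hH.eigenspace μ) := by
  -- If all finite sums of m are bounded, a finite set with maximal sum contains every point where m
  -- is nonzero.
  have key : ∀ (P : ℝ → Prop) (m : ℝ → ℕ) (n : ℕ),
      (∀ s : Finset ℝ, (∀ x ∈ s, P x) → ∑ x ∈ s, m x ≤ n) →
      ∃ s : Finset ℝ, (∀ x ∈ s, P x) ∧ ∀ x, P x → x ∉ s → m x = 0 := by
    intro P m n hn
    have hex : ∃ k, ∃ s : Finset ℝ, (∀ x ∈ s, P x) ∧ ∑ x ∈ s, m x = k := ⟨0, ∅, by simp, rfl⟩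
    have hbd : ∀ k, (∃ s : Finset ℝ, (∀ x ∈ s, P x) ∧ ∑ x ∈ s, m x = k) → k ≤ n := by
      rintro k ⟨s, hs, rfl⟩; exact hn s hs
    classical
    obtain ⟨s, hs, hsm⟩ := Nat.findGreatest_spec (P := fun k => ∃ s : Finset ℝ,
      (∀ x ∈ s, P x) ∧ ∑ x ∈ s, m x = k) (Nat.zero_le n) ⟨∅, by simp, rfl⟩
    refine ⟨s, hs, fun x hx hxs => ?_⟩
    have h1 : ∃ s' : Finset ℝ, (∀ x ∈ s', P x) ∧ ∑ x ∈ s', m x = m x + ∑ x ∈ s, m x :=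
      ⟨insert x s, by
        intro y hy
        rcases Finset.mem_insert.1 hy with rfl | hy
        · exact hx
        · exact hs y hy, Finset.sum_insert hxs⟩
    have h2 := Nat.le_findGreatest (P := fun k => ∃ s : Finset ℝ,
      (∀ x ∈ s, P x) ∧ ∑ x ∈ s, m x = k) (hbd _ h1) h1
    rw [← hsm] at h2
    omega
  obtain ⟨n, hn⟩ := hH.exists_sum_finrank_ker_le hF
  obtain ⟨X, hX0, hX⟩ := key (fun x => 0 < x) _ n hn
  have hXker : ∀ x, 0 < x → x ∉ X → LinearMap.ker (F x).toLinearMap = ⊥ := fun x hx hxX =>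
    Submodule.finrank_eq_zero.1 (hX x hx hxX)
  have hXu : ∀ x, 0 < x → x ∉ X → IsUnit (F x) := fun x hx hxX => by
    have h1 := hXker x hx hxX
    have h2 : IsUnit (F x).toLinearMap := (LinearMap.isUnit_iff_ker_eq_bot _).2 h1
    have h3 := h2.map (Module.End.toContinuousLinearMap (𝕜 := ℝ) E)
    have h4 : F x = Module.End.toContinuousLinearMap (𝕜 := ℝ) E (F x).toLinearMap := by
      ext v; rfl
    rw [h4]
    exact h3
  obtain ⟨t, ht, ht0⟩ := key (fun μ => μ < lam) (fun μ => Module.finrank ℝ (hH.eigenspace μ)) _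
    fun t ht => hH.sum_finrank_eigenspace_le hF hX0 hXu ht
  have ht' : ∀ μ < lam, μ ∉ t → hH.eigenspace μ = ⊥ := fun μ hμ hμt =>
    Submodule.finrank_eq_zero.1 (ht0 μ hμ hμt)
  exact ⟨X, t, hX0, ht, hXker, ht', le_antisymm (hH.sum_finrank_ker_le hF hX0 ht')
    (hH.sum_finrank_eigenspace_le hF hX0 hXu ht)⟩

end IsCoercive

end Hamiltonian

end StochasticAiry

namespace StochasticAiry

/-! ### The scalars as a real inner product space -/

section Scalars

variable {𝔽 : Type*} [NormedDivisionRing 𝔽] [StarRing 𝔽] [InnerProductSpace ℝ 𝔽]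
  [IsClassicalField 𝔽]

namespace IsClassicalField

/-- Real linearity and isometry of the involution are not part of the class; they are derived from
this formula. -/
lemma star_eq (x : 𝔽) : star x = (‖x‖ ^ 2 : ℝ) • x⁻¹ := by
  rcases eq_or_ne x 0 with rfl | hx
  · simp
  · have h := IsClassicalField.star_mul_self x
    calc star x = star x * x * x⁻¹ := by rw [mul_assoc, mul_inv_cancel₀ hx, mul_one]
      _ = _ := by rw [h, smul_mul_assoc, one_mul]

lemma inv_smul' (c : ℝ) (x : 𝔽) : (c • x)⁻¹ = c⁻¹ • x⁻¹ := by
  rcases eq_or_ne c 0 with rfl | hc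
  · simp
  rcases eq_or_ne x 0 with rfl | hx
  · simp
  refine inv_eq_of_mul_eq_one_right ?_
  rw [smul_mul_smul_comm, mul_inv_cancel₀ hc, mul_inv_cancel₀ hx, one_smul]

lemma star_smul_real (c : ℝ) (x : 𝔽) : star (c • x) = c • star x := by
  rcases eq_or_ne c 0 with rfl | hc
  · simp
  rw [star_eq, star_eq, norm_smul, inv_smul', mul_pow, Real.norm_eq_abs, sq_abs, smul_smul,
    smul_smul]
  congr 1
  field_simp

lemma norm_star_eq (x : 𝔽) : ‖star x‖ = ‖x‖ := by
  rcases eq_or_ne x 0 with rfl | hx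
  · simp
  rw [star_eq, norm_smul, norm_inv, Real.norm_eq_abs, abs_of_nonneg (by positivity)]
  have := norm_ne_zero_iff.2 hx
  field_simp

lemma star_mul_add_star_mul (a b : 𝔽) :
    star a * b + star b * a = (2 * inner ℝ a b : ℝ) • (1 : 𝔽) := by
  have h := IsClassicalField.star_mul_self (a + b)
  rw [norm_add_sq_real, star_add, add_mul, mul_add, mul_add, IsClassicalField.star_mul_self,
    IsClassicalField.star_mul_self, add_smul, add_smul] at h
  have h2 : (‖a‖ ^ 2 : ℝ) • (1 : 𝔽) + (star a * b + star b * a) + (‖b‖ ^ 2 : ℝ) • (1 : 𝔽) =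
      (‖a‖ ^ 2 : ℝ) • (1 : 𝔽) + (2 * inner ℝ a b : ℝ) • (1 : 𝔽) + (‖b‖ ^ 2 : ℝ) • (1 : 𝔽) := by
    rw [← h]; abel
  exact add_left_cancel (add_right_cancel h2)

lemma inner_star_star (a b : 𝔽) : inner ℝ (star a) (star b) = inner ℝ a b := by
  have h1 := norm_add_sq_real a b
  have h2 := norm_add_sq_real (star a) (star b)
  rw [← star_add, norm_star_eq, norm_star_eq, norm_star_eq] at h2
  linarith

lemma inner_one_star (x : 𝔽) : inner ℝ (1 : 𝔽) (star x) = inner ℝ (1 : 𝔽) x := by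
  have := inner_star_star (1 : 𝔽) x
  rwa [star_one] at this

/-- The real inner product is the real part of star a * b. This lets adjoints of matrices over 𝔽 be
treated as adjoints of real operators. -/
lemma inner_one_star_mul (a b : 𝔽) : inner ℝ (1 : 𝔽) (star a * b) = inner ℝ a b := by
  have h := congrArg (inner ℝ (1 : 𝔽)) (star_mul_add_star_mul a b)
  have h2 : inner ℝ (1 : 𝔽) (star b * a) = inner ℝ (1 : 𝔽) (star a * b) := by
    rw [← inner_one_star (star b * a), star_mul, star_star]
  rw [inner_add_right, h2, real_inner_smul_right, real_inner_self_eq_norm_sq, norm_one] at h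
  linarith

lemma continuous_star : Continuous (star : 𝔽 → 𝔽) :=
  AddMonoidHomClass.continuous_of_bound (starAddEquiv : 𝔽 ≃+ 𝔽) 1
    fun x => by rw [one_mul]; exact (norm_star_eq x).le

instance : FiniteDimensional ℝ 𝔽 := IsClassicalField.toFinite

instance : IsStablyFiniteRing 𝔽 := inferInstance

end IsClassicalField

end Scalars

/-! ### Vectors and matrices -/

section Vectors

variable {r : ℕ} {𝔽 : Type*} [NormedDivisionRing 𝔽] [StarRing 𝔽] [InnerProductSpace ℝ 𝔽]
  [IsClassicalField 𝔽]

/-- The column vectors as a Euclidean space. -/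
abbrev Vec (r : ℕ) (𝔽 : Type*) := PiLp 2 (fun _ : Fin r => 𝔽)

/-- The identification of column vectors with the Euclidean space. -/
def toVec (r : ℕ) (𝔽 : Type*) [NormedDivisionRing 𝔽] [InnerProductSpace ℝ 𝔽] :
    (Fin r → 𝔽) ≃L[ℝ] Vec r 𝔽 :=
  (PiLp.continuousLinearEquiv 2 ℝ (fun _ : Fin r => 𝔽)).symm

lemma inner_toVec (u v : Fin r → 𝔽) :
    inner ℝ (toVec r 𝔽 u) (toVec r 𝔽 v) = inner ℝ (1 : 𝔽) (star u ⬝ᵥ v) := by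
  rw [PiLp.inner_apply, dotProduct, inner_sum]
  exact Finset.sum_congr rfl fun i _ => (IsClassicalField.inner_one_star_mul _ _).symm

lemma norm_vec_le_sum (v : Vec r 𝔽) : ‖v‖ ≤ ∑ i, ‖v i‖ := by
  have h0 : 0 ≤ ∑ i, ‖v i‖ := Finset.sum_nonneg fun _ _ => norm_nonneg _
  refine (sq_le_sq₀ (norm_nonneg _) h0).1 ?_
  rw [PiLp.norm_sq_eq_of_L2]
  exact Finset.sum_sq_le_sq_sum_of_nonneg fun _ _ => norm_nonneg _

/-- The action of a matrix on column vectors. -/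
def opL (M : Matrix (Fin r) (Fin r) 𝔽) : Vec r 𝔽 →L[ℝ] Vec r 𝔽 :=
  LinearMap.toContinuousLinearMap
    { toFun := fun v => toVec r 𝔽 (M *ᵥ (toVec r 𝔽).symm v)
      map_add' := fun v w => by rw [map_add, mulVec_add, map_add]
      map_smul' := fun c v => by
        rw [map_smul, mulVec_smul, map_smul, RingHom.id_apply] }

lemma opL_apply (M : Matrix (Fin r) (Fin r) 𝔽) (v : Vec r 𝔽) :
    opL M v = toVec r 𝔽 (M *ᵥ (toVec r 𝔽).symm v) := rfl

lemma opL_toVec (M : Matrix (Fin r) (Fin r) 𝔽) (v : Fin r → 𝔽) :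
    opL M (toVec r 𝔽 v) = toVec r 𝔽 (M *ᵥ v) := rfl

lemma opL_add (M N : Matrix (Fin r) (Fin r) 𝔽) : opL (M + N) = opL M + opL N := by
  ext1 v
  rw [_root_.add_apply, opL_apply, opL_apply, opL_apply, add_mulVec, map_add]

lemma opL_sub (M N : Matrix (Fin r) (Fin r) 𝔽) : opL (M - N) = opL M - opL N := by
  ext1 v
  rw [_root_.sub_apply, opL_apply, opL_apply, opL_apply, sub_mulVec, map_sub]

lemma opL_smul (c : ℝ) (M : Matrix (Fin r) (Fin r) 𝔽) : opL (c • M) = c • opL M := by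
  ext1 v
  rw [_root_.smul_apply, opL_apply, opL_apply, smul_mulVec, map_smul]

lemma opL_one : opL (1 : Matrix (Fin r) (Fin r) 𝔽) = ContinuousLinearMap.id ℝ _ := by
  ext1 v
  rw [opL_apply, one_mulVec]; simp

lemma opL_mul (M N : Matrix (Fin r) (Fin r) 𝔽) (v : Vec r 𝔽) :
    opL (M * N) v = opL M (opL N v) := by
  rw [opL_apply, opL_apply, opL_apply, ContinuousLinearEquiv.symm_apply_apply, mulVec_mulVec]

lemma norm_opL_le (M : Matrix (Fin r) (Fin r) 𝔽) : ‖opL M‖ ≤ ∑ i, ∑ j, ‖M i j‖ := by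
  refine ContinuousLinearMap.opNorm_le_bound _
    (Finset.sum_nonneg fun _ _ => Finset.sum_nonneg fun _ _ => norm_nonneg _) fun v => ?_
  refine (norm_vec_le_sum (opL M v)).trans ?_
  rw [Finset.sum_mul]
  refine Finset.sum_le_sum fun i _ => ?_
  rw [Finset.sum_mul]
  refine (norm_sum_le Finset.univ fun j => M i j * v j).trans (Finset.sum_le_sum fun j _ => ?_)
  rw [norm_mul]
  exact mul_le_mul_of_nonneg_left (PiLp.norm_apply_le v j) (norm_nonneg _)

lemma continuous_opL {b : ℝ → Matrix (Fin r) (Fin r) 𝔽} (hb : Continuous b) :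
    Continuous fun x => opL (b x) := by
  rw [continuous_clm_apply]
  intro v
  exact (toVec r 𝔽).continuous.comp (hb.matrix_mulVec continuous_const)

lemma inner_opL_left (M : Matrix (Fin r) (Fin r) 𝔽) (u v : Vec r 𝔽) :
    inner ℝ (opL M u) v = inner ℝ u (opL Mᴴ v) := by
  obtain ⟨u, rfl⟩ := (toVec r 𝔽).surjective u
  obtain ⟨v, rfl⟩ := (toVec r 𝔽).surjective v
  rw [opL_toVec, opL_toVec, inner_toVec, inner_toVec, star_mulVec, dotProduct_mulVec]

lemma inner_opL_of_isHermitian {M : Matrix (Fin r) (Fin r) 𝔽} (hM : M.IsHermitian)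
    (u v : Vec r 𝔽) : inner ℝ (opL M u) v = inner ℝ u (opL M v) := by
  rw [inner_opL_left, hM.eq]

end Vectors

/-! ### The boundary matrices -/

namespace ExtSelfAdjoint

variable {r : ℕ} {𝔽 : Type*} [NormedDivisionRing 𝔽] [StarRing 𝔽] [InnerProductSpace ℝ 𝔽]
  [IsClassicalField 𝔽] (W : ExtSelfAdjoint r 𝔽)

lemma mul_conjTranspose : W.U * W.Uᴴ = 1 := mul_eq_one_comm.1 W.orthonormal

lemma spectralSum_mul (d e : Fin r → ℝ) :
    W.spectralSum d * W.spectralSum e = W.spectralSum (fun i => d i * e i) := by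
  unfold spectralSum
  calc _ = W.U * diagonal (fun i => d i • (1 : 𝔽)) * (W.Uᴴ * W.U) *
        diagonal (fun i => e i • (1 : 𝔽)) * W.Uᴴ := by simp only [Matrix.mul_assoc]
    _ = _ := by
        rw [W.orthonormal, Matrix.mul_one, Matrix.mul_assoc W.U, diagonal_mul_diagonal]
        simp only [smul_mul_smul_comm, mul_one]

lemma spectralSum_add (d e : Fin r → ℝ) :
    W.spectralSum d + W.spectralSum e = W.spectralSum (fun i => d i + e i) := by
  unfold spectralSum
  rw [← Matrix.add_mul, ← Matrix.mul_add, diagonal_add]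
  simp only [add_smul]

lemma spectralSum_one : W.spectralSum (fun _ => 1) = 1 := by
  unfold spectralSum
  simp only [one_smul, diagonal_one, Matrix.mul_one, mul_conjTranspose]

lemma isHermitian_spectralSum (d : Fin r → ℝ) : (W.spectralSum d).IsHermitian := by
  unfold spectralSum Matrix.IsHermitian
  rw [conjTranspose_mul, conjTranspose_mul, conjTranspose_conjTranspose, diagonal_conjTranspose,
    Matrix.mul_assoc]
  congr 3
  funext i
  rw [Pi.star_apply, IsClassicalField.star_smul_real, star_one]

lemma tildeI_mul_self : W.tildeI * W.tildeI = W.tildeI := by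
  unfold tildeI
  rw [spectralSum_mul]
  congr 1; funext i; split_ifs <;> simp

lemma tildeI_mul_finitePart : W.tildeI * W.finitePart = W.finitePart := by
  unfold tildeI finitePart
  rw [spectralSum_mul]
  congr 1; funext i; split_ifs with h <;> simp [h]

lemma finitePart_mul_tildeI : W.finitePart * W.tildeI = W.finitePart := by
  unfold tildeI finitePart
  rw [spectralSum_mul]
  congr 1; funext i; split_ifs with h <;> simp [h]

/-- Compared on eigenvalues: both sides give w + 1 for finite w and 1 for w = ∞. The relation
reduces the algebra of the boundary matrices to the projection `tildeI` and the finite part. -/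
lemma tildeW_add_tildeI : W.tildeW + W.tildeI = W.finitePart + 1 := by
  rw [← W.spectralSum_one]
  unfold tildeI finitePart tildeW
  rw [spectralSum_add, spectralSum_add]
  congr 1; funext i
  split_ifs with h
  · simp [h]
  · lift W.w i to ℝ using h with a
    simp

lemma tildeI_mul_tildeW : W.tildeI * W.tildeW = W.finitePart := by
  have h : W.tildeW = W.finitePart + 1 - W.tildeI := by rw [← tildeW_add_tildeI]; abel
  rw [h, Matrix.mul_sub, Matrix.mul_add, tildeI_mul_self, tildeI_mul_finitePart, Matrix.mul_one]
  abel

lemma tildeW_mul_tildeI : W.tildeW * W.tildeI = W.finitePart := by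
  have h : W.tildeW = W.finitePart + 1 - W.tildeI := by rw [← tildeW_add_tildeI]; abel
  rw [h, Matrix.sub_mul, Matrix.add_mul, tildeI_mul_self, finitePart_mul_tildeI, Matrix.one_mul]
  abel

lemma tildeI_mulVec_eq_self_iff (v : Fin r → 𝔽) :
    W.tildeI *ᵥ v = v ↔ ∀ i, W.w i = ⊤ → (W.Uᴴ *ᵥ v) i = 0 := by
  have h1 : W.Uᴴ *ᵥ (W.tildeI *ᵥ v) = fun i => if W.w i = ⊤ then 0 else (W.Uᴴ *ᵥ v) i := by
    unfold tildeI spectralSum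
    rw [mulVec_mulVec, ← Matrix.mul_assoc, ← Matrix.mul_assoc, W.orthonormal, Matrix.one_mul,
      ← mulVec_mulVec]
    funext i
    rw [mulVec_diagonal]
    by_cases hi : W.w i = ⊤ <;> simp [hi]
  constructor
  · intro h i hi
    have h2 := congrFun h1 i
    rw [h] at h2
    simpa [hi] using h2
  · intro h
    have h2 : W.Uᴴ *ᵥ (W.tildeI *ᵥ v) = W.Uᴴ *ᵥ v := by
      rw [h1]
      funext i
      split_ifs with hi
      · exact (h i hi).symm
      · rfl
    have h3 := congrArg (fun w => W.U *ᵥ w) h2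
    simp only [mulVec_mulVec, ← Matrix.mul_assoc, mul_conjTranspose, Matrix.one_mul,
      one_mulVec] at h3
    exact h3

/-- The boundary condition in terms of the finite part. -/
lemma boundary_iff (f g : Fin r → 𝔽) : -(W.tildeW *ᵥ f) + W.tildeI *ᵥ g = 0 ↔
    W.tildeI *ᵥ f = f ∧ W.tildeI *ᵥ (g - W.finitePart *ᵥ f) = 0 := by
  have hW : W.tildeW *ᵥ f = W.finitePart *ᵥ f + f - W.tildeI *ᵥ f := by
    have h : W.tildeW = W.finitePart + 1 - W.tildeI := by rw [← tildeW_add_tildeI]; abel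
    rw [h, sub_mulVec, add_mulVec, one_mulVec]
  constructor
  · intro h
    have h1 := congrArg (fun v => W.tildeI *ᵥ v) h
    simp only [mulVec_add, mulVec_neg, mulVec_mulVec, tildeI_mul_tildeW, tildeI_mul_self,
      mulVec_zero] at h1
    refine ⟨?_, ?_⟩
    · have h2 : f - W.tildeI *ᵥ f = 0 := by
        have h3 : f - W.tildeI *ᵥ f = (-(W.finitePart *ᵥ f) + W.tildeI *ᵥ g) -
            (-(W.tildeW *ᵥ f) + W.tildeI *ᵥ g) := by rw [hW]; abel
        rw [h3, h, h1, sub_zero]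
      exact (sub_eq_zero.1 h2).symm
    · rw [mulVec_sub, mulVec_mulVec, tildeI_mul_finitePart, ← h1]; abel
  · rintro ⟨h1, h2⟩
    rw [mulVec_sub, mulVec_mulVec, tildeI_mul_finitePart] at h2
    rw [hW, h1, ← h2]; abel

end ExtSelfAdjoint

end StochasticAiry

namespace StochasticAiry

/-! ### Gauge transformations and coercivity -/

namespace Hamiltonian

variable {E : Type*} [NormedAddCommGroup E] [InnerProductSpace ℝ E]

/-- The system `H'` arises from `H` by the change of variables `g ↦ g + S f`. -/
structure IsGauge (H H' : Hamiltonian E) (S S' : ℝ → E →L[ℝ] E) : Prop where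
  deriv : ∀ x, 0 ≤ x → HasDerivWithinAt S (S' x) (Ici 0) x
  A_eq : ∀ x, 0 ≤ x → H.A x = H'.A x + S x
  p_eq : ∀ x, 0 ≤ x → H'.p x = H.p x + S' x
  D_eq : H'.D = H.D
  β_eq : H'.β = H.β + S 0

namespace IsGauge

variable {H H' : Hamiltonian E} {S S' : ℝ → E →L[ℝ] E}

lemma symm (h : H.IsGauge H' S S') : H'.IsGauge H (fun x => -S x) (fun x => -S' x) where
  deriv x hx := (h.deriv x hx).fun_neg
  A_eq x hx := by rw [h.A_eq x hx]; abel
  p_eq x hx := by rw [h.p_eq x hx]; abel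
  D_eq := h.D_eq.symm
  β_eq := by rw [h.β_eq]; abel

lemma sol (h : H.IsGauge H' S S') {μ : ℝ} {f g : ℝ → E} (hs : H.Sol μ f g) :
    H'.Sol μ f (fun x => g x + S x (f x)) := hs.gauge h.deriv h.A_eq h.p_eq

lemma bc (h : H.IsGauge H' S S') {f g : ℝ → E} (hs : H.BC f g) :
    H'.BC f (fun x => g x + S x (f x)) := hs.gauge h.D_eq h.β_eq

lemma isFrame (h : H.IsGauge H' S S') {lam : ℝ} {F G : ℝ → E →L[ℝ] E} (hF : H.IsFrame lam F G) :
    H'.IsFrame lam F (fun x => G x + (S x).comp (F x)) where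
  sol v := h.sol (hF.sol v)
  bc v := h.bc (hF.bc v)
  surj d hd := hF.surj d (h.D_eq ▸ hd)
  inj v h1 h2 := hF.inj v h1 (by
    simpa [h1] using h2)

end IsGauge

lemma inner_integral_comm [CompleteSpace E] {A : ℝ → E →L[ℝ] E} (hA : Continuous A)
    (hs : ∀ x u v, inner ℝ (A x u) v = inner ℝ u (A x v)) (a b : ℝ) (u v : E) :
    inner ℝ ((∫ t in a..b, A t) u) v = inner ℝ u ((∫ t in a..b, A t) v) := by
  have h1 : ∀ w, (∫ t in a..b, A t) w = ∫ t in a..b, A t w := fun w =>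
    (ContinuousLinearMap.intervalIntegral_apply (hA.intervalIntegrable a b) w)
  have hi : ∀ w, IntervalIntegrable (fun t => A t w) volume a b := fun w =>
    (hA.clm_apply continuous_const).intervalIntegrable a b
  have h2 : ∀ e w, inner ℝ e (∫ t in a..b, A t w) = ∫ t in a..b, inner ℝ e (A t w) := fun e w =>
    ((innerSL ℝ e).intervalIntegral_comp_comm (hi w)).symm
  rw [h1, h1, real_inner_comm, h2, h2]
  exact intervalIntegral.integral_congr fun t _ => (real_inner_comm _ _).trans (hs t u v)

/-- If the increments of `A` over unit intervals grow slower than the potential, then the system can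
be transformed into a coercive one. -/
lemma exists_isCoercive_isGauge [CompleteSpace E] (H : Hamiltonian E) {r : ℝ} (hr : 1 ≤ r)
    (hp : ∀ x, H.p x = (r * x) • ContinuousLinearMap.id ℝ E) {C : ℝ}
    (hosc : ∀ x, 0 ≤ x → ∀ t ∈ Icc (0 : ℝ) 1, ‖H.A (x + t) - H.A x‖ ^ 2 ≤ 1 / 10 * x + C) :
    ∃ (H' : Hamiltonian E) (S S' : ℝ → E →L[ℝ] E) (c C' : ℝ), H.IsGauge H' S S' ∧
      H'.IsCoercive c C' := by
  have hC : 0 ≤ C := by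
    have := hosc 0 le_rfl 0 (by simp)
    simpa using this
  set P : ℝ → E →L[ℝ] E := fun x => ∫ t in (0 : ℝ)..x, H.A t with hP
  have hPd : ∀ x, HasDerivAt P (H.A x) x := fun x =>
    intervalIntegral.integral_hasDerivAt_right (H.continuous_A.intervalIntegrable _ _)
      (H.continuous_A.stronglyMeasurableAtFilter _ _) H.continuous_A.continuousAt
  -- The average of A over [x, x + 1]: differentiable although A is only continuous, close to A(x),
  -- and with derivative A(x + 1) - A(x).
  set m : ℝ → E →L[ℝ] E := fun x => P (x + 1) - P x with hm
  have hmd : ∀ x, HasDerivAt m (H.A (x + 1) - H.A x) x := fun x =>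
    ((hPd (x + 1)).comp_add_const x 1).sub (hPd x)
  have hm_eq : ∀ x, m x = ∫ t in x..(x + 1), H.A t := fun x =>
    intervalIntegral.integral_interval_sub_left (H.continuous_A.intervalIntegrable _ _)
      (H.continuous_A.intervalIntegrable _ _)
  have hms : ∀ x u v, inner ℝ (m x u) v = inner ℝ u (m x v) := fun x u v => by
    rw [hm_eq]; exact inner_integral_comm H.continuous_A H.symm_A _ _ u v
  -- The gauge also contains s e^{-x} times the identity. At 0 it lifts the boundary operator above
  -- the identity; afterwards it and its derivative stay bounded by s.
  set s : ℝ := ‖H.β + m 0‖ + 1 with hs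
  have hs0 : 0 ≤ s := by positivity
  set I := ContinuousLinearMap.id ℝ E with hI
  have hI1 : ‖I‖ ≤ 1 := ContinuousLinearMap.norm_id_le
  set S : ℝ → E →L[ℝ] E := fun x => m x + (s * Real.exp (-x)) • I with hS
  set S' : ℝ → E →L[ℝ] E := fun x => (H.A (x + 1) - H.A x) - (s * Real.exp (-x)) • I with hS'
  have hSd : ∀ x, HasDerivAt S (S' x) x := by
    intro x
    have h1 : HasDerivAt (fun x => s * Real.exp (-x)) (-(s * Real.exp (-x))) x := by
      have := ((Real.hasDerivAt_exp (-x)).comp x (hasDerivAt_neg x)).const_mul s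
      refine this.congr_deriv ?_
      ring
    refine ((hmd x).add (h1.smul_const I)).congr_deriv ?_
    rw [hS', neg_smul]
    simp only
    abel
  have hSc : Continuous S := continuous_iff_continuousAt.2 fun x => (hSd x).continuousAt
  have hS'c : Continuous S' := by
    have := H.continuous_A
    rw [hS']
    fun_prop
  have hSs : ∀ x u v, inner ℝ (S x u) v = inner ℝ u (S x v) := fun x u v => by
    simp only [hS, _root_.add_apply, _root_.smul_apply, hI, ContinuousLinearMap.id_apply,
      inner_add_left, inner_add_right, hms, real_inner_smul_left, real_inner_smul_right]
  have hS's : ∀ x u v, inner ℝ (S' x u) v = inner ℝ u (S' x v) := fun x u v => by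
    simp only [hS', _root_.sub_apply, _root_.smul_apply, hI, ContinuousLinearMap.id_apply,
      inner_sub_left, inner_sub_right, H.symm_A, real_inner_smul_left, real_inner_smul_right]
  let H' : Hamiltonian E :=
    { A := fun x => H.A x - S x
      p := fun x => H.p x + S' x
      β := H.β + S 0
      D := H.D
      continuous_A := H.continuous_A.sub hSc
      continuous_p := H.continuous_p.add hS'c
      symm_A := fun x u v => by
        simp only [_root_.sub_apply, inner_sub_left, inner_sub_right, H.symm_A, hSs]
      symm_p := fun x u v => by
        simp only [_root_.add_apply, inner_add_left, inner_add_right, H.symm_p, hS's]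
      symm_β := fun u v => by
        simp only [_root_.add_apply, inner_add_left, inner_add_right, H.symm_β, hSs] }
  have hexp : ∀ x, 0 ≤ x → 0 ≤ s * Real.exp (-x) ∧ s * Real.exp (-x) ≤ s := fun x hx =>
    ⟨by positivity, mul_le_of_le_one_right hs0 (Real.exp_le_one_iff.2 (by linarith))⟩
  have hsmul : ∀ x, 0 ≤ x → ‖(s * Real.exp (-x)) • I‖ ≤ s := fun x hx => by
    rw [norm_smul, Real.norm_eq_abs, abs_of_nonneg (hexp x hx).1]
    calc _ ≤ s * 1 := mul_le_mul (hexp x hx).2 hI1 (norm_nonneg _) hs0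
      _ = s := mul_one s
  have hA' : ∀ x, 0 ≤ x → ‖H'.A x‖ ^ 2 ≤ 2 * (1 / 10 * x + C) + 2 * s ^ 2 := by
    intro x hx
    have h0 : 0 ≤ 1 / 10 * x + C := by positivity
    have h1 : ‖m x - H.A x‖ ≤ √(1 / 10 * x + C) := by
      have h2 : m x - H.A x = ∫ t in x..(x + 1), (H.A t - H.A x) := by
        rw [intervalIntegral.integral_sub (H.continuous_A.intervalIntegrable _ _)
          intervalIntegrable_const, ← hm_eq, intervalIntegral.integral_const]
        simp
      rw [h2]
      refine (intervalIntegral.norm_integral_le_of_norm_le_const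
        (C := √(1 / 10 * x + C)) fun t ht => ?_).trans (by simp)
      rw [uIoc_of_le (by linarith)] at ht
      have h3 := hosc x hx (t - x) ⟨by linarith [ht.1], by linarith [ht.2]⟩
      rw [add_sub_cancel] at h3
      exact Real.le_sqrt_of_sq_le h3
    have h4 : ‖H'.A x‖ ≤ √(1 / 10 * x + C) + s := by
      have : H'.A x = -(m x - H.A x) - (s * Real.exp (-x)) • I := by
        change H.A x - (m x + (s * Real.exp (-x)) • I) = _
        abel
      rw [this]
      refine (norm_sub_le _ _).trans (add_le_add ?_ (hsmul x hx))
      rwa [norm_neg]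
    have h5 : ‖H'.A x‖ ^ 2 ≤ (√(1 / 10 * x + C) + s) ^ 2 := by gcongr
    have h6 := Real.sq_sqrt h0
    nlinarith [sq_nonneg (√(1 / 10 * x + C) - s)]
  have hinc : ∀ x, 0 ≤ x → ‖S' x‖ ≤ 1 + (1 / 10 * x + C) + s := by
    intro x hx
    refine (norm_sub_le _ _).trans (add_le_add ?_ (hsmul x hx))
    have := hosc x hx 1 (by simp)
    nlinarith [sq_nonneg (‖H.A (x + 1) - H.A x‖ - 1), norm_nonneg (H.A (x + 1) - H.A x)]
  -- The potential contributes at least x. Of this, S' costs x/10 and twice ‖A - S‖² costs 4x/10,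
  -- leaving x/2; the remaining losses go into the second constant.
  refine ⟨H', S, S', 1 / 2, 5 * C + 2 + s + 4 * s ^ 2 + r, ?_, ?_⟩
  · exact
      { deriv := fun x _ => (hSd x).hasDerivWithinAt
        A_eq := fun x _ => by change H.A x = H.A x - S x + S x; abel
        p_eq := fun x _ => rfl
        D_eq := rfl
        β_eq := rfl }
  · refine
      { pos := by norm_num
        nonneg := by positivity
        lower := fun x hx v => ?_
        bound_A := fun x hx => (hA' x hx).trans ?_
        bound_p := fun x hx => ?_
        le_β := fun v => ?_ }
    · have e1 : inner ℝ (H'.p x v) v = r * x * ‖v‖ ^ 2 + inner ℝ (S' x v) v := by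
        change inner ℝ ((H.p x + S' x) v) v = _
        rw [hp, _root_.add_apply, inner_add_left, _root_.smul_apply, ContinuousLinearMap.id_apply,
          real_inner_smul_left, real_inner_self_eq_norm_sq]
      have e2 : |inner ℝ (S' x v) v| ≤ (1 + (1 / 10 * x + C) + s) * ‖v‖ ^ 2 := by
        calc _ ≤ ‖S' x v‖ * ‖v‖ := abs_real_inner_le_norm _ _
          _ ≤ (‖S' x‖ * ‖v‖) * ‖v‖ := by gcongr; exact (S' x).le_opNorm v
          _ = ‖S' x‖ * ‖v‖ ^ 2 := by ring
          _ ≤ _ := by gcongr; exact hinc x hx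
      have e3 : ‖H'.A x v‖ ^ 2 ≤ (2 * (1 / 10 * x + C) + 2 * s ^ 2) * ‖v‖ ^ 2 := by
        calc _ ≤ (‖H'.A x‖ * ‖v‖) ^ 2 := by gcongr; exact (H'.A x).le_opNorm v
          _ = ‖H'.A x‖ ^ 2 * ‖v‖ ^ 2 := mul_pow _ _ _
          _ ≤ _ := by gcongr; exact hA' x hx
      have e4 : x * ‖v‖ ^ 2 ≤ r * x * ‖v‖ ^ 2 := by
        rw [mul_assoc]; exact le_mul_of_one_le_left (by positivity) hr
      have e5 : 0 ≤ r * ‖v‖ ^ 2 := by positivity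
      have e6 := sq_nonneg ‖v‖
      rw [abs_le] at e2
      rw [e1]
      nlinarith [e2.1]
    · nlinarith [mul_nonneg hC hx, mul_nonneg hs0 hx, mul_nonneg (sq_nonneg s) hx,
        mul_nonneg (by linarith : 0 ≤ r) hx]
    · change ‖H.p x + S' x‖ ≤ _
      have e1 : ‖H.p x‖ ≤ r * x := by
        rw [hp, norm_smul, Real.norm_eq_abs, abs_of_nonneg (by positivity)]
        exact mul_le_of_le_one_right (by positivity) hI1
      have e2 := norm_add_le (H.p x) (S' x)
      have e3 := hinc x hx
      nlinarith [mul_nonneg hC hx, mul_nonneg hs0 hx, mul_nonneg (sq_nonneg s) hx, sq_nonneg s]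
    · change _ ≤ inner ℝ ((H.β + S 0) v) v
      have e1 : H.β + S 0 = (H.β + m 0) + s • I := by
        simp only [hS, neg_zero, Real.exp_zero, mul_one]; abel
      have e2 : |inner ℝ ((H.β + m 0) v) v| ≤ ‖H.β + m 0‖ * ‖v‖ ^ 2 := by
        calc _ ≤ ‖(H.β + m 0) v‖ * ‖v‖ := abs_real_inner_le_norm _ _
          _ ≤ (‖H.β + m 0‖ * ‖v‖) * ‖v‖ := by gcongr; exact (H.β + m 0).le_opNorm v
          _ = _ := by ring
      rw [e1, _root_.add_apply, inner_add_left, _root_.smul_apply, hI,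
        ContinuousLinearMap.id_apply, real_inner_smul_left, real_inner_self_eq_norm_sq, hs]
      rw [abs_le] at e2
      nlinarith [e2.1]

end Hamiltonian

/-! ### The system of the stochastic Airy operator -/

section Airy

variable {r : ℕ} {𝔽 : Type*} [NormedDivisionRing 𝔽] [StarRing 𝔽] [InnerProductSpace ℝ 𝔽]
  [IsClassicalField 𝔽]

/-- Continuous self-adjoint paths. -/
structure IsNoisePath (b : ℝ → Matrix (Fin r) (Fin r) 𝔽) : Prop where
  continuous : Continuous b
  isHermitian : ∀ x, (b x).IsHermitian

/-- The vectors whose Dirichlet components vanish. -/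
def ExtSelfAdjoint.domain (W : ExtSelfAdjoint r 𝔽) : Submodule ℝ (Vec r 𝔽) :=
  LinearMap.eqLocus (opL W.tildeI).toLinearMap LinearMap.id

lemma ExtSelfAdjoint.mem_domain (W : ExtSelfAdjoint r 𝔽) (v : Vec r 𝔽) :
    v ∈ W.domain ↔ opL W.tildeI v = v := Iff.rfl

lemma ExtSelfAdjoint.toVec_mem_domain (W : ExtSelfAdjoint r 𝔽) (v : Fin r → 𝔽) :
    toVec r 𝔽 v ∈ W.domain ↔ W.tildeI *ᵥ v = v := by
  rw [mem_domain, opL_toVec, (toVec r 𝔽).injective.eq_iff]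

lemma ExtSelfAdjoint.forall_inner_eq_zero_iff (W : ExtSelfAdjoint r 𝔽) (v : Vec r 𝔽) :
    (∀ d ∈ W.domain, inner ℝ d v = 0) ↔ opL W.tildeI v = 0 := by
  have hs : ∀ u v, inner ℝ (opL W.tildeI u) v = inner ℝ u (opL W.tildeI v) :=
    inner_opL_of_isHermitian (W.isHermitian_spectralSum _ : W.tildeI.IsHermitian)
  constructor
  · intro h
    have h1 := h (opL W.tildeI v) (by rw [mem_domain, ← opL_mul, tildeI_mul_self])
    rw [← tildeI_mul_self, opL_mul, hs] at h1
    exact inner_self_eq_zero (𝕜 := ℝ).1 h1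
  · intro h d hd
    rw [mem_domain] at hd
    rw [← hd, hs, h, inner_zero_right]

/-- The Hamiltonian system of the stochastic Airy operator. -/
def airy {b : ℝ → Matrix (Fin r) (Fin r) 𝔽} (hb : IsNoisePath b) (W : ExtSelfAdjoint r 𝔽) :
    Hamiltonian (Vec r 𝔽) where
  A x := √2 • opL (b x)
  p x := ((r : ℝ) * x) • ContinuousLinearMap.id ℝ _
  β := opL W.finitePart
  D := W.domain
  continuous_A := by
    have := continuous_opL hb.continuous
    fun_prop
  continuous_p := by fun_prop
  symm_A x u v := by
    rw [_root_.smul_apply, _root_.smul_apply, real_inner_smul_left, real_inner_smul_right,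
      inner_opL_of_isHermitian (hb.isHermitian x)]
  symm_p x u v := by
    simp only [_root_.smul_apply, ContinuousLinearMap.id_apply, real_inner_smul_left,
      real_inner_smul_right]
  symm_β := inner_opL_of_isHermitian (W.isHermitian_spectralSum _)

lemma hasDerivWithinAt_toVec_iff {f : ℝ → Fin r → 𝔽} {f' : Fin r → 𝔽} {s : Set ℝ} {x : ℝ} :
    HasDerivWithinAt (fun x => toVec r 𝔽 (f x)) (toVec r 𝔽 f') s x ↔ HasDerivWithinAt f f' s x := by
  constructor
  · intro h
    have := (toVec r 𝔽).symm.toContinuousLinearMap.hasFDerivAt.comp_hasDerivWithinAt x h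
    simpa [Function.comp_def] using this
  · intro h
    exact (toVec r 𝔽).toContinuousLinearMap.hasFDerivAt.comp_hasDerivWithinAt x h

variable {b : ℝ → Matrix (Fin r) (Fin r) 𝔽} (hb : IsNoisePath b) (W : ExtSelfAdjoint r 𝔽)

lemma sol_iff {μ : ℝ} {f g : ℝ → Fin r → 𝔽} :
    (airy hb W).Sol μ (fun x => toVec r 𝔽 (f x)) (fun x => toVec r 𝔽 (g x)) ↔
      IsSolution b μ f g := by
  refine forall_congr' fun x => forall_congr' fun hx => and_congr ?_ ?_
  · rw [← hasDerivWithinAt_toVec_iff]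
    rw [map_add, map_smul, ← opL_toVec]; exact Iff.rfl
  · rw [← hasDerivWithinAt_toVec_iff]
    have h2 : ∀ v : Vec r 𝔽, (2 : ℝ) • opL (b x) v = √2 • opL (b x) (√2 • v) := fun v => by
      rw [map_smul, smul_smul, Real.mul_self_sqrt (by norm_num)]
    rw [map_sub, map_sub, map_smul, map_smul, map_smul, ← opL_toVec, ← opL_toVec, ← opL_toVec,
      sub_smul, h2]
    exact Iff.rfl

lemma bc_iff {f g : ℝ → Fin r → 𝔽} :
    (airy hb W).BC (fun x => toVec r 𝔽 (f x)) (fun x => toVec r 𝔽 (g x)) ↔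
      -(W.tildeW *ᵥ f 0) + W.tildeI *ᵥ g 0 = 0 := by
  rw [W.boundary_iff, ← W.toVec_mem_domain, ← (toVec r 𝔽).map_eq_zero_iff, ← opL_toVec,
    ← W.forall_inner_eq_zero_iff, map_sub, ← opL_toVec]
  exact Iff.rfl

/-- Matrices act from the left, so multiplication by scalars from the right commutes with the
system; over ℍ left multiplication would not. -/
lemma IsSolution.op_smul {μ : ℝ} {f g : ℝ → Fin r → 𝔽} (h : IsSolution b μ f g) (c : 𝔽) :
    IsSolution b μ (fun x => MulOpposite.op c • f x) (fun x => MulOpposite.op c • g x) := by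
  let L : (Fin r → 𝔽) →L[ℝ] (Fin r → 𝔽) := LinearMap.toContinuousLinearMap
    { toFun := fun v => MulOpposite.op c • v
      map_add' := fun v w => smul_add _ _ _
      map_smul' := fun a v => funext fun i => smul_mul_assoc a (v i) c }
  have hL : ∀ v, L v = MulOpposite.op c • v := fun v => rfl
  intro x hx
  have h1 := L.hasFDerivAt.comp_hasDerivWithinAt x (h x hx).1
  have h2 := L.hasFDerivAt.comp_hasDerivWithinAt x (h x hx).2
  refine ⟨h1.congr_deriv ?_, h2.congr_deriv ?_⟩
  · rw [map_add, map_smul, hL, hL, mulVec_smul]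
  · rw [map_sub, map_sub, map_smul, map_smul, map_smul, hL, hL, hL, mulVec_smul, mulVec_smul,
      mulVec_smul]

lemma IsMatrixSolution.mulVec {lam : ℝ} {F G : ℝ → Matrix (Fin r) (Fin r) 𝔽}
    (h : IsMatrixSolution b lam F G) (v : Fin r → 𝔽) :
    (airy hb W).Sol lam (fun x => opL (F x) (toVec r 𝔽 v)) (fun x => opL (G x) (toVec r 𝔽 v)) := by
  have h1 : ∀ s : Finset (Fin r), (airy hb W).Sol lam
      (fun x => ∑ j ∈ s, toVec r 𝔽 (MulOpposite.op (v j) • fun i => F x i j))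
      (fun x => ∑ j ∈ s, toVec r 𝔽 (MulOpposite.op (v j) • fun i => G x i j)) := by
    intro s
    induction s using Finset.induction_on with
    | empty => exact Hamiltonian.Sol.zero _ _
    | insert j s hj ih =>
      simp only [Finset.sum_insert hj]
      exact Hamiltonian.Sol.add ((sol_iff hb W).2 ((h j).op_smul (v j))) ih
  have h2 : ∀ M : Matrix (Fin r) (Fin r) 𝔽, opL M (toVec r 𝔽 v) =
      ∑ j, toVec r 𝔽 (MulOpposite.op (v j) • fun i => M i j) := fun M => by
    rw [opL_toVec, mulVec_eq_sum, map_sum]; rfl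
  simp only [h2]
  exact h1 Finset.univ

lemma isFrame_airy {lam : ℝ} {F G : ℝ → Matrix (Fin r) (Fin r) 𝔽}
    (h : IsMatrixSolution b lam F G) (hF : F 0 = W.tildeI) (hG : G 0 = W.tildeW) :
    (airy hb W).IsFrame lam (fun x => opL (F x)) (fun x => opL (G x)) where
  sol v := by
    obtain ⟨v, rfl⟩ := (toVec r 𝔽).surjective v
    exact h.mulVec hb W v
  bc v := by
    obtain ⟨v, rfl⟩ := (toVec r 𝔽).surjective v
    simp only [opL_toVec]
    rw [bc_iff, hF, hG, mulVec_mulVec, mulVec_mulVec, W.tildeW_mul_tildeI, W.tildeI_mul_tildeW,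
      neg_add_cancel]
  surj d hd := ⟨d, by
    change opL (F 0) d = d
    rw [hF]
    exact hd⟩
  inj v h1 h2 := by
    rw [hF] at h1
    rw [hG] at h2
    have h3 : W.tildeW = W.finitePart + 1 - W.tildeI := by rw [← W.tildeW_add_tildeI]; abel
    rw [h3, opL_sub, opL_add, _root_.sub_apply, _root_.add_apply, h1, opL_one,
      ← W.finitePart_mul_tildeI, opL_mul, h1, map_zero] at h2
    simpa using h2

lemma opL_injective : Function.Injective (opL : Matrix (Fin r) (Fin r) 𝔽 → _) := by
  intro M N h
  ext i j
  have h1 := congrArg (fun L => (toVec r 𝔽).symm (L (toVec r 𝔽 (Pi.single j 1))) i) h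
  simpa [opL_toVec] using h1

lemma isConjoinedBasis (hb : IsNoisePath b) (W : ExtSelfAdjoint r 𝔽) {lam : ℝ} {F G : ℝ → Matrix (Fin r) (Fin r) 𝔽}
    (h : IsMatrixSolution b lam F G) (hF : F 0 = W.tildeI) (hG : G 0 = W.tildeW) :
    IsConjoinedBasis b lam F G where
  isMatrixSolution := h
  symm x hx := by
    have hfr := isFrame_airy hb W h hF hG
    apply opL_injective
    ext1 w
    refine ext_inner_left ℝ fun v => ?_
    have h1 := hfr.symm hx v w
    rwa [inner_opL_left, inner_opL_left, ← opL_mul, ← opL_mul] at h1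
  rank x hx v h1 h2 := by
    have hfr := isFrame_airy hb W h hF hG
    have h3 := hfr.eq_zero hx (v := toVec r 𝔽 v) (by rw [opL_toVec, h1, map_zero])
      (by rw [opL_toVec, h2, map_zero])
    simpa using h3

end Airy

end StochasticAiry

namespace StochasticAiry

/-! ### Eigenfunctions of the stochastic Airy operator -/

section Eigenfunctions

variable {r : ℕ} {𝔽 : Type*} [NormedDivisionRing 𝔽] [StarRing 𝔽] [InnerProductSpace ℝ 𝔽]
  [IsClassicalField 𝔽]

open Hamiltonian Triple

lemma memLp_toVec_iff {f : ℝ → Fin r → 𝔽} {μ : Measure ℝ} :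
    MemLp (fun x => toVec r 𝔽 (f x)) 2 μ ↔ ∀ i, MemLp (fun x => f x i) 2 μ := memLp_piLp_iff

lemma LocInt.continuousLinearMap_comp {E F : Type*} [NormedAddCommGroup E] [NormedSpace ℝ E]
    [NormedAddCommGroup F] [NormedSpace ℝ F] (L : E →L[ℝ] F) {k : ℝ → E} (hk : LocInt k) :
    LocInt (fun x => L (k x)) := hk.clm_apply (A := fun _ => L) continuous_const

/-- Reading an 𝔽-valued pairing against a ∈ 𝔽 amounts to multiplying the left vector by a from the
right. Thus an 𝔽-valued form equation is equivalent to a family of real ones. -/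
lemma inner_dotProduct (a : 𝔽) (u v : Fin r → 𝔽) : inner ℝ a (star u ⬝ᵥ v) =
    inner ℝ (toVec r 𝔽 (MulOpposite.op a • u)) (toVec r 𝔽 v) := by
  rw [inner_toVec, ← IsClassicalField.inner_one_star_mul, dotProduct, dotProduct, Finset.mul_sum]
  congr 1
  refine Finset.sum_congr rfl fun i _ => ?_
  change star a * (star (u i) * v i) = star (u i * a) * v i
  rw [star_mul, mul_assoc]

lemma integrable_dotProduct {U V : ℝ → Fin r → 𝔽} (hU : Continuous U) (hc : HasCompactSupport U)
    (hV : LocInt (fun x => toVec r 𝔽 (V x))) :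
    Integrable (fun x => star (U x) ⬝ᵥ V x) halfLine := by
  obtain ⟨T, hT, hz⟩ := exists_forall_gt_eq_zero (hc.comp_left (map_zero (toVec r 𝔽)))
  replace hz : ∀ x, T ≤ x → U x = 0 := fun x hx => (toVec r 𝔽).map_eq_zero_iff.1 (hz x hx)
  refine integrable_finsetSum _ fun i _ => ?_
  have hVi : LocInt (fun x => V x i) := hV.continuousLinearMap_comp
    ((ContinuousLinearMap.proj i).comp (toVec r 𝔽).symm.toContinuousLinearMap)
  have h1 : IntervalIntegrable (fun x => star (U x i) * V x i) volume 0 T :=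
    (hVi T hT).continuousOn_mul
      (IsClassicalField.continuous_star.comp ((continuous_apply i).comp hU)).continuousOn
  rw [intervalIntegrable_iff_integrableOn_Ioc_of_le hT] at h1
  refine h1.of_forall_sdiff_eq_zero measurableSet_Ioi fun x hx => ?_
  have : T ≤ x := by
    by_contra h
    exact hx.2 ⟨hx.1, (not_le.1 h).le⟩
  change star (U x i) * V x i = 0
  rw [hz x this]
  simp

lemma inner_innerL2 (a : 𝔽) {U V : ℝ → Fin r → 𝔽} (hU : Continuous U) (hc : HasCompactSupport U)
    (hV : LocInt (fun x => toVec r 𝔽 (V x))) :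
    Integrable (fun x => inner ℝ (toVec r 𝔽 (MulOpposite.op a • U x)) (toVec r 𝔽 (V x))) halfLine ∧
    inner ℝ a (innerL2 U V) =
      ∫ x in Ioi (0 : ℝ), inner ℝ (toVec r 𝔽 (MulOpposite.op a • U x)) (toVec r 𝔽 (V x)) := by
  have h1 := integrable_dotProduct hU hc hV
  have h2 := (innerSL ℝ a).integral_comp_comm h1
  have h3 := (innerSL ℝ a).integrable_comp h1
  simp only [innerSL_apply_apply, inner_dotProduct] at h2 h3
  exact ⟨h3, h2.symm⟩

lemma continuous_integratedPotential {b : ℝ → Matrix (Fin r) (Fin r) 𝔽} (hb : Continuous b) :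
    Continuous (integratedPotential b) := by
  unfold integratedPotential
  exact (hb.const_smul (√2 : ℝ)).add ((by fun_prop : Continuous fun x : ℝ => (r : ℝ) * x ^ 2 / 2).smul
    continuous_const)

lemma opL_integratedPotential (b : ℝ → Matrix (Fin r) (Fin r) 𝔽) (x : ℝ) :
    opL (integratedPotential b x) =
      √2 • opL (b x) + ((r : ℝ) * x ^ 2 / 2) • ContinuousLinearMap.id ℝ (Vec r 𝔽) := by
  unfold integratedPotential
  rw [opL_add, opL_smul, opL_smul, opL_one]

variable {b : ℝ → Matrix (Fin r) (Fin r) 𝔽}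

/-- The form of the stochastic Airy operator in terms of real inner products. -/
lemma inner_airyForm_sub (hb : Continuous b) (W : ExtSelfAdjoint r 𝔽) (a : 𝔽) (μ : ℝ)
    {φ f h : ℝ → Fin r → 𝔽} (hφ : ContDiff ℝ ((⊤ : ℕ∞) : WithTop ℕ∞) φ) (hc : HasCompactSupport φ)
    (hf : LocInt (fun x => toVec r 𝔽 (f x))) (hh : LocInt (fun x => toVec r 𝔽 (h x))) :
    inner ℝ a (airyForm b W φ (deriv φ) f h - μ • innerL2 φ f) =
      (∫ x in Ioi (0 : ℝ), (inner ℝ (toVec r 𝔽 (MulOpposite.op a • deriv φ x))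
          (toVec r 𝔽 (h x) - opL (integratedPotential b x) (toVec r 𝔽 (f x))) +
        inner ℝ (toVec r 𝔽 (MulOpposite.op a • φ x))
          (-(μ • toVec r 𝔽 (f x)) - opL (integratedPotential b x) (toVec r 𝔽 (h x))))) +
      inner ℝ (toVec r 𝔽 (MulOpposite.op a • φ 0)) (opL W.finitePart (toVec r 𝔽 (f 0))) := by
  have hY := continuous_opL (continuous_integratedPotential hb)
  have hYf : LocInt (fun x => toVec r 𝔽 (integratedPotential b x *ᵥ f x)) := hf.clm_apply hY
  have hYh : LocInt (fun x => toVec r 𝔽 (integratedPotential b x *ᵥ h x)) := hh.clm_apply hY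
  have hd : Continuous (deriv φ) := hφ.continuous_deriv (by simp)
  have hdc := hc.deriv
  obtain ⟨i1, e1⟩ := inner_innerL2 a hd hdc hh
  obtain ⟨i2, e2⟩ := inner_innerL2 a hd hdc hYf
  obtain ⟨i3, e3⟩ := inner_innerL2 a hφ.continuous hc hYh
  obtain ⟨i4, e4⟩ := inner_innerL2 a hφ.continuous hc hf
  unfold airyForm
  rw [inner_sub_right, inner_add_right, inner_sub_right, inner_sub_right, real_inner_smul_right,
    e1, e2, e3, e4, inner_dotProduct, ← opL_toVec, ← integral_const_mul,
    add_sub_right_comm]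
  congr 1
  have e5 := integral_sub i1 i2
  have e6 := integral_sub (i1.sub i2) i3
  have e7 := integral_sub ((i1.sub i2).sub i3) (i4.const_mul μ)
  simp only [Pi.sub_apply] at e6 e7
  rw [← e5, ← e6, ← e7]
  refine integral_congr_ae (Filter.Eventually.of_forall fun x => ?_)
  simp only [inner_sub_right, inner_neg_right, real_inner_smul_right, opL_toVec]
  ring

lemma Hamiltonian.isGauge_smul_id {E : Type*} [NormedAddCommGroup E] [InnerProductSpace ℝ E]
    {H H' : Hamiltonian E} {a a' : ℝ → ℝ} (hd : ∀ x, HasDerivAt a (a' x) x) (h0 : a 0 = 0)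
    (hA : ∀ x, H'.A x = H.A x + a x • ContinuousLinearMap.id ℝ E)
    (hp : ∀ x, H.p x = H'.p x + a' x • ContinuousLinearMap.id ℝ E)
    (hD : H'.D = H.D) (hβ : H'.β = H.β) :
    H.IsGauge H' (fun x => -(a x • ContinuousLinearMap.id ℝ E))
      (fun x => -(a' x • ContinuousLinearMap.id ℝ E)) where
  deriv x _ := ((hd x).smul_const (ContinuousLinearMap.id ℝ E)).fun_neg.hasDerivWithinAt
  A_eq x _ := by rw [hA]; abel
  p_eq x _ := by rw [hp]; abel
  D_eq := hD
  β_eq := by rw [hβ, h0, zero_smul, neg_zero, add_zero]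

/-- The Hamiltonian system of the form of the stochastic Airy operator. -/
def integratedAiry (hb : IsNoisePath b) (W : ExtSelfAdjoint r 𝔽) : Hamiltonian (Vec r 𝔽) where
  A x := opL (integratedPotential b x)
  p x := 0
  β := opL W.finitePart
  D := W.domain
  continuous_A := continuous_opL (continuous_integratedPotential hb.continuous)
  continuous_p := continuous_const
  symm_A x u v := by
    simp only [opL_integratedPotential, _root_.add_apply, _root_.smul_apply, inner_add_left,
      inner_add_right, real_inner_smul_left, real_inner_smul_right, ContinuousLinearMap.id_apply,
      inner_opL_of_isHermitian (hb.isHermitian x)]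
  symm_p x u v := by simp
  symm_β := inner_opL_of_isHermitian (W.isHermitian_spectralSum _)

/-- Subtracting the primitive r x²/2 in the gauge moves the potential r x from p into A, which turns
√2 b into Y and p into 0. Since the primitive vanishes at 0, the boundary condition is unchanged. -/
lemma isGauge_integratedAiry (hb : IsNoisePath b) (W : ExtSelfAdjoint r 𝔽) :
    (airy hb W).IsGauge (integratedAiry hb W)
      (fun x => -(((r : ℝ) * x ^ 2 / 2) • ContinuousLinearMap.id ℝ (Vec r 𝔽)))
      (fun x => -(((r : ℝ) * x) • ContinuousLinearMap.id ℝ (Vec r 𝔽))) := by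
  refine isGauge_smul_id (fun x => ?_) (by simp) (fun x => opL_integratedPotential b x)
    (fun x => (zero_add _).symm) rfl rfl
  refine (((hasDerivAt_pow 2 x).const_mul (r : ℝ)).div_const 2).congr_deriv ?_
  simp; ring

variable {W : ExtSelfAdjoint r 𝔽} {μ : ℝ} {f : ℝ → Fin r → 𝔽}

lemma eq_add_integral_iff {h : ℝ → Fin r → 𝔽} (hh : LocInt (fun x => toVec r 𝔽 (h x)))
    {x : ℝ} (hx : 0 ≤ x) : f x = f 0 + ∫ t in (0 : ℝ)..x, h t ↔
      toVec r 𝔽 (f x) = toVec r 𝔽 (f 0) + ∫ t in (0 : ℝ)..x, toVec r 𝔽 (h t) := by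
  have hl : LocInt h := by
    have := hh.continuousLinearMap_comp (toVec r 𝔽).symm.toContinuousLinearMap
    simpa using this
  have h1 : ∫ t in (0 : ℝ)..x, toVec r 𝔽 (h t) = toVec r 𝔽 (∫ t in (0 : ℝ)..x, h t) :=
    (toVec r 𝔽).toContinuousLinearMap.intervalIntegral_comp_comm (hl x hx)
  rw [h1, ← map_add, (toVec r 𝔽).injective.eq_iff]

lemma isTestFunction_smul {η : ℝ → ℝ} {e : Fin r → 𝔽}
    (hη : ContDiff ℝ ((⊤ : ℕ∞) : WithTop ℕ∞) η) (hc : HasCompactSupport η)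
    (he : toVec r 𝔽 e ∈ W.domain ∨ ∃ ε > 0, ∀ x < ε, η x = 0) :
    IsTestFunction W (fun x => η x • e) where
  smooth := hη.smul contDiff_const
  compact_support := hc.smul_right
  dirichlet i hi := by
    rcases he with he | ⟨ε, hε, h⟩
    · rw [W.toVec_mem_domain, W.tildeI_mulVec_eq_self_iff] at he
      refine ⟨1, one_pos, fun x _ _ => ?_⟩
      rw [mulVec_smul, Pi.smul_apply, he i hi, smul_zero]
    · refine ⟨ε, hε, fun x _ hx => ?_⟩
      rw [h x hx]; simp

/-- The weak equation is the weak form of the gauged system with A = Y and p = 0. Regularity gives a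
classical solution of that system, and undoing the gauge gives one of the original. -/
lemma IsWeakEigenfunction.isL2Eigenfunction (hb : IsNoisePath b)
    (hf : IsWeakEigenfunction b W μ f) : IsL2Eigenfunction b W μ f := by
  obtain ⟨h, hD, hw⟩ := hf.weak_equation
  have hhm : MemLp (fun x => toVec r 𝔽 (h x)) 2 halfLine := memLp_toVec_iff.2 hD.memLp_deriv
  have hh := LocInt.of_memLp hhm
  have hfi : ∀ x, 0 ≤ x → toVec r 𝔽 (f x) = toVec r 𝔽 (f 0) + ∫ t in (0 : ℝ)..x, toVec r 𝔽 (h t) :=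
    fun x hx => (eq_add_integral_iff hh hx).1 (hD.eq_integral x hx)
  have hfc : ContinuousOn (fun x => toVec r 𝔽 (f x)) (Ici 0) :=
    (hh.continuousOn_primitive (toVec r 𝔽 (f 0))).congr hfi
  have hfl := LocInt.of_continuousOn hfc
  obtain ⟨g, hg, hbc⟩ := (integratedAiry hb W).exists_sol_of_weak (μ := μ)
    (y := toVec r 𝔽 (f 0)) (f := fun x => toVec r 𝔽 (f x)) (h := fun x => toVec r 𝔽 (h x))
    ((W.toVec_mem_domain _).2 ((W.tildeI_mulVec_eq_self_iff _).2 hD.dirichlet)) hh hfi (by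
      intro η e hη hc he
      obtain ⟨e, rfl⟩ := (toVec r 𝔽).surjective e
      have hφ := isTestFunction_smul (W := W) hη hc he
      -- The scalar a = 1 is enough here, since the direction e already ranges over all of 𝔽^r.
      have h1 := inner_airyForm_sub hb.continuous W 1 μ hφ.smooth hφ.compact_support hfl hh
      rw [hw _ hφ, sub_self, inner_zero_right] at h1
      have hd : ∀ x, deriv (fun x => η x • e) x = deriv η x • e := fun x =>
        ((hη.differentiable (by simp) x).hasDerivAt.smul_const e).deriv
      simp only [hd, MulOpposite.op_one, one_smul, map_smul, real_inner_smul_left] at h1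
      refine Eq.trans ?_ h1.symm
      congr 1
      refine integral_congr_ae (Filter.Eventually.of_forall fun x => ?_)
      change _ * inner ℝ _ (_ - opL (integratedPotential b x) _) + _ * inner ℝ _ (0 - _ - _) = _
      rw [zero_sub]
      rfl)
  have hsol := (isGauge_integratedAiry hb W).symm.sol hg
  have hbc' := (isGauge_integratedAiry hb W).symm.bc hbc
  refine ⟨hf.zero_of_neg, hf.ne_zero, ?_, ?_⟩
  · rw [← memLp_toVec_iff]
    have hm := memLp_toVec_iff.2 hD.memLp_weighted
    refine hm.mono ((hfc.mono Ioi_subset_Ici_self).aestronglyMeasurable measurableSet_Ioi)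
      (ae_halfLine fun x hx => ?_)
    have h1 : toVec r 𝔽 (fun i => √(1 + (r : ℝ) * x) • f x i) = √(1 + (r : ℝ) * x) •
      toVec r 𝔽 (f x) := by rw [← map_smul]; rfl
    rw [h1, norm_smul, Real.norm_eq_abs, abs_of_nonneg (Real.sqrt_nonneg _)]
    refine le_mul_of_one_le_left (norm_nonneg _) (Real.one_le_sqrt.2 ?_)
    have : 0 ≤ (r : ℝ) * x := by positivity
    linarith
  · set g' : ℝ → Vec r 𝔽 := fun x =>
      g x + -(-(((r : ℝ) * x ^ 2 / 2) • ContinuousLinearMap.id ℝ (Vec r 𝔽))) (toVec r 𝔽 (f x)) with hg'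
    refine ⟨fun x => (toVec r 𝔽).symm (g' x), (sol_iff hb W).1 ?_,
      (bc_iff hb W (f := f) (g := fun x => (toVec r 𝔽).symm (g' x))).1 ?_⟩
    · simp only [ContinuousLinearEquiv.apply_symm_apply]
      exact hsol
    · simp only [ContinuousLinearEquiv.apply_symm_apply]
      exact hbc'

section Coercive

variable {H' : Hamiltonian (Vec r 𝔽)} {S S' : ℝ → Vec r 𝔽 →L[ℝ] Vec r 𝔽} {c C : ℝ}

/-- The functions on the half-line represented by the elements of the form domain. -/
def profile (H' : Hamiltonian (Vec r 𝔽)) : H'.formSpace →ₗ[ℝ] (ℝ → Fin r → 𝔽) :=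
  LinearMap.pi fun x => (toVec r 𝔽).symm.toLinearEquiv.toLinearMap ∘ₗ LinearMap.proj x ∘ₗ H'.repS

lemma toVec_profile (z : H'.formSpace) (x : ℝ) :
    toVec r 𝔽 (profile H' z x) = rep (Vec r 𝔽) z.1 x := (toVec r 𝔽).apply_symm_apply _

lemma profile_injective : Function.Injective (profile H') := by
  intro z w h
  apply H'.repS_injective
  funext x
  have := congrArg (fun u => toVec r 𝔽 (u x)) h
  simp only [toVec_profile] at this
  exact this

lemma IsL2Eigenfunction.exists_mem_formSpace {hb : IsNoisePath b}
    (hg : (airy hb W).IsGauge H' S S') (hH : H'.IsCoercive c C) {g : ℝ → Fin r → 𝔽}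
    (hs : IsSolution b μ f g) (hbc : -(W.tildeW *ᵥ f 0) + W.tildeI *ᵥ g 0 = 0)
    (hf : ∀ i, MemLp (fun x => f x i) 2 halfLine) :
    ∃ z : H'.formSpace, z ∈ hH.eigenspace μ ∧
      h (Vec r 𝔽) z.1 =ᵐ[halfLine] (fun x => toVec r 𝔽 (√2 • (b x *ᵥ f x) + g x)) ∧
      ∀ x, 0 ≤ x → rep (Vec r 𝔽) z.1 x = toVec r 𝔽 (f x) := by
  have h1 := hg.sol ((sol_iff hb W).2 hs)
  have h2 := hg.bc ((bc_iff hb W).2 hbc)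
  obtain ⟨z, hz, hzh, hze, hzr⟩ := hH.exists_rep_eq_of_memLp h1 h2 (memLp_toVec_iff.2 hf)
  refine ⟨⟨z, hz⟩, fun φ hφ => hH.form_eq_of_sol h1 h2 hzh hze (hzr 0 le_rfl) hφ, ?_, hzr⟩
  filter_upwards [hzh, ae_halfLine fun x hx => hg.A_eq x hx.le] with x e1 e2
  rw [e1, map_add, map_smul, ← opL_toVec, show √2 • opL (b x) (toVec r 𝔽 (f x)) =
    (airy hb W).A x (toVec r 𝔽 (f x)) from rfl, e2, _root_.add_apply]
  abel

/-- The gauge does not change f, so eigenfunctions of the original system are exactly the nonzero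
profiles of eigenvectors of the coercive form. -/
lemma isL2Eigenfunction_iff {hb : IsNoisePath b} (hg : (airy hb W).IsGauge H' S S')
    (hH : H'.IsCoercive c C) :
    IsL2Eigenfunction b W μ f ↔ f ≠ 0 ∧ f ∈ (hH.eigenspace μ).map (profile H') := by
  constructor
  · intro hf
    obtain ⟨g, hs, hbc⟩ := hf.exists_solution
    obtain ⟨z, hz, -, hzr⟩ := IsL2Eigenfunction.exists_mem_formSpace hg hH hs hbc hf.memLp
    refine ⟨hf.ne_zero, z, hz, funext fun x => (toVec r 𝔽).injective ?_⟩
    rw [toVec_profile]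
    rcases lt_or_ge x 0 with hx | hx
    · rw [rep_of_neg hx, hf.zero_of_neg x hx, map_zero]
    · exact hzr x hx
  · rintro ⟨hne, z, hz, rfl⟩
    obtain ⟨g, hs, hbc⟩ := hH.exists_sol_of_form_eq z.2 hz
    have hs' := hg.symm.sol hs
    have hbc' := hg.symm.bc hbc
    refine ⟨fun x hx => ?_, hne, ?_, fun x => (toVec r 𝔽).symm (g x + -S x (rep (Vec r 𝔽) z.1 x)),
      (sol_iff hb W).1 ?_, (bc_iff hb W (f := profile H' z)
        (g := fun x => (toVec r 𝔽).symm (g x + -S x (rep (Vec r 𝔽) z.1 x)))).1 ?_⟩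
    · apply (toVec r 𝔽).injective
      rw [toVec_profile, rep_of_neg hx, map_zero]
    · rw [← memLp_toVec_iff]
      simp only [toVec_profile]
      exact (memLp_congr_ae z.2.2).1 (Lp.memLp _)
    · simp only [ContinuousLinearEquiv.apply_symm_apply, toVec_profile]
      exact hs'
    · simp only [ContinuousLinearEquiv.apply_symm_apply, toVec_profile]
      exact hbc'

lemma memLp_sqrt_smul (z : Triple (Vec r 𝔽)) {f : ℝ → Vec r 𝔽} (hc : ContinuousOn f (Ici 0))
    (hf : emb (Vec r 𝔽) z =ᵐ[halfLine] f) :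
    MemLp (fun x => √(1 + (r : ℝ) * x) • f x) 2 halfLine := by
  have h1 : MemLp (fun x => √(1 + x) • f x) 2 halfLine := by
    refine (memLp_congr_ae ?_).1 (Lp.memLp (u (Vec r 𝔽) z))
    filter_upwards [emb_ae z, hf, ae_halfLine fun x hx => wt_mul hx.le] with x e1 e2 e3
    rw [← e2, e1, smul_smul, mul_comm, e3, one_smul]
  -- The weights are comparable: 1 + r x ≤ (1 + r)(1 + x).
  refine h1.of_le_mul (c := √(1 + r)) ?_ (ae_halfLine fun x hx => ?_)
  · exact ((by fun_prop : ContinuousOn (fun x : ℝ => √(1 + (r : ℝ) * x)) (Ioi 0)).smul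
      (hc.mono Ioi_subset_Ici_self)).aestronglyMeasurable measurableSet_Ioi
  · rw [norm_smul, norm_smul, Real.norm_eq_abs, Real.norm_eq_abs, abs_of_nonneg (Real.sqrt_nonneg _),
      abs_of_nonneg (Real.sqrt_nonneg _), ← mul_assoc, ← Real.sqrt_mul (by positivity)]
    gcongr
    have : (0 : ℝ) ≤ r := Nat.cast_nonneg r
    nlinarith

lemma integral_inner_of_sol {H : Hamiltonian (Vec r 𝔽)} {f g : ℝ → Vec r 𝔽} (hs : H.Sol μ f g)
    {ψ : ℝ → Vec r 𝔽} (hψ : ContDiff ℝ 1 ψ) (hc : HasCompactSupport ψ) :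
    ∫ x in Ioi (0 : ℝ), (inner ℝ (deriv ψ x) (g x) + inner ℝ (ψ x)
      (H.p x (f x) - μ • f x - H.A x (H.A x (f x)) - H.A x (g x))) = -inner ℝ (ψ 0) (g 0) := by
  obtain ⟨T, hT, hz⟩ := exists_forall_gt_eq_zero hc
  obtain ⟨T', hT', hz'⟩ := exists_forall_gt_eq_zero hc.deriv
  have hM : 0 ≤ max T T' := le_max_of_le_left hT
  rw [setIntegral_Ioi_eq_of_eq_zero hM (fun x hx => by
    rw [hz x ((le_max_left _ _).trans hx.le), hz' x ((le_max_right _ _).trans hx.le)]; simp)]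
  rw [integral_eq_sub_of_hasDerivWithinAt (f := fun x => inner ℝ (ψ x) (g x)) ?_ ?_ le_rfl hM,
    hz _ (le_max_left _ _)]
  · simp
  · refine LocInt.of_continuousOn (ContinuousOn.add ?_ ?_)
    · exact (hψ.continuous_deriv le_rfl).continuousOn.inner hs.continuousOn_snd
    · exact hψ.continuous.continuousOn.inner hs.continuousOn_deriv_snd
  · intro x hx
    refine (((hψ.differentiable one_ne_zero x).hasDerivAt.hasDerivWithinAt).inner ℝ
      (hs x hx).2).congr_deriv ?_
    ring

/-- The coercive system is used only to place f in the weighted space. The weak equation itself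
follows by integrating the gauged system with A = Y against the compactly supported φ a, whose value
at 0 lies in the domain so that the boundary condition applies. -/
lemma IsL2Eigenfunction.isWeakEigenfunction {hb : IsNoisePath b}
    (hg : (airy hb W).IsGauge H' S S') (hH : H'.IsCoercive c C)
    (hf : IsL2Eigenfunction b W μ f) : IsWeakEigenfunction b W μ f := by
  obtain ⟨g, hs, hbc⟩ := hf.exists_solution
  obtain ⟨z, hz, hzh, hzr⟩ := IsL2Eigenfunction.exists_mem_formSpace hg hH hs hbc hf.memLp
  have hsY := (isGauge_integratedAiry hb W).sol ((sol_iff hb W).2 hs)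
  have hbcY := (isGauge_integratedAiry hb W).bc ((bc_iff hb W).2 hbc)
  have hcf := hsY.continuousOn_fst
  have hhm : MemLp (fun x => toVec r 𝔽 (√2 • (b x *ᵥ f x) + g x)) 2 halfLine :=
    (memLp_congr_ae hzh).1 (Lp.memLp _)
  have hemb : emb (Vec r 𝔽) z.1 =ᵐ[halfLine] fun x => toVec r 𝔽 (f x) := by
    filter_upwards [z.2.2, ae_halfLine fun x hx => hzr x hx.le] with x e1 e2
    rw [e1, e2]
  refine ⟨hf.zero_of_neg, hf.ne_zero, fun x => √2 • (b x *ᵥ f x) + g x, ⟨?_, ?_, ?_, ?_⟩, ?_⟩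
  · intro x hx
    exact (eq_add_integral_iff (LocInt.of_memLp hhm) hx).2 (primitive_of_hasDerivWithinAt
      (f := fun x => toVec r 𝔽 (f x)) (LocInt.of_memLp hhm)
      (fun y hy => hasDerivWithinAt_toVec_iff.2 (hs y hy).1) hx)
  · exact memLp_toVec_iff.1 hhm
  · rw [← memLp_toVec_iff]
    exact memLp_sqrt_smul z.1 hcf hemb
  · exact (W.tildeI_mulVec_eq_self_iff _).1 ((W.boundary_iff _ _).1 hbc).1
  · intro φ hφ
    rw [← sub_eq_zero]
    refine ext_inner_left ℝ fun a => ?_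
    rw [inner_zero_right, inner_airyForm_sub hb.continuous W a μ hφ.smooth hφ.compact_support
      (LocInt.of_continuousOn hcf) (LocInt.of_memLp hhm)]
    let L : (Fin r → 𝔽) →L[ℝ] Vec r 𝔽 := (toVec r 𝔽).toContinuousLinearMap.comp
      (LinearMap.toContinuousLinearMap
        { toFun := fun v => MulOpposite.op a • v
          map_add' := fun v w => smul_add _ _ _
          map_smul' := fun t v => funext fun i => smul_mul_assoc t (v i) a })
    have hψ : ContDiff ℝ 1 (fun x => L (φ x)) := L.contDiff.comp (hφ.smooth.of_le (by simp))
    have hψc : HasCompactSupport (fun x => L (φ x)) := hφ.compact_support.comp_left (map_zero L)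
    have hψd : ∀ x, deriv (fun x => L (φ x)) x = L (deriv φ x) := fun x =>
      (L.hasFDerivAt.comp_hasDerivAt x (hφ.smooth.differentiable (by simp) x).hasDerivAt).deriv
    have hI := integral_inner_of_sol hsY hψ hψc
    have h0 : L (φ 0) ∈ W.domain := by
      change toVec r 𝔽 (MulOpposite.op a • φ 0) ∈ W.domain
      rw [W.toVec_mem_domain, mulVec_smul, (W.tildeI_mulVec_eq_self_iff _).2]
      intro i hi
      obtain ⟨ε, hε, h⟩ := hφ.dirichlet i hi
      exact h 0 le_rfl hε
    have hB := hbcY.2 _ h0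
    rw [inner_sub_right, sub_eq_zero] at hB
    rw [hB] at hI
    rw [← neg_eq_iff_add_eq_zero]
    refine neg_eq_iff_eq_neg.2 (Eq.trans (integral_congr_ae (ae_halfLine fun x hx => ?_)) hI)
    have hx1 : toVec r 𝔽 (√2 • (b x *ᵥ f x) + g x) = (integratedAiry hb W).A x (toVec r 𝔽 (f x)) +
        (toVec r 𝔽 (g x) + (-(((r : ℝ) * x ^ 2 / 2) • ContinuousLinearMap.id ℝ (Vec r 𝔽)))
          (toVec r 𝔽 (f x))) := by
      have := congrArg (fun M => M (toVec r 𝔽 (f x))) ((isGauge_integratedAiry hb W).A_eq x hx.le)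
      simp only [_root_.add_apply] at this
      rw [map_add, map_smul, ← opL_toVec, show √2 • opL (b x) (toVec r 𝔽 (f x)) =
        (airy hb W).A x (toVec r 𝔽 (f x)) from rfl, this]
      abel
    have hA : opL (integratedPotential b x) = (integratedAiry hb W).A x := rfl
    have hp : (integratedAiry hb W).p x (toVec r 𝔽 (f x)) = 0 := rfl
    simp only [hψd, hx1, hA, hp, map_add, add_sub_cancel_left, zero_sub]
    rw [sub_add_eq_sub_sub, sub_add_eq_sub_sub]
    rfl

lemma isWeakEigenfunction_iff {hb : IsNoisePath b} (hg : (airy hb W).IsGauge H' S S')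
    (hH : H'.IsCoercive c C) : IsWeakEigenfunction b W μ f ↔ IsL2Eigenfunction b W μ f :=
  ⟨fun h => h.isL2Eigenfunction hb, fun h => h.isWeakEigenfunction hg hH⟩

end Coercive

end Eigenfunctions

end StochasticAiry

namespace StochasticAiry

/-! ### Dimensions and counting -/

lemma countWithMult_eq_sum {S : Set ℝ} {m : ℝ → ℕ∞} {X : Finset ℝ} {k : ℝ → ℕ}
    (hX : ∀ x ∈ X, x ∈ S) (hm : ∀ x ∈ X, m x = k x) (h0 : ∀ x ∈ S, x ∉ X → m x = 0) :
    countWithMult S m = (∑ x ∈ X, k x : ℕ) := by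
  have h : {p : ℝ × ℕ | p.1 ∈ S ∧ (p.2 : ℕ∞) < m p.1} =
      ((X.sigma fun x => Finset.range (k x)).map (Equiv.sigmaEquivProd ℝ ℕ).toEmbedding :
        Finset (ℝ × ℕ)) := by
    ext ⟨x, n⟩
    simp only [mem_ofPred_eq, Finset.coe_map, mem_image, SetLike.mem_coe, Finset.mem_sigma,
      Finset.mem_range, Equiv.coe_toEmbedding]
    constructor
    · rintro ⟨hx, hn⟩
      by_cases hxX : x ∈ X
      · rw [hm x hxX, Nat.cast_lt] at hn
        exact ⟨⟨x, n⟩, ⟨hxX, hn⟩, rfl⟩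
      · rw [h0 x hx hxX] at hn
        exact absurd hn not_lt_zero
    · rintro ⟨⟨y, l⟩, ⟨hy, hl⟩, h⟩
      obtain ⟨rfl, rfl⟩ := Prod.mk.inj h
      exact ⟨hX _ hy, by rw [hm _ hy]; exact_mod_cast hl⟩
  rw [countWithMult, h, Set.encard_coe_eq_coe_finsetCard, Finset.card_map, Finset.card_sigma]
  simp only [Finset.card_range]

section Dim

variable {r : ℕ} {𝔽 : Type*} [NormedDivisionRing 𝔽] [StarRing 𝔽] [InnerProductSpace ℝ 𝔽]
  [IsClassicalField 𝔽]

lemma finrank_pos_real : 0 < Module.finrank ℝ 𝔽 := Module.finrank_pos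

/-- The tower law: real dimension is dim 𝔽 times the dimension over the opposite field. It transfers
the real count to the 𝔽-multiplicities. -/
lemma exists_rightDim_eq {V : Type*} [AddCommGroup V] [Module 𝔽ᵐᵒᵖ V] [Module ℝ V]
    [IsScalarTower ℝ 𝔽ᵐᵒᵖ V] {S : Submodule 𝔽ᵐᵒᵖ V} {T : Submodule ℝ V} [FiniteDimensional ℝ T]
    (h : ∀ v, v ∈ S ↔ v ∈ T) :
    ∃ n : ℕ, rightDim S = n ∧ Module.finrank ℝ 𝔽 * n = Module.finrank ℝ T := by
  have hST : S.restrictScalars ℝ = T := Submodule.ext h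
  subst hST
  have : Module.Finite ℝ S := ‹FiniteDimensional ℝ (S.restrictScalars ℝ)›
  have : Module.Finite 𝔽ᵐᵒᵖ S := Module.Finite.of_restrictScalars_finite ℝ 𝔽ᵐᵒᵖ S
  refine ⟨Module.finrank 𝔽ᵐᵒᵖ S, ?_, ?_⟩
  · rw [rightDim, ← Module.finrank_eq_rank]; simp
  · rw [(MulOpposite.opLinearEquiv ℝ : 𝔽 ≃ₗ[ℝ] 𝔽ᵐᵒᵖ).finrank_eq]
    exact Module.finrank_mul_finrank ℝ 𝔽ᵐᵒᵖ S

instance : IsScalarTower ℝ 𝔽ᵐᵒᵖ 𝔽 where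
  smul_assoc t c x := mul_smul_comm t x c.unop

lemma exists_nullity_eq (M : Matrix (Fin r) (Fin r) 𝔽) : ∃ n : ℕ, nullity M = n ∧
    Module.finrank ℝ 𝔽 * n = Module.finrank ℝ (LinearMap.ker (opL M).toLinearMap) := by
  rw [← LinearEquiv.finrank_map_eq (toVec r 𝔽).symm.toLinearEquiv]
  refine exists_rightDim_eq fun v => ?_
  change M *ᵥ v = 0 ↔ _
  rw [Submodule.mem_map]
  constructor
  · intro h
    refine ⟨toVec r 𝔽 v, ?_, (toVec r 𝔽).symm_apply_apply v⟩
    rw [LinearMap.mem_ker]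
    change opL M (toVec r 𝔽 v) = 0
    rw [opL_toVec, h, map_zero]
  · rintro ⟨w, hw, rfl⟩
    have h1 : opL M w = 0 := hw
    exact (toVec r 𝔽).map_eq_zero_iff.1 h1

variable {b : ℝ → Matrix (Fin r) (Fin r) 𝔽} {W : ExtSelfAdjoint r 𝔽} {μ : ℝ} {f : ℝ → Fin r → 𝔽}

lemma IsL2Eigenfunction.op_smul (hf : IsL2Eigenfunction b W μ f) {a : 𝔽}
    (hne : MulOpposite.op a • f ≠ 0) : IsL2Eigenfunction b W μ (MulOpposite.op a • f) where
  zero_of_neg x hx := by rw [Pi.smul_apply, hf.zero_of_neg x hx, smul_zero]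
  ne_zero := hne
  memLp i := by
    let L : 𝔽 →L[ℝ] 𝔽 := LinearMap.toContinuousLinearMap
      { toFun := fun v => v * a
        map_add' := fun v w => add_mul _ _ _
        map_smul' := fun t v => smul_mul_assoc t v a }
    exact L.comp_memLp' (hf.memLp i)
  exists_solution := by
    obtain ⟨g, hs, hbc⟩ := hf.exists_solution
    refine ⟨fun x => MulOpposite.op a • g x, hs.op_smul a, ?_⟩
    have := congrArg (fun v => MulOpposite.op a • v) hbc
    simp only [smul_add, smul_neg, smul_zero, ← mulVec_smul] at this
    exact this

variable {hb : IsNoisePath b} {H' : Hamiltonian (Vec r 𝔽)} {S S' : ℝ → Vec r 𝔽 →L[ℝ] Vec r 𝔽}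
  {c C : ℝ}

/-- Taking the span adds only 0: the eigenfunctions together with 0 are the image of a real
eigenspace, and they are stable under right multiplication by scalars. -/
lemma exists_l2Mult_eq (hg : (airy hb W).IsGauge H' S S') (hH : H'.IsCoercive c C) (μ : ℝ) :
    ∃ n : ℕ, l2Mult b W μ = n ∧
      Module.finrank ℝ 𝔽 * n = Module.finrank ℝ (hH.eigenspace μ) := by
  have hfr : Module.finrank ℝ ((hH.eigenspace μ).map (profile H')) =
      Module.finrank ℝ (hH.eigenspace μ) :=
    (Submodule.equivMapOfInjective (profile H') profile_injective (hH.eigenspace μ)).finrank_eq.symm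
  rw [← hfr]
  refine exists_rightDim_eq fun f => ⟨fun hf => ?_, fun hf => ?_⟩
  · induction hf using Submodule.span_induction with
    | mem f hf => exact ((isL2Eigenfunction_iff hg hH).1 hf).2
    | zero => exact zero_mem _
    | add f f' _ _ h h' => exact add_mem h h'
    | smul a f _ h =>
      by_cases hf : a • f = 0
      · rw [hf]; exact zero_mem _
      · have hf0 : f ≠ 0 := fun h0 => hf (by rw [h0, smul_zero])
        have h1 : IsL2Eigenfunction b W μ f := (isL2Eigenfunction_iff hg hH).2 ⟨hf0, h⟩
        exact ((isL2Eigenfunction_iff hg hH).1 (h1.op_smul (a := a.unop) hf)).2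
  · by_cases hf0 : f = 0
    · rw [hf0]; exact zero_mem _
    · exact Submodule.subset_span ((isL2Eigenfunction_iff hg hH).2 ⟨hf0, hf⟩)

lemma weakMult_eq (hg : (airy hb W).IsGauge H' S S') (hH : H'.IsCoercive c C) :
    weakMult b W = l2Mult b W := by
  funext μ
  unfold weakMult l2Mult
  simp only [isWeakEigenfunction_iff hg hH]

/-- The deterministic form of the theorem: it suffices that the increments of the noise over unit
intervals grow slowly. -/
theorem focalCount_eq_eigenvalueCount (hr : 1 ≤ r) (hb : IsNoisePath b) {C : ℝ}
    (hosc : ∀ x, 0 ≤ x → ∀ t ∈ Icc (0 : ℝ) 1,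
      ‖√2 • opL (b (x + t)) - √2 • opL (b x)‖ ^ 2 ≤ 1 / 10 * x + C)
    (W : ExtSelfAdjoint r 𝔽) {lam : ℝ} {F G : ℝ → Matrix (Fin r) (Fin r) 𝔽}
    (h : IsMatrixSolution b lam F G) (hF : F 0 = W.tildeI) (hG : G 0 = W.tildeW) :
    IsConjoinedBasis b lam F G ∧ focalCount F < ⊤ ∧ focalCount F = l2EigenvalueCount b W lam ∧
      focalCount F = weakEigenvalueCount b W lam := by
  obtain ⟨H', S, S', c, C', hg, hH⟩ := (airy hb W).exists_isCoercive_isGauge (r := (r : ℝ))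
    (by exact_mod_cast hr) (fun x => rfl) hosc
  obtain ⟨X, t, hX, ht, hX0, ht0, hsum⟩ :=
    hH.exists_sum_finrank_eq (hg.isFrame (isFrame_airy hb W h hF hG))
  choose n hn hn' using fun x => exists_nullity_eq (F x)
  choose m hm hm' using fun μ => exists_l2Mult_eq hg hH μ
  have hβ := finrank_pos_real (𝔽 := 𝔽)
  have h1 : focalCount F = (∑ x ∈ X, n x : ℕ) := by
    refine countWithMult_eq_sum hX (fun x _ => hn x) fun x hx hxX => ?_
    have h2 := hn' x
    rw [hX0 x hx hxX, finrank_bot] at h2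
    rw [hn x, (mul_eq_zero.1 h2).resolve_left hβ.ne', Nat.cast_zero]
  have h2 : l2EigenvalueCount b W lam = (∑ μ ∈ t, m μ : ℕ) := by
    refine countWithMult_eq_sum ht (fun x _ => hm x) fun x hx hxX => ?_
    have h2 := hm' x
    rw [ht0 x hx hxX, finrank_bot] at h2
    rw [hm x, (mul_eq_zero.1 h2).resolve_left hβ.ne', Nat.cast_zero]
  have h3 : ∑ x ∈ X, n x = ∑ μ ∈ t, m μ := by
    simp only [← hn', ← hm', ← Finset.mul_sum] at hsum
    exact Nat.eq_of_mul_eq_mul_left hβ hsum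
  have h4 : focalCount F = l2EigenvalueCount b W lam := by rw [h1, h2, h3]
  refine ⟨isConjoinedBasis hb W h hF hG, by rw [h1]; exact ENat.natCast_lt_top _, h4, ?_⟩
  rw [h4, l2EigenvalueCount, weakEigenvalueCount, weakMult_eq hg hH]

end Dim

end StochasticAiry

namespace StochasticAiry

/-! ### Growth of the increments of Brownian motion -/

section Chaining

variable {E : Type*} [NormedAddCommGroup E]

/-- Chaining along the dyadic points of an interval of length one. -/
lemma norm_sub_le_of_dyadic {z : ℝ → E} (hz : Continuous z) {a m : ℝ}
    (h : ∀ k j : ℕ, j < 2 ^ k →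
      ‖z (a + (j + 1) / 2 ^ k) - z (a + j / 2 ^ k)‖ ≤ m * (9 / 10) ^ k) {t : ℝ}
    (ht : t ∈ Icc (0 : ℝ) 1) : ‖z (a + t) - z a‖ ≤ 10 * m := by
  have h00 : ‖z (a + 1) - z a‖ ≤ m := by simpa using h 0 0 (by simp)
  have hm : 0 ≤ m := (norm_nonneg _).trans h00
  -- The endpoint t = 1 is the single step at level 0; for t < 1 the dyadic approximations start
  -- from 0.
  rcases ht.2.eq_or_lt with rfl | ht1
  · linarith
  set d : ℕ → ℝ := fun k => (⌊2 ^ k * t⌋₊ : ℝ) / 2 ^ k with hd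
  have hstep : ∀ k, dist (z (a + d k)) (z (a + d (k + 1))) ≤ m * (9 / 10) ^ (k + 1) := by
    intro k
    set j := ⌊2 ^ k * t⌋₊ with hj
    have h0 : 0 ≤ 2 ^ k * t := mul_nonneg (by positivity) ht.1
    have hj1 : (j : ℝ) ≤ 2 ^ k * t := Nat.floor_le h0
    have hj2 : 2 ^ k * t < j + 1 := Nat.lt_floor_add_one _
    have hjk : j < 2 ^ k := by
      have : (j : ℝ) < 2 ^ k := by nlinarith [show (0 : ℝ) < 2 ^ k by positivity]
      exact_mod_cast this
    have h2 : (j : ℝ) / 2 ^ k = ((2 * j : ℕ) : ℝ) / 2 ^ (k + 1) := by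
      push_cast; rw [pow_succ]; field_simp
    -- Consecutive dyadic lower approximations of t either coincide or differ by one cell of the
    -- finer level, so each step costs at most one increment.
    have hfl : ⌊2 ^ (k + 1) * t⌋₊ = 2 * j ∨ ⌊2 ^ (k + 1) * t⌋₊ = 2 * j + 1 := by
      have h3 : 2 * j ≤ ⌊2 ^ (k + 1) * t⌋₊ := Nat.le_floor (by push_cast; rw [pow_succ]; linarith)
      have h4 : ⌊2 ^ (k + 1) * t⌋₊ < 2 * j + 2 := (Nat.floor_lt (mul_nonneg (by positivity) ht.1)).2 (by
        push_cast; rw [pow_succ]; linarith)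
      omega
    have hdk : d k = ((2 * j : ℕ) : ℝ) / 2 ^ (k + 1) := h2
    rcases hfl with h5 | h5
    · have : d (k + 1) = d k := by rw [hdk, hd]; simp only [h5]
      rw [this, dist_self]
      positivity
    · have : d (k + 1) = (((2 * j : ℕ) : ℝ) + 1) / 2 ^ (k + 1) := by
        rw [hd]; simp only [h5]; push_cast; rfl
      rw [this, hdk, dist_comm, dist_eq_norm]
      exact h (k + 1) (2 * j) (by rw [pow_succ]; omega)
  have hsum : ∀ K, ‖z (a + d K) - z a‖ ≤ 10 * m := by
    intro K
    have h1 := dist_le_range_sum_dist (fun k => z (a + d k)) K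
    have hd0 : d 0 = 0 := by
      rw [hd]; simp [ht1]
    simp only [hd0, add_zero] at h1
    rw [dist_comm, dist_eq_norm] at h1
    refine h1.trans ((Finset.sum_le_sum fun k _ => hstep k).trans ?_)
    have h2 : ∀ K : ℕ, ∑ k ∈ Finset.range K, m * (9 / 10 : ℝ) ^ (k + 1) =
        9 * m * (1 - (9 / 10) ^ K) := by
      intro K
      induction K with
      | zero => simp
      | succ K ih => rw [Finset.sum_range_succ, ih]; ring
    rw [h2]
    have : (0 : ℝ) ≤ (9 / 10) ^ K := by positivity
    nlinarith
  have hlim : Filter.Tendsto d Filter.atTop (nhds t) := by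
    have h1 : Filter.Tendsto (fun k : ℕ => t - 1 / 2 ^ k) Filter.atTop (nhds (t - 0)) := by
      refine tendsto_const_nhds.sub ?_
      simpa [one_div] using tendsto_pow_atTop_nhds_zero_of_lt_one (r := (2⁻¹ : ℝ))
        (by norm_num) (by norm_num)
    rw [sub_zero] at h1
    refine tendsto_of_tendsto_of_tendsto_of_le_of_le h1 tendsto_const_nhds (fun k => ?_) fun k => ?_
    · have h2 := Nat.lt_floor_add_one (2 ^ k * t)
      have h3 : (0 : ℝ) < 2 ^ k := by positivity
      change t - 1 / 2 ^ k ≤ _ / _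
      rw [le_div_iff₀ h3, sub_mul, div_mul_cancel₀ _ h3.ne']
      linarith
    · have h2 := Nat.floor_le (mul_nonneg (by positivity) ht.1 : 0 ≤ 2 ^ k * t)
      change _ / _ ≤ t
      rw [div_le_iff₀ (by positivity)]
      linarith
  have hlim2 : Filter.Tendsto (fun k => ‖z (a + d k) - z a‖) Filter.atTop
      (nhds ‖z (a + t) - z a‖) :=
    (((hz.tendsto _).comp (hlim.const_add a)).sub_const _).norm
  exact le_of_tendsto hlim2 (Filter.Eventually.of_forall hsum)

/-- An interval of length at most 1 meets at most two consecutive unit cells, so chaining in each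
cell bounds the increment by the cell constants. Their squares √(y n) are o(n), and the finitely
many exceptional cells enter the constant C. -/
lemma exists_norm_sub_sq_le {z : ℝ → E} (hz : Continuous z) {y : ℕ → ℝ}
    (h : ∀ n k j : ℕ, j < 2 ^ k →
      ‖z (n + (j + 1) / 2 ^ k) - z (n + j / 2 ^ k)‖ ≤ √√(y n) * (9 / 10) ^ k)
    (hy : ∀ η : ℝ, 0 < η → ∃ N, ∀ n ≥ N, √(y n) ≤ η * (n + 1)) {ε : ℝ} (hε : 0 < ε) :
    ∃ C, ∀ x, 0 ≤ x → ∀ t ∈ Icc (0 : ℝ) 1, ‖z (x + t) - z x‖ ^ 2 ≤ ε * x + C := by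
  -- The increment is at most 20ρ + 10ρ', whose square is at most 800ρ² + 200ρ'²; hence 1000 = 800 +
  -- 200.
  set η := ε / 1000 with hη
  have hη0 : 0 < η := by positivity
  obtain ⟨N, hN⟩ := hy η hη0
  set C₀ := ∑ n ∈ Finset.range N, √(y n) with hC₀
  have hC0 : 0 ≤ C₀ := Finset.sum_nonneg fun _ _ => Real.sqrt_nonneg _
  have hb : ∀ n : ℕ, √(y n) ≤ η * (n + 1) + C₀ := by
    intro n
    rcases le_or_gt N n with hn | hn
    · linarith [hN n hn]
    · have h1 : √(y n) ≤ C₀ := Finset.single_le_sum (f := fun n => √(y n))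
        (fun _ _ => Real.sqrt_nonneg _) (Finset.mem_range.2 hn)
      have : 0 ≤ η * ((n : ℝ) + 1) := by positivity
      linarith
  refine ⟨2 * ε + 1000 * C₀, fun x hx t ht => ?_⟩
  set n := ⌊x⌋₊ with hn
  have hn1 : (n : ℝ) ≤ x := Nat.floor_le hx
  have hn2 : x < n + 1 := Nat.lt_floor_add_one x
  set ρ := √√(y n) with hρ
  set ρ' := √√(y (n + 1)) with hρ'
  have e1 : ∀ s ∈ Icc (0 : ℝ) 1, ‖z (n + s) - z n‖ ≤ 10 * ρ := fun s hs =>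
    norm_sub_le_of_dyadic hz (h n) hs
  have e2 : ∀ s ∈ Icc (0 : ℝ) 1, ‖z (n + 1 + s) - z (n + 1)‖ ≤ 10 * ρ' := fun s hs =>
    norm_sub_le_of_dyadic hz (by simpa using h (n + 1)) hs
  have h0 : 0 ≤ ρ := Real.sqrt_nonneg _
  have h0' : 0 ≤ ρ' := Real.sqrt_nonneg _
  have ex : ‖z x - z n‖ ≤ 10 * ρ := by
    simpa using e1 (x - n) ⟨by linarith, by linarith⟩
  have hmain : ‖z (x + t) - z x‖ ≤ 20 * ρ + 10 * ρ' := by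
    rcases le_or_gt (x + t) (n + 1) with hxt | hxt
    · have e3 := e1 (x + t - n) ⟨by linarith [ht.1], by linarith⟩
      rw [add_sub_cancel] at e3
      have := norm_sub_le (z (x + t) - z n) (z x - z n)
      rw [sub_sub_sub_cancel_right] at this
      linarith
    · have e3 := e2 (x + t - (n + 1)) ⟨by linarith [ht.1], by linarith [ht.2]⟩
      rw [add_sub_cancel] at e3
      have e4 := e1 1 (by simp)
      have : z (x + t) - z x = (z (x + t) - z (n + 1)) + ((z (n + 1) - z n) - (z x - z n)) := by abel
      rw [this]
      have h5 := norm_add_le (z (x + t) - z (n + 1)) ((z (n + 1) - z n) - (z x - z n))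
      have h6 := norm_sub_le (z (n + 1) - z n) (z x - z n)
      linarith
  have s1 : ρ ^ 2 = √(y n) := Real.sq_sqrt (Real.sqrt_nonneg _)
  have s2 : ρ' ^ 2 = √(y (n + 1)) := Real.sq_sqrt (Real.sqrt_nonneg _)
  have b1 := hb n
  have b2 := hb (n + 1)
  push_cast at b2
  calc ‖z (x + t) - z x‖ ^ 2 ≤ (20 * ρ + 10 * ρ') ^ 2 := by gcongr
    _ ≤ 800 * ρ ^ 2 + 200 * ρ' ^ 2 := by nlinarith [sq_nonneg (20 * ρ - 10 * ρ')]
    _ ≤ 800 * (η * (n + 1) + C₀) + 200 * (η * (n + 1 + 1) + C₀) := by rw [s1, s2]; linarith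
    _ ≤ ε * x + (2 * ε + 1000 * C₀) := by rw [show ε = 1000 * η by rw [hη]; ring]; nlinarith

/-- A process with fourth moments of increments as those of Brownian motion has increments over
unit intervals that are almost surely `o(√x)`. -/
lemma ae_exists_norm_sub_sq_le {Ω : Type*} [MeasurableSpace Ω] {P : Measure Ω} {Z : ℝ → Ω → E}
    (hc : ∀ᵐ ω ∂P, Continuous fun x => Z x ω) {K : ℝ} (hK : 0 ≤ K)
    (hm : ∀ s t, 0 ≤ s → s ≤ t → AEMeasurable (fun ω => ‖Z t ω - Z s ω‖) P)
    (hZ : ∀ s t, 0 ≤ s → s ≤ t →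
      ∫⁻ ω, ENNReal.ofReal (‖Z t ω - Z s ω‖ ^ 4) ∂P ≤ ENNReal.ofReal (K * (t - s) ^ 2))
    {ε : ℝ} (hε : 0 < ε) :
    ∀ᵐ ω ∂P, ∃ C, ∀ x, 0 ≤ x → ∀ t ∈ Icc (0 : ℝ) 1, ‖Z (x + t) ω - Z x ω‖ ^ 2 ≤ ε * x + C := by
  set D : ℕ → ℕ → ℕ → Ω → ℝ := fun n k j ω =>
    ‖Z (n + (j + 1) / 2 ^ k) ω - Z (n + j / 2 ^ k) ω‖ with hD
  have hle : ∀ n k j : ℕ, (n : ℝ) + j / 2 ^ k ≤ n + (j + 1) / 2 ^ k := fun n k j => by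
    gcongr; linarith
  have hDm : ∀ n k j, AEMeasurable (D n k j) P := fun n k j => hm _ _ (by positivity) (hle n k j)
  set T : ℕ → ℕ → ℕ → Ω → ℝ≥0∞ := fun n k j ω =>
    ENNReal.ofReal (((10 / 9) ^ k * D n k j ω) ^ 4) with hT
  have hTm : ∀ n k j, AEMeasurable (T n k j) P := fun n k j =>
    (((hDm n k j).const_mul _).pow_const 4).ennreal_ofReal
  have hTi : ∀ n k j, ∫⁻ ω, T n k j ω ∂P ≤
      ENNReal.ofReal (K * (((10 / 9) ^ k) ^ 4 * ((1 / 2) ^ k) ^ 2)) := by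
    intro n k j
    have h1 := hZ (n + j / 2 ^ k) (n + (j + 1) / 2 ^ k) (by positivity) (hle n k j)
    have h2 : ∀ ω, T n k j ω = ENNReal.ofReal (((10 / 9) ^ k) ^ 4) *
        ENNReal.ofReal (‖Z (n + (j + 1) / 2 ^ k) ω - Z (n + j / 2 ^ k) ω‖ ^ 4) := fun ω => by
      rw [hT, ← ENNReal.ofReal_mul (by positivity), ← mul_pow]
    simp only [h2]
    rw [lintegral_const_mul' _ _ ENNReal.ofReal_ne_top]
    refine (mul_le_mul_right h1 _).trans (le_of_eq ?_)
    rw [← ENNReal.ofReal_mul (by positivity)]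
    congr 1
    rw [show (n : ℝ) + (j + 1) / 2 ^ k - (n + j / 2 ^ k) = (1 / 2) ^ k by
      rw [one_div, inv_pow]; field_simp; ring]
    ring
  set M : ℕ → Ω → ℝ≥0∞ := fun n ω => ∑' k, ∑ j ∈ Finset.range (2 ^ k), T n k j ω with hM
  have hMm : ∀ n, AEMeasurable (M n) P := fun n =>
    AEMeasurable.tsum fun k => Finset.aemeasurable_fun_sum _ fun j _ => hTm n k j
  -- Level k has 2^k increments, each with fourth moment of order 4^{-k}, weighted by (10/9)^{4k}.
  -- The total is of order q^k with q < 1, so the sum over levels is finite uniformly in the cell.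
  set q : ℝ := (10 / 9) ^ 4 / 2 with hq
  set L : ℝ := ∑' k : ℕ, K * q ^ k with hL
  have hMi : ∀ n, ∫⁻ ω, M n ω ∂P ≤ ENNReal.ofReal L := by
    intro n
    rw [hM, lintegral_tsum fun k => Finset.aemeasurable_fun_sum _ fun j _ => hTm n k j, hL,
      ENNReal.ofReal_tsum_of_nonneg (fun k => by positivity)
        ((summable_geometric_of_lt_one (by norm_num [hq]) (by norm_num [hq])).mul_left K)]
    refine ENNReal.tsum_le_tsum fun k => ?_
    rw [lintegral_finsetSum' _ fun j _ => hTm n k j]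
    refine (Finset.sum_le_sum fun j _ => hTi n k j).trans (le_of_eq ?_)
    rw [Finset.sum_const, Finset.card_range, nsmul_eq_mul,
      show ((2 ^ k : ℕ) : ℝ≥0∞) = ENNReal.ofReal (2 ^ k) by
        rw [ENNReal.ofReal_pow (by norm_num)]; simp,
      ← ENNReal.ofReal_mul (by positivity)]
    congr 1
    have h3 : (2 : ℝ) ^ k * (((10 / 9) ^ k) ^ 4 * ((1 / 2) ^ k) ^ 2) = q ^ k := by
      rw [← pow_mul, ← pow_mul, mul_comm k 4, mul_comm k 2, pow_mul, pow_mul, ← mul_pow, ← mul_pow, hq]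
      norm_num
    rw [← h3]; ring
  set w : ℕ → ℝ := fun n => 1 / ((n : ℝ) + 1) ^ 2 with hw
  have hws : Summable w := by
    have := (summable_nat_add_iff 1).2 (Real.summable_one_div_nat_pow.2 one_lt_two)
    simpa [hw] using this
  -- Summing expectations against 1/(n + 1)² shows almost surely M n = o(n²), so √(M n) = o(n), as
  -- the chaining lemma requires.
  have hfin : ∀ᵐ ω ∂P, ∑' n, ENNReal.ofReal (w n) * M n ω < ⊤ := by
    refine ae_lt_top' (AEMeasurable.tsum fun n => (hMm n).const_mul _) ?_
    rw [lintegral_tsum fun n => (hMm n).const_mul _]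
    have h1 : ∑' n, ∫⁻ ω, ENNReal.ofReal (w n) * M n ω ∂P ≤
        ∑' n, ENNReal.ofReal (w n) * ENNReal.ofReal L := ENNReal.tsum_le_tsum fun n => by
      rw [lintegral_const_mul' _ _ ENNReal.ofReal_ne_top]
      exact mul_le_mul_right (hMi n) _
    refine ne_top_of_le_ne_top ?_ h1
    rw [ENNReal.tsum_mul_right, ← ENNReal.ofReal_tsum_of_nonneg (fun n => by positivity) hws]
    exact ENNReal.mul_ne_top ENNReal.ofReal_ne_top ENNReal.ofReal_ne_top
  filter_upwards [hc, hfin] with ω hcω hω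
  have hMf : ∀ n, M n ω ≠ ⊤ := by
    intro n h
    have h1 : ENNReal.ofReal (w n) * M n ω ≠ ⊤ := ne_top_of_le_ne_top hω.ne (ENNReal.le_tsum n)
    rw [h, ENNReal.mul_top (by simp only [ne_eq, ENNReal.ofReal_eq_zero, not_le]; positivity)] at h1
    exact h1 rfl
  refine exists_norm_sub_sq_le hcω (y := fun n => (M n ω).toReal) ?_ ?_ hε
  · intro n k j hj
    have h1 : T n k j ω ≤ M n ω := (Finset.single_le_sum (f := fun j => T n k j ω)
      (fun _ _ => zero_le) (Finset.mem_range.2 hj)).trans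
        (ENNReal.le_tsum (f := fun k => ∑ j ∈ Finset.range (2 ^ k), T n k j ω) k)
    have h2 := ENNReal.toReal_mono (hMf n) h1
    rw [hT, ENNReal.toReal_ofReal (by positivity)] at h2
    have h3 : (10 / 9) ^ k * D n k j ω ≤ √√(M n ω).toReal := by
      refine Real.le_sqrt_of_sq_le (Real.le_sqrt_of_sq_le ?_)
      rw [← pow_mul]; exact h2
    have h4 : ((9 : ℝ) / 10) ^ k * (10 / 9) ^ k = 1 := by rw [← mul_pow]; norm_num
    calc D n k j ω = (9 / 10) ^ k * ((10 / 9) ^ k * D n k j ω) := by rw [← mul_assoc, h4, one_mul]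
      _ ≤ (9 / 10) ^ k * √√(M n ω).toReal := by gcongr
      _ = _ := mul_comm _ _
  · intro η hη
    have h1 := ENNReal.tendsto_cofinite_zero_of_tsum_ne_top hω.ne
    rw [Nat.cofinite_eq_atTop] at h1
    have h2 := h1.eventually (ge_mem_nhds (ENNReal.ofReal_pos.2 (by positivity : 0 < η ^ 2)))
    obtain ⟨N, hN⟩ := Filter.eventually_atTop.1 h2
    refine ⟨N, fun n hn => ?_⟩
    have h3 := ENNReal.toReal_mono ENNReal.ofReal_ne_top (hN n hn)
    rw [ENNReal.toReal_mul, ENNReal.toReal_ofReal (by positivity),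
      ENNReal.toReal_ofReal (by positivity), hw, one_div_mul_eq_div, div_le_iff₀ (by positivity)] at h3
    refine Real.sqrt_le_iff.2 ⟨by positivity, ?_⟩
    rwa [mul_pow]

end Chaining

/-! ### Fourth moments of the Gaussian ensemble and the noise path -/

section Gaussian

variable {r : ℕ} {𝔽 : Type*} [NormedDivisionRing 𝔽] [StarRing 𝔽] [InnerProductSpace ℝ 𝔽]
  [IsClassicalField 𝔽] [MeasurableSpace 𝔽] [BorelSpace 𝔽]

instance : SecondCountableTopology 𝔽 :=
  have : ProperSpace 𝔽 := FiniteDimensional.proper ℝ 𝔽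
  inferInstance

lemma measurable_smul_scalar (c : ℝ) : Measurable fun z : 𝔽 => c • z :=
  (continuous_const_smul c).measurable

instance : IsProbabilityMeasure (gaussianScalar 𝔽) :=
  Measure.isProbabilityMeasure_map (measurable_smul_scalar _).aemeasurable

lemma memLp_gaussianScalar : MemLp id 4 (gaussianScalar 𝔽) := by
  have : CompleteSpace 𝔽 := FiniteDimensional.complete ℝ 𝔽
  rw [gaussianScalar, memLp_map_measure_iff aestronglyMeasurable_id
    (measurable_smul_scalar _).aemeasurable]
  exact (IsGaussian.memLp_id (stdGaussian 𝔽) 4 (by simp)).const_smul _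

lemma measurable_matrix_entry (i j : Fin r) :
    Measurable fun A : Matrix (Fin r) (Fin r) 𝔽 => A i j :=
  (measurable_pi_apply j).comp (measurable_pi_apply i)

lemma measurable_matrix_of {α : Type*} [MeasurableSpace α] {f : α → Matrix (Fin r) (Fin r) 𝔽}
    (h : ∀ i j, Measurable fun a => f a i j) : Measurable f :=
  measurable_pi_iff.2 fun i => measurable_pi_iff.2 fun j => h i j

lemma measurable_hermitianPart : Measurable fun X : Fin r → Fin r → 𝔽 =>
    (√2 : ℝ)⁻¹ • (Matrix.of X + (Matrix.of X)ᴴ) := by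
  refine measurable_matrix_of fun i j => ?_
  have h : ∀ i j, Measurable fun X : Fin r → Fin r → 𝔽 => X i j := fun i j =>
    (measurable_pi_apply j).comp (measurable_pi_apply i)
  exact (measurable_smul_scalar _).comp
    ((h i j).add (IsClassicalField.continuous_star.measurable.comp (h j i)))

lemma memLp_gaussianEnsemble (i j : Fin r) :
    MemLp (fun A : Matrix (Fin r) (Fin r) 𝔽 => A i j) 4 (gaussianEnsemble r 𝔽) := by
  rw [gaussianEnsemble, memLp_map_measure_iff (measurable_matrix_entry i j).aestronglyMeasurable
    measurable_hermitianPart.aemeasurable]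
  have h : ∀ i j, MemLp (fun X : Fin r → Fin r → 𝔽 => X i j) 4
      (Measure.pi fun _ : Fin r => Measure.pi fun _ : Fin r => gaussianScalar 𝔽) := fun i j =>
    memLp_gaussianScalar.comp_measurePreserving
      ((measurePreserving_eval (fun _ : Fin r => gaussianScalar 𝔽) j).comp (measurePreserving_eval
        (fun _ : Fin r => Measure.pi fun _ : Fin r => gaussianScalar 𝔽) i))
  have hs : MemLp (fun X : Fin r → Fin r → 𝔽 => star (X j i)) 4
      (Measure.pi fun _ : Fin r => Measure.pi fun _ : Fin r => gaussianScalar 𝔽) :=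
    (h j i).of_le (IsClassicalField.continuous_star.comp_aestronglyMeasurable
      (h j i).aestronglyMeasurable)
      (Filter.Eventually.of_forall fun X => (IsClassicalField.norm_star_eq _).le)
  exact ((h i j).add hs).const_smul _

lemma lintegral_gaussianEnsemble_lt_top (i j : Fin r) :
    ∫⁻ A, ENNReal.ofReal (‖A i j‖ ^ 4) ∂(gaussianEnsemble r 𝔽) < ⊤ := by
  have h := (memLp_gaussianEnsemble (𝔽 := 𝔽) i j).integrable_norm_pow (p := 4) (by norm_num)
  exact (hasFiniteIntegral_iff_ofReal (Filter.Eventually.of_forall fun A => by positivity)).1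
    h.hasFiniteIntegral

variable {Ω : Type*} [MeasurableSpace Ω] {P : Measure Ω} {B : ℝ≥0 → Ω → Matrix (Fin r) (Fin r) 𝔽}

lemma IsStandardMatrixBM.aemeasurable_entry (hB : IsStandardMatrixBM B P) (i j : Fin r) {s t : ℝ≥0}
    (hst : s ≤ t) : AEMeasurable (fun ω => ‖B t ω i j - B s ω i j‖) P :=
  ((measurable_matrix_entry i j).comp_aemeasurable (hB.law_increments s t hst).aemeasurable).norm

lemma IsStandardMatrixBM.lintegral_entry (hB : IsStandardMatrixBM B P) (i j : Fin r) {s t : ℝ≥0}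
    (hst : s ≤ t) : ∫⁻ ω, ENNReal.ofReal (‖B t ω i j - B s ω i j‖ ^ 4) ∂P =
      ENNReal.ofReal (((t : ℝ) - s) ^ 2) *
        ∫⁻ A, ENNReal.ofReal (‖A i j‖ ^ 4) ∂(gaussianEnsemble r 𝔽) := by
  have hst' : (0 : ℝ) ≤ (t : ℝ) - s := sub_nonneg.2 (NNReal.coe_le_coe.2 hst)
  have hf : Measurable fun A : Matrix (Fin r) (Fin r) 𝔽 => ENNReal.ofReal (‖A i j‖ ^ 4) :=
    ((measurable_matrix_entry i j).norm.pow_const 4).ennreal_ofReal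
  have h1 := (hB.law_increments s t hst).lintegral_comp hf.aemeasurable
  have h2 : Measurable fun A : Matrix (Fin r) (Fin r) 𝔽 => √((t : ℝ) - s) • A :=
    measurable_matrix_of fun i j => (measurable_smul_scalar _).comp (measurable_matrix_entry i j)
  refine h1.trans ?_
  rw [lintegral_map hf h2, ← lintegral_const_mul' _ _ ENNReal.ofReal_ne_top]
  refine lintegral_congr fun A => ?_
  rw [Matrix.smul_apply, norm_smul, mul_pow, ENNReal.ofReal_mul (by positivity), Real.norm_eq_abs,
    abs_of_nonneg (Real.sqrt_nonneg _), show √((t : ℝ) - s) ^ 4 = (√((t : ℝ) - s) ^ 2) ^ 2 by ring,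
    Real.sq_sqrt hst']

lemma IsStandardMatrixBM.ae_entry (hB : IsStandardMatrixBM B P) (i j : Fin r) {ε : ℝ} (hε : 0 < ε) :
    ∀ᵐ ω ∂P, ∃ C, ∀ x, 0 ≤ x → ∀ t ∈ Icc (0 : ℝ) 1,
      ‖noisePath B ω (x + t) i j - noisePath B ω x i j‖ ^ 2 ≤ ε * x + C := by
  have hK := lintegral_gaussianEnsemble_lt_top (𝔽 := 𝔽) i j
  refine ae_exists_norm_sub_sq_le (Z := fun x ω => noisePath B ω x i j)
    (K := (∫⁻ A, ENNReal.ofReal (‖A i j‖ ^ 4) ∂(gaussianEnsemble r 𝔽)).toReal) ?_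
    ENNReal.toReal_nonneg (fun s t _ hst => hB.aemeasurable_entry i j (Real.toNNReal_le_toNNReal hst))
    (fun s t hs hst => ?_) hε
  · filter_upwards [hB.continuous_paths] with ω hω
    exact (hω.comp continuous_real_toNNReal).matrix_elem i j
  · refine (hB.lintegral_entry i j (Real.toNNReal_le_toNNReal hst)).le.trans (le_of_eq ?_)
    rw [Real.coe_toNNReal _ hs, Real.coe_toNNReal _ (hs.trans hst), mul_comm (ENNReal.toReal _),
      ENNReal.ofReal_mul (by positivity), ENNReal.ofReal_toReal hK.ne]

lemma sq_norm_opL_le (M : Matrix (Fin r) (Fin r) 𝔽) :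
    ‖opL M‖ ^ 2 ≤ (r : ℝ) ^ 2 * ∑ i, ∑ j, ‖M i j‖ ^ 2 := by
  have h1 := norm_opL_le M
  calc ‖opL M‖ ^ 2 ≤ (∑ i, ∑ j, ‖M i j‖) ^ 2 := by gcongr
    _ = (∑ p : Fin r × Fin r, ‖M p.1 p.2‖) ^ 2 := by rw [Fintype.sum_prod_type]
    _ ≤ (Finset.univ : Finset (Fin r × Fin r)).card * ∑ p : Fin r × Fin r, ‖M p.1 p.2‖ ^ 2 :=
      sq_sum_le_card_mul_sum_sq
    _ = _ := by
      rw [Fintype.sum_prod_type, Finset.card_univ, Fintype.card_prod, Fintype.card_fin]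
      push_cast; ring

lemma IsStandardMatrixBM.ae_isNoisePath (hB : IsStandardMatrixBM B P) :
    ∀ᵐ ω ∂P, IsNoisePath (noisePath B ω) := by
  filter_upwards [hB.continuous_paths, hB.selfAdjoint] with ω h1 h2
  exact ⟨h1.comp continuous_real_toNNReal, fun x => h2 _⟩

lemma IsStandardMatrixBM.ae_increment_le (hB : IsStandardMatrixBM B P) (hr : 1 ≤ r) :
    ∀ᵐ ω ∂P, ∃ C, ∀ x, 0 ≤ x → ∀ t ∈ Icc (0 : ℝ) 1,
      ‖√2 • opL (noisePath B ω (x + t)) - √2 • opL (noisePath B ω x)‖ ^ 2 ≤ 1 / 10 * x + C := by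
  have hr0 : (0 : ℝ) < r := by exact_mod_cast hr
  -- Passing from entries to the operator costs r² in the norm bound, r² for the number of entries
  -- and 2 from the factor √2; 2 r⁴ / (20 r⁴) is the required 1/10.
  have h := fun i j => hB.ae_entry i j (ε := 1 / (20 * (r : ℝ) ^ 4)) (by positivity)
  filter_upwards [ae_all_iff.2 fun i => ae_all_iff.2 (h i)] with ω hω
  choose C hC using hω
  refine ⟨(r : ℝ) ^ 2 * ∑ i, ∑ j, 2 * C i j, fun x hx t ht => ?_⟩
  rw [← opL_smul, ← opL_smul, ← opL_sub, ← smul_sub]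
  refine (sq_norm_opL_le _).trans ?_
  calc _ ≤ (r : ℝ) ^ 2 * ∑ i, ∑ j, (2 * (1 / (20 * (r : ℝ) ^ 4) * x) + 2 * C i j) := by
        gcongr with i _ j _
        rw [Matrix.smul_apply, norm_smul, mul_pow, Real.norm_eq_abs, sq_abs,
          Real.sq_sqrt (by norm_num), ← mul_add]
        gcongr
        exact hC i j x hx t ht
    _ = _ := by
      simp only [Finset.sum_add_distrib, Finset.sum_const, Finset.card_univ, Fintype.card_fin,
        nsmul_eq_mul]
      field_simp
      ring

end Gaussian

end StochasticAiry

theorem theorem5 {𝔽 : Type*} [NormedDivisionRing 𝔽] [StarRing 𝔽] [InnerProductSpace ℝ 𝔽]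
    [StochasticAiry.IsClassicalField 𝔽] [MeasurableSpace 𝔽] [BorelSpace 𝔽]
    {Ω : Type*} [MeasurableSpace Ω] (P : Measure Ω) [IsProbabilityMeasure P]
    (r : ℕ) (hr : 1 ≤ r) (B : ℝ≥0 → Ω → Matrix (Fin r) (Fin r) 𝔽)
    (hB : StochasticAiry.IsStandardMatrixBM B P) :
    ∀ᵐ ω ∂P, ∀ (W : StochasticAiry.ExtSelfAdjoint r 𝔽) (lam : ℝ)
      (F G : ℝ → Matrix (Fin r) (Fin r) 𝔽),
      StochasticAiry.IsMatrixSolution (StochasticAiry.noisePath B ω) lam F G →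
      F 0 = W.tildeI → G 0 = W.tildeW →
      StochasticAiry.IsConjoinedBasis (StochasticAiry.noisePath B ω) lam F G ∧
      StochasticAiry.focalCount F < ⊤ ∧
      StochasticAiry.focalCount F =
        StochasticAiry.l2EigenvalueCount (StochasticAiry.noisePath B ω) W lam ∧
      StochasticAiry.focalCount F =
        StochasticAiry.weakEigenvalueCount (StochasticAiry.noisePath B ω) W lam := by
  -- The exceptional null set concerns only the path, so it serves all boundary conditions and
  -- spectral parameters at once.
  filter_upwards [hB.ae_isNoisePath, hB.ae_increment_le hr] with ω hb hosc W lam F G h hF hG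
  obtain ⟨C, hC⟩ := hosc
  exact StochasticAiry.focalCount_eq_eigenvalueCount hr hb hC W h hF hG

end
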